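/- Let $n\ge 1$. For $\lambda\in\mathbb C$ with $\operatorname{Re}\lambda>0$ let $(x_1\cdots x_n)_+^\lambda$ be the distribution on $\mathbb R^n$ given by the locally integrable function equal to $\exp(\lambda\log(x_1\cdots x_n))$ where $x_1\cdots x_n>0$ and to $0$ elsewhere. It extends to a distribution-valued meromorphic function of $\lambda$ on the whole complex plane, which is again denoted by $(x_1\cdots x_n)_+^\lambda$. This function has a pole of order $n$ at $\lambda=-1$. Let \[ (x_1\cdots x_n)_+^\lambda=\sum_{j=-n}^{\infty}(\lambda+1)^j u_j \] be its Laurent expansion about $\lambda=-1$, where the $u_j$ are (complex-valued Schwartz) distributions on $\mathbb R^n$. Let $\mathcal D_0$ be the ring of germs at the origin $0\in\mathbb R^n$ of linear differential operators whose coefficients are complex-valued real analytic functions, and for a distribution $u$ on $\mathbb R^n$ let $\operatorname{Ann}_{\mathcal D_0}u$ be the left ideal of the germs $P\in\mathcal D_0$ such that $Pu=0$ on a neighborhood of $0$. Then, for each $k=0,1,\dots,n-1$, $\operatorname{Ann}_{\mathcal D_0}u_{-n+k}$ is the left ideal of $\mathcal D_0$ generated by \[ x_{j_1}\cdots x_{j_{k+1}}\quad(1\le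 j_1<\cdots<j_{k+1}\le n),\qquad x_1\partial_1-x_i\partial_i\quad(2\le i\le n), \] where $\partial_i=\partial/\partial x_i$. -/

import Mathlib

open Filter Topology MeasureTheory TopologicalSpace
open scoped Distributions ContDiff

noncomputable section

/-- The space `ℝⁿ`, with its product topology and Lebesgue measure. -/
abbrev RSpace (n : ℕ) : Type := Fin n → ℝ

/-! ### Distributions and the complex power -/

/-- Complex-valued Schwartz distributions on an open set `Ω ⊆ ℝⁿ`: continuous `ℂ`-linear
functionals on the complex-valued test functions (with the canonical LF topology). -/
abbrev CDistribution {n : ℕ} (Ω : Opens (RSpace n)) : Type := 𝓓(Ω, ℂ) →L[ℂ] ℂ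

/-- `t_+^s`, equal to `exp (s log t)` for `t > 0` and to `0` for `t ≤ 0`. -/
def plusPow (t : ℝ) (s : ℂ) : ℂ :=
  if 0 < t then Complex.exp (s * (Real.log t : ℂ)) else 0

/-- `F s = ∑ⱼ (s - s₀)ʲ uⱼ` is the Laurent expansion at `s₀` of the distribution-valued
function `F`: the principal part is finite, and the expansion holds as an identity of
distributions on a punctured neighbourhood of `s₀`. -/
def HasLaurentExpansionAt {n : ℕ} {Ω : Opens (RSpace n)} (F : ℂ → CDistribution Ω) (s₀ : ℂ)
    (u : ℤ → CDistribution Ω) : Prop :=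
  (∃ m : ℕ, ∀ j : ℤ, j < -(m : ℤ) → u j = 0) ∧
  ∀ᶠ s in 𝓝[≠] s₀, ∀ φ : 𝓓(Ω, ℂ), HasSum (fun j : ℤ => (s - s₀) ^ j * u j φ) (F s φ)

/-- `F` is a distribution-valued meromorphic function on the complex plane. The values of `F`
at the points of a discrete set (in particular at the poles) are immaterial. -/
def IsMeromorphicFamily {n : ℕ} {Ω : Opens (RSpace n)} (F : ℂ → CDistribution Ω) : Prop :=
  ∀ s₀ : ℂ, ∃ u : ℤ → CDistribution Ω, HasLaurentExpansionAt F s₀ u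

/-- `F` is the complex power `s ↦ (x₁ ⋯ xₙ)_+^s`: it is the locally bounded function
`(x₁ ⋯ xₙ)_+^s` for `Re s > 0`, continued meromorphically to the whole complex plane. -/
def IsComplexPower (n : ℕ) (F : ℂ → CDistribution (⊤ : Opens (RSpace n))) : Prop :=
  (∀ s : ℂ, 0 < s.re → ∀ φ : 𝓓((⊤ : Opens (RSpace n)), ℂ),
    F s φ = ∫ x : RSpace n, plusPow (∏ i, x i) s * φ x) ∧
  IsMeromorphicFamily F

/-! ### Germs of analytic functions -/

/-- The ring of germs at `0 ∈ ℝⁿ` of complex-valued real analytic functions. -/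
def anGermSubring (n : ℕ) : Subring (Germ (𝓝 (0 : RSpace n)) ℂ) where
  carrier := {g | ∃ f : RSpace n → ℂ, AnalyticAt ℝ f 0 ∧ (f : Germ (𝓝 (0 : RSpace n)) ℂ) = g}
  mul_mem' := by
    rintro _ _ ⟨f, hf, rfl⟩ ⟨g, hg, rfl⟩
    exact ⟨f * g, hf.mul hg, rfl⟩
  one_mem' := ⟨fun _ => 1, analyticAt_const, rfl⟩
  add_mem' := by
    rintro _ _ ⟨f, hf, rfl⟩ ⟨g, hg, rfl⟩
    exact ⟨f + g, hf.add hg, rfl⟩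
  zero_mem' := ⟨fun _ => 0, analyticAt_const, rfl⟩
  neg_mem' := by
    rintro _ ⟨f, hf, rfl⟩
    exact ⟨-f, hf.neg, rfl⟩

/-- The ring of germs at `0 ∈ ℝⁿ` of complex-valued real analytic functions, as a type. -/
abbrev AnGerm (n : ℕ) : Type := anGermSubring n

/-- The germ at `0` of a function that is real analytic at `0`. -/
def AnGerm.mk {n : ℕ} (f : RSpace n → ℂ) (hf : AnalyticAt ℝ f 0) : AnGerm n :=
  ⟨(f : Germ (𝓝 (0 : RSpace n)) ℂ), f, hf, rfl⟩

/-- Complex constants as analytic germs. -/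
def AnGerm.constHom (n : ℕ) : ℂ →+* AnGerm n where
  toFun c := AnGerm.mk (fun _ => c) analyticAt_const
  map_one' := rfl
  map_mul' _ _ := rfl
  map_zero' := rfl
  map_add' _ _ := rfl

instance AnGerm.instAlgebra (n : ℕ) : Algebra ℂ (AnGerm n) := (AnGerm.constHom n).toAlgebra

/-- The germ of the partial derivative `∂ᵢ f` of (a representative `f` of) a germ. -/
def germPartial {n : ℕ} (i : Fin n) :
    Germ (𝓝 (0 : RSpace n)) ℂ → Germ (𝓝 (0 : RSpace n)) ℂ :=
  Germ.map' (fun (f : RSpace n → ℂ) (x : RSpace n) => fderiv ℝ f x (Pi.single i (1 : ℝ)))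
    (fun _ _ h => (Filter.EventuallyEq.fderiv (𝕜 := ℝ) h).mono fun _ hx =>
      congrArg (fun L : RSpace n →L[ℝ] ℂ => L (Pi.single i (1 : ℝ))) hx)

/-- The partial derivative `∂ᵢ` as a `ℂ`-linear endomorphism of the ring of analytic germs. -/
def AnGerm.partial {n : ℕ} (i : Fin n) : Module.End ℂ (AnGerm n) where
  toFun g := ⟨germPartial i g.1, by
    obtain ⟨f, hf, hg⟩ := g.2
    refine ⟨fun x => fderiv ℝ f x (Pi.single i (1 : ℝ)),
      ((ContinuousLinearMap.apply ℝ ℂ (Pi.single i (1 : ℝ) : RSpace n)).analyticAt _).comp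
        hf.fderiv, ?_⟩
    rw [← hg]
    rfl⟩
  map_add' := by
    rintro ⟨_, f, hf, rfl⟩ ⟨_, g, hg, rfl⟩
    refine Subtype.ext (Germ.coe_eq.2 ?_)
    filter_upwards [hf.eventually_analyticAt, hg.eventually_analyticAt] with x h1 h2
    change fderiv ℝ (f + g) x _ = fderiv ℝ f x _ + fderiv ℝ g x _
    rw [fderiv_add h1.differentiableAt h2.differentiableAt, _root_.add_apply]
  map_smul' := by
    rintro c ⟨_, f, hf, rfl⟩
    refine Subtype.ext (Germ.coe_eq.2 ?_)
    filter_upwards [hf.eventually_analyticAt] with x h1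
    change fderiv ℝ (fun y => c * f y) x _ = c * fderiv ℝ f x _
    rw [fderiv_const_mul h1.differentiableAt]
    simp

/-! ### The stalk at the origin of the sheaf of differential operators -/

/-- Multiplication by an analytic germ, as an endomorphism of the space of analytic germs. -/
def AnGerm.mulEnd {n : ℕ} (g : AnGerm n) : Module.End ℂ (AnGerm n) :=
  LinearMap.mulLeft ℂ g

/-- `𝓓₀`: the ring of germs at `0 ∈ ℝⁿ` of linear differential operators with complex-valued
real analytic coefficients, that is, the ring of endomorphisms of the space of analytic germs
generated by the multiplication operators and the partial derivatives. -/
def diffOpStalk (n : ℕ) : Subalgebra ℂ (Module.End ℂ (AnGerm n)) :=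
  Algebra.adjoin ℂ
    (Set.range (AnGerm.mulEnd (n := n)) ∪ Set.range (AnGerm.partial (n := n)))

/-- An analytic germ as an operator of order zero. -/
def diffOpStalk.ofGerm {n : ℕ} (g : AnGerm n) : diffOpStalk n :=
  ⟨AnGerm.mulEnd g, Algebra.subset_adjoin (Or.inl ⟨g, rfl⟩)⟩

/-- The operator `∂ᵢ` in `𝓓₀`. -/
def diffOpStalk.del {n : ℕ} (i : Fin n) : diffOpStalk n :=
  ⟨AnGerm.partial i, Algebra.subset_adjoin (Or.inr ⟨i, rfl⟩)⟩

/-- The monomial `∂^β = ∂₁^β₁ ⋯ ∂ₙ^βₙ` in `𝓓₀`. -/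
def diffOpStalk.delPow {n : ℕ} (β : Fin n → ℕ) : diffOpStalk n :=
  (List.ofFn fun i => diffOpStalk.del i ^ β i).prod

/-- The germ of the coordinate function `xᵢ`. -/
def AnGerm.coord {n : ℕ} (i : Fin n) : AnGerm n :=
  AnGerm.mk (fun x => ((x i : ℝ) : ℂ))
    ((Complex.ofRealCLM.comp (ContinuousLinearMap.proj i : RSpace n →L[ℝ] ℝ)).analyticAt 0)

/-! ### Sections of the sheaf of differential operators and their action on distributions -/

/-- A differential operator `∑_β a_β(x) ∂^β` (a finite sum) with complex-valued real analytic
coefficients on an open set `V`. -/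
structure DiffOpOn {n : ℕ} (V : Opens (RSpace n)) where
  /-- the finite set of multi-indices over which the sum extends -/
  idx : Finset (Fin n → ℕ)
  /-- the coefficients `a_β` -/
  coeff : (Fin n → ℕ) → RSpace n → ℂ
  analytic : ∀ β, AnalyticOnNhd ℝ (coeff β) V

/-- The germ at `0` of a differential operator defined on a neighbourhood of `0`. -/
def DiffOpOn.germ {n : ℕ} {V : Opens (RSpace n)} (P : DiffOpOn V) (h0 : (0 : RSpace n) ∈ V) :
    diffOpStalk n :=
  ∑ β ∈ P.idx,
    diffOpStalk.ofGerm (AnGerm.mk (P.coeff β) (P.analytic β 0 h0)) * diffOpStalk.delPow β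

/-- The product `a φ` of a function `a`, real analytic on `V`, and a test function on `V`. -/
def mulTest {n : ℕ} {V : Opens (RSpace n)} (a : RSpace n → ℂ)
    (ha : AnalyticOnNhd ℝ a V) (φ : 𝓓(V, ℂ)) : 𝓓(V, ℂ) where
  toFun x := a x * φ x
  contDiff' := by
    rw [contDiff_iff_contDiffAt]
    intro x
    by_cases hx : x ∈ tsupport φ
    · exact (ha x (φ.tsupport_subset hx)).contDiffAt.mul φ.contDiff.contDiffAt
    · have h : (fun y => a y * φ y) =ᶠ[𝓝 x] fun _ => 0 := by
        filter_upwards [(isClosed_tsupport φ).isOpen_compl.mem_nhds hx] with y hy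
        rw [image_eq_zero_of_notMem_tsupport hy, mul_zero]
      exact contDiffAt_const.congr_of_eventuallyEq h
  hasCompactSupport' := φ.hasCompactSupport.mul_left
  tsupport_subset' := (tsupport_mul_subset_right).trans φ.tsupport_subset

/-- The derivative `∂^β` of test functions. -/
def testDelPow {n : ℕ} {V : Opens (RSpace n)} (β : Fin n → ℕ) : 𝓓(V, ℂ) →L[ℂ] 𝓓(V, ℂ) :=
  (List.ofFn fun i : Fin n =>
    (TestFunction.lineDerivCLM ℂ (Pi.single i (1 : ℝ)) : 𝓓(V, ℂ) →L[ℂ] 𝓓(V, ℂ)) ^ β i).prod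

/-- Restriction to `V` of a distribution on `ℝⁿ`. -/
def CDistribution.restrict {n : ℕ} (u : CDistribution (⊤ : Opens (RSpace n))) (V : Opens (RSpace n)) : CDistribution V :=
  u.comp (TestFunction.monoCLM ℂ : 𝓓(V, ℂ) →L[ℂ] 𝓓((⊤ : Opens (RSpace n)), ℂ))

/-- The pairing `⟨P u, φ⟩ = ∑_β (-1)^|β| ⟨u, ∂^β (a_β φ)⟩` for `P = ∑_β a_β ∂^β`, a distribution
`u` on `V` and a test function `φ` on `V`. -/
def DiffOpOn.applyDist {n : ℕ} {V : Opens (RSpace n)} (P : DiffOpOn V) (u : CDistribution V)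
    (φ : 𝓓(V, ℂ)) : ℂ :=
  ∑ β ∈ P.idx, (-1 : ℂ) ^ (∑ i, β i) * u (testDelPow β (mulTest (P.coeff β) (P.analytic β) φ))

/-- The annihilator of `u` in `𝓓₀`: the germs at `0` of the differential operators `P`, defined on
an open neighbourhood `V` of `0`, such that `P u = 0` on `V`. -/
def annStalk {n : ℕ} (u : CDistribution (⊤ : Opens (RSpace n))) : Set (diffOpStalk n) :=
  {P | ∃ (V : Opens (RSpace n)) (h0 : (0 : RSpace n) ∈ V) (Q : DiffOpOn V),
    Q.germ h0 = P ∧ ∀ φ : 𝓓(V, ℂ), Q.applyDist (u.restrict V) φ = 0}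

/-- The products `x_{j₁} ⋯ x_{jₘ}` of `m` distinct coordinates, together with the operators
`x₁∂₁ - xᵢ∂ᵢ` for `i ≠ 1`; the first coordinate is the one with index `0`. -/
def annGenerators (n : ℕ) (hn : 0 < n) (m : ℕ) : Set (diffOpStalk n) :=
  {P | ∃ J : Finset (Fin n), J.card = m ∧ P = diffOpStalk.ofGerm (∏ j ∈ J, AnGerm.coord j)} ∪
  {P | ∃ i : Fin n, i ≠ ⟨0, hn⟩ ∧
    P = diffOpStalk.ofGerm (AnGerm.coord ⟨0, hn⟩) * diffOpStalk.del ⟨0, hn⟩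
      - diffOpStalk.ofGerm (AnGerm.coord i) * diffOpStalk.del i}

end

/-!
Write `f = x₁⋯xₙ`, and let `w m` be the Laurent coefficient of index `-n + m - 1` of `f_+^s` at
`s = -1`, so that the claim is about the annihilator `A m` of `w m` for `1 ≤ m ≤ n`.

*Analysis.* Integration by parts gives, for `Re s > 0`, the relations `∂ᵢ xᵢ f_+^s = (s + 1) f_+^s`
and, in the variables outside a set `J` of indices,
`(-(s + 1))^(n - |J|) ⟨x_J f_+^s, φ⟩ = ⟨f_+^(s + 1), ∂_{Jᶜ} φ⟩`, where `x_J = ∏_{j ∈ J} xⱼ`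
(`powerIntegral_eulerTest`, `powerIntegral_add_one`). The second one with `J = ∅` continues `f_+^s`
to the plane (`exists_isComplexPower`), and by the identity theorem both persist. Comparing Laurent
coefficients one finds `∂ᵢ xᵢ w (m + 1) = w m` (`IsComplexPower.coeff_eulerTest`), and, since
`f_+^(s + 1)` tends to the indicator function of `f > 0` as `s → -1`, that `x_J` kills `w |J|` while
`⟨x_J w (|J| + 1), φ⟩ = ± ∫_{f > 0} ∂_{Jᶜ} φ` for `|J| < n` (`IsComplexPower.coeff_mulProd`). The
last integral does not vanish identically near any point with `xⱼ > 0` for `j ∈ J` and `xⱼ = 0`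
otherwise, as one sees on products of functions of one variable. So a function that kills
`w (|J| + 1)` vanishes on the coordinate subspace `{xⱼ = 0 for j ∉ J}`
(`zeroOut_eq_zero_of_ofGerm_mem_annIdeal`); in particular `w 1 ≠ 0`.

*Algebra.* The rest is a formal consequence (`GermOps.Generates.annihilator_eq_span`), proved by
induction on `m`. By Hadamard's lemma every operator has, modulo the left ideal generated by the
`∂ᵢ xᵢ`, a normal form `∑ ∂^β a_β` in which `a_β` does not involve the variables that occur in `∂^β`
(`GermOps.Generates.exists_reduced`). Let `P` annihilate `w (m + 1)`, and let `S` be a set of `m`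
indices. The operators that annihilate `w (m + 1)` after multiplication by a power of `x_S` form a
left ideal, which contains the `∂ᵢ xᵢ` and the `xᵢ` with `i ∉ S`, and whose functions vanish on
`{xᵢ = 0 for i ∉ S}`. Multiplying the normal form of `P` by a suitable monomial turns it, modulo
this left ideal, into a function, which has to vanish on the subspace; its summands can be told
apart by their polar parts, so all `a_β` vanish there (`GermOps.zeroOut_eq_zero_of_rightSum_mem`).
As this holds for all `S`, the `a_β` lie in the ideal generated by the products of `m + 1`
coordinates (`AnGerm.mem_span_of_zeroOut_eq_zero`). What remains of `P` is a multiple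
`P' ∂₁ x₁`, up to multiples of the `∂₁ x₁ - ∂ᵢ xᵢ = x₁ ∂₁ - xᵢ ∂ᵢ`. Here `P'` annihilates `w m`,
and the induction hypothesis applies to it.

*Germs.* A germ of a differential operator acts on distributions through its representatives on
balls. On a ball the transpose, an endomorphism of the space of test functions, is determined by the
germ (`Represents.unique`) and is multiplicative (`Represents.mul`). Hence annihilators are left
ideals, and membership can be tested with any representative (`mem_annStalk_iff`).
-/

/-! ### Division of analytic functions by a coordinate -/

section Division

variable {E F : Type*} [NormedAddCommGroup E] [NormedSpace ℝ E]
  [NormedAddCommGroup F] [NormedSpace ℝ F]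

/-- If `p` is the Taylor series of `f` at `0` and `ρ` is a linear map with `x - ρ x = ℓ x • e`,
this is the series of a function `g` with `f x - f (ρ x) = ℓ x • g x`: the term
`p (x, …, x) - p (ρ x, …, ρ x)` telescopes into summands in which one argument is `x - ρ x`. -/
noncomputable def FormalMultilinearSeries.divCoord (p : FormalMultilinearSeries ℝ E F)
    (ρ : E →L[ℝ] E) (e : E) : FormalMultilinearSeries ℝ E F := fun m =>
  ∑ j : Fin (m + 1), ((p (m + 1)).curryMid j e).compContinuousLinearMap
    (fun l => if l.castSucc < j then ρ else ContinuousLinearMap.id ℝ E)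

theorem FormalMultilinearSeries.smul_divCoord_apply (p : FormalMultilinearSeries ℝ E F)
    (ρ : E →L[ℝ] E) (e : E) (ℓ : E → ℝ) (h : ∀ x, x - ρ x = ℓ x • e) (m : ℕ) (x : E) :
    ℓ x • p.divCoord ρ e m (fun _ => x) =
      p (m + 1) (fun _ => x) - p (m + 1) (fun _ => ρ x) := by
  set c : ℕ → F := fun j => p (m + 1) (fun i => if (i : ℕ) < j then ρ x else x) with hc
  have key : ∀ j : Fin (m + 1), ℓ x • (((p (m + 1)).curryMid j e).compContinuousLinearMap
      (fun l => if l.castSucc < j then ρ else ContinuousLinearMap.id ℝ E)) (fun _ => x)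
      = c j - c (j + 1) := by
    intro j
    have e1 : c j = p (m + 1) (Function.update (fun i : Fin (m + 1) =>
        if (i : ℕ) < j then ρ x else x) j x) := by
      simp only [hc]; congr 1; ext i
      by_cases hi : i = j
      · subst hi; simp
      · simp [hi]
    have e2 : c (j + 1) = p (m + 1) (Function.update (fun i : Fin (m + 1) =>
        if (i : ℕ) < j then ρ x else x) j (ρ x)) := by
      simp only [hc]; congr 1; ext i
      by_cases hi : i = j
      · subst hi; simp
      · have : (i : ℕ) ≠ j := fun h => hi (Fin.ext h)
        have h2 : ((i : ℕ) < j + 1) ↔ ((i : ℕ) < j) := by omega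
        simp [hi, h2]
    rw [e1, e2, ← ContinuousMultilinearMap.map_update_sub, h,
      ContinuousMultilinearMap.map_update_smul]
    congr 1
    rw [ContinuousMultilinearMap.compContinuousLinearMap_apply,
      ContinuousMultilinearMap.curryMid_apply]
    congr 1; ext i
    rcases Fin.eq_self_or_eq_succAbove j i with rfl | ⟨l, rfl⟩
    · simp
    · have h3 : (j.succAbove l < j) ↔ l.castSucc < j := Fin.succAbove_lt_iff_castSucc_lt j l
      rw [Fin.insertNth_apply_succAbove, Function.update_of_ne (Fin.succAbove_ne j l)]
      by_cases hl : l.castSucc < j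
      · rw [if_pos hl, if_pos (Fin.lt_def.1 (h3.2 hl))]
      · rw [if_neg hl, if_neg fun h4 => hl (h3.1 (Fin.lt_def.2 h4))]; rfl
  have : p.divCoord ρ e m (fun _ => x) = ∑ j : Fin (m + 1),
      (((p (m + 1)).curryMid j e).compContinuousLinearMap
      (fun l => if l.castSucc < j then ρ else ContinuousLinearMap.id ℝ E)) (fun _ => x) := by
    simp [divCoord]
  rw [this, Finset.smul_sum, Finset.sum_congr rfl (fun j _ => key j),
    Fin.sum_univ_eq_sum_range (fun j => c j - c (j + 1)) (m + 1), Finset.sum_range_sub']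
  congr 1
  simp only [hc]; congr 1; ext i; simp [Nat.lt_succ_iff.1 i.2]

theorem FormalMultilinearSeries.norm_divCoord_le (p : FormalMultilinearSeries ℝ E F)
    (ρ : E →L[ℝ] E) (hρ : ‖ρ‖ ≤ 1) (e : E) (m : ℕ) :
    ‖p.divCoord ρ e m‖ ≤ (m + 1) * (‖p (m + 1)‖ * ‖e‖) := by
  refine (norm_sum_le _ _).trans ?_
  have : ∀ j ∈ (Finset.univ : Finset (Fin (m + 1))),
      ‖((p (m + 1)).curryMid j e).compContinuousLinearMap
        (fun l => if l.castSucc < j then ρ else ContinuousLinearMap.id ℝ E)‖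
        ≤ ‖p (m + 1)‖ * ‖e‖ := by
    intro j _
    refine (ContinuousMultilinearMap.norm_compContinuousLinearMap_le _ _).trans ?_
    have h1 : ∏ l : Fin m, ‖(if l.castSucc < j then ρ else ContinuousLinearMap.id ℝ E)‖ ≤ 1 := by
      refine Finset.prod_le_one (fun _ _ => norm_nonneg _) fun l _ => ?_
      split_ifs
      · exact hρ
      · exact ContinuousLinearMap.norm_id_le
    have h2 : ‖(p (m + 1)).curryMid j e‖ ≤ ‖p (m + 1)‖ * ‖e‖ := by
      refine (ContinuousLinearMap.le_opNorm _ _).trans ?_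
      gcongr
      exact (ContinuousMultilinearMap.norm_curryMid j (p (m + 1))).le
    calc _ ≤ ‖(p (m + 1)).curryMid j e‖ * 1 := by gcongr
      _ ≤ _ := by rw [mul_one]; exact h2
  refine (Finset.sum_le_sum this).trans ?_
  simp

/-- Hadamard's lemma for analytic functions. -/
theorem AnalyticAt.exists_sub_comp_eq_smul [CompleteSpace F] {f : E → F} (hf : AnalyticAt ℝ f 0)
    (ρ : E →L[ℝ] E) (hρ : ‖ρ‖ ≤ 1) (e : E) (ℓ : E → ℝ) (h : ∀ x, x - ρ x = ℓ x • e) :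
    ∃ g : E → F, AnalyticAt ℝ g 0 ∧ ∀ᶠ x in 𝓝 0, f x - f (ρ x) = ℓ x • g x := by
  obtain ⟨p, r, hp⟩ := hf
  set q := p.divCoord ρ e with hq
  have hqr : 0 < q.radius := by
    obtain ⟨s, hs0, hs⟩ := ENNReal.lt_iff_exists_nnreal_btwn.1 (hp.r_pos.trans_le hp.r_le)
    have hs0' : 0 < s := by exact_mod_cast hs0
    obtain ⟨C, hC, hb⟩ := p.norm_mul_pow_le_of_lt_radius hs
    refine lt_of_lt_of_le (b := ((s / 2 : NNReal) : ENNReal)) (by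
      exact_mod_cast (half_pos hs0')) (q.le_radius_of_bound (‖e‖ * C / s) fun m => ?_)
    have h1 := p.norm_divCoord_le ρ hρ e m
    have h2 := hb (m + 1)
    have hsR : (0 : ℝ) < s := hs0'
    -- halving the radius absorbs the number `m + 1` of summands
    have h3 : ((m : ℝ) + 1) ≤ 2 ^ m := by exact_mod_cast Nat.lt_two_pow_self (n := m)
    have h4 : ‖p (m + 1)‖ * (s : ℝ) ^ m ≤ C / s := by
      rw [le_div_iff₀ hsR, mul_assoc, ← pow_succ]; exact h2
    push_cast
    rw [div_pow]
    calc ‖q m‖ * ((s : ℝ) ^ m / 2 ^ m)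
        ≤ ((m + 1) * (‖p (m + 1)‖ * ‖e‖)) * ((s : ℝ) ^ m / 2 ^ m) := by gcongr
      _ = ((m + 1) / 2 ^ m) * (‖e‖ * (‖p (m + 1)‖ * (s : ℝ) ^ m)) := by ring
      _ ≤ 1 * (‖e‖ * (C / s)) := by
          gcongr
          rw [div_le_one (by positivity)]; exact h3
      _ = ‖e‖ * C / s := by ring
  have hg := q.hasFPowerSeriesOnBall hqr
  refine ⟨q.sum, hg.analyticAt, ?_⟩
  filter_upwards [Metric.eball_mem_nhds (0 : E) hp.r_pos, Metric.eball_mem_nhds (0 : E) hqr]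
    with x hx hx'
  have hx2 : ρ x ∈ Metric.eball (0 : E) r := by
    rw [Metric.mem_eball, edist_zero_right] at hx ⊢
    refine lt_of_le_of_lt ?_ hx
    have : ‖ρ x‖ ≤ ‖x‖ := (ρ.le_of_opNorm_le hρ x).trans (by simp)
    rw [enorm_eq_nnnorm, enorm_eq_nnnorm]
    exact_mod_cast this
  have s1 := (hp.hasSum hx).sub (hp.hasSum hx2)
  have s2 := (hg.hasSum hx').const_smul (ℓ x)
  simp only [zero_add] at s1 s2
  rw [← hasSum_nat_add_iff' 1] at s1
  have h0 : p 0 (fun _ => x) - p 0 (fun _ => ρ x) = 0 := by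
    rw [sub_eq_zero]; congr 1; ext i; exact i.elim0
  simp only [Finset.range_one, Finset.sum_singleton, h0, sub_zero] at s1
  refine s1.unique ?_
  convert s2 using 2 with m
  exact (p.smul_divCoord_apply ρ e ℓ h m x).symm

end Division

/-! ### The ring of analytic germs -/

namespace AnGerm

variable {n : ℕ}

theorem exists_rep (g : AnGerm n) :
    ∃ (f : RSpace n → ℂ) (hf : AnalyticAt ℝ f 0), g = AnGerm.mk f hf := by
  obtain ⟨_, f, hf, rfl⟩ := g
  exact ⟨f, hf, rfl⟩

theorem mk_eq_mk {f g : RSpace n → ℂ} {hf : AnalyticAt ℝ f 0} {hg : AnalyticAt ℝ g 0} :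
    AnGerm.mk f hf = AnGerm.mk g hg ↔ f =ᶠ[𝓝 0] g :=
  Subtype.ext_iff.trans Germ.coe_eq

theorem mk_eq_zero {f : RSpace n → ℂ} {hf : AnalyticAt ℝ f 0} :
    AnGerm.mk f hf = 0 ↔ ∀ᶠ x in 𝓝 0, f x = 0 :=
  Subtype.ext_iff.trans Germ.coe_eq

theorem mk_eq_one {f : RSpace n → ℂ} {hf : AnalyticAt ℝ f 0} :
    AnGerm.mk f hf = 1 ↔ ∀ᶠ x in 𝓝 0, f x = 1 :=
  Subtype.ext_iff.trans Germ.coe_eq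

theorem analyticAt_coord (i : Fin n) (x : RSpace n) :
    AnalyticAt ℝ (fun x : RSpace n => ((x i : ℝ) : ℂ)) x :=
  (Complex.ofRealCLM.comp (ContinuousLinearMap.proj i : RSpace n →L[ℝ] ℝ)).analyticAt x

theorem coord_eq_mk (i : Fin n) :
    (AnGerm.coord i : AnGerm n) = AnGerm.mk (fun x => ((x i : ℝ) : ℂ)) (analyticAt_coord i 0) := rfl

theorem mk_mul {f g : RSpace n → ℂ} (hf : AnalyticAt ℝ f 0) (hg : AnalyticAt ℝ g 0) :
    AnGerm.mk (fun x => f x * g x) (hf.mul hg) = AnGerm.mk f hf * AnGerm.mk g hg := rfl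

theorem mk_add {f g : RSpace n → ℂ} (hf : AnalyticAt ℝ f 0) (hg : AnalyticAt ℝ g 0) :
    AnGerm.mk (fun x => f x + g x) (hf.add hg) = AnGerm.mk f hf + AnGerm.mk g hg := rfl

theorem analyticAt_fderiv_apply {f : RSpace n → ℂ} {x : RSpace n} (hf : AnalyticAt ℝ f x)
    (v : RSpace n) : AnalyticAt ℝ (fun x => fderiv ℝ f x v) x :=
  ((ContinuousLinearMap.apply ℝ ℂ v).analyticAt _).comp hf.fderiv

theorem partial_mk {f : RSpace n → ℂ} (hf : AnalyticAt ℝ f 0) (i : Fin n) :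
    AnGerm.partial i (AnGerm.mk f hf) =
      AnGerm.mk (fun x => fderiv ℝ f x (Pi.single i 1)) (analyticAt_fderiv_apply hf _) := rfl

theorem partial_mul (i : Fin n) (g h : AnGerm n) :
    AnGerm.partial i (g * h) = AnGerm.partial i g * h + g * AnGerm.partial i h := by
  obtain ⟨f, hf, rfl⟩ := g.exists_rep
  obtain ⟨k, hk, rfl⟩ := h.exists_rep
  rw [← mk_mul, partial_mk, partial_mk, partial_mk, ← mk_mul, ← mk_mul, ← mk_add, mk_eq_mk]
  filter_upwards [hf.eventually_analyticAt, hk.eventually_analyticAt] with x h1 h2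
  rw [fderiv_fun_mul h1.differentiableAt h2.differentiableAt]
  simp only [add_apply, smul_apply, smul_eq_mul]
  ring

theorem partial_comm (i j : Fin n) (g : AnGerm n) :
    AnGerm.partial i (AnGerm.partial j g) = AnGerm.partial j (AnGerm.partial i g) := by
  obtain ⟨f, hf, rfl⟩ := g.exists_rep
  rw [partial_mk, partial_mk, partial_mk, partial_mk, mk_eq_mk]
  filter_upwards [hf.eventually_analyticAt] with x h1
  have hs : IsSymmSndFDerivAt ℝ f x := by
    refine ContDiffAt.isSymmSndFDerivAt (n := ω) h1.contDiffAt ?_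
    simp
  have hd : DifferentiableAt ℝ (fderiv ℝ f) x := h1.fderiv.differentiableAt
  have e : ∀ v w : RSpace n,
      fderiv ℝ (fun y => fderiv ℝ f y v) x w = fderiv ℝ (fderiv ℝ f) x w v := by
    intro v w
    rw [fderiv_clm_apply hd (differentiableAt_const v)]
    simp
  rw [e, e]
  exact hs _ _

theorem partial_one (i : Fin n) : AnGerm.partial i (1 : AnGerm n) = 0 := by
  have h := partial_mul i (1 : AnGerm n) 1
  simpa using h

theorem partial_coord (i j : Fin n) :
    AnGerm.partial i (AnGerm.coord j : AnGerm n) = if i = j then 1 else 0 := by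
  have h : ∀ x : RSpace n, fderiv ℝ (fun x : RSpace n => ((x j : ℝ) : ℂ)) x (Pi.single i 1)
      = if i = j then 1 else 0 := by
    intro x
    have : (fun x : RSpace n => ((x j : ℝ) : ℂ)) =
      (Complex.ofRealCLM.comp (ContinuousLinearMap.proj j : RSpace n →L[ℝ] ℝ)) := rfl
    rw [this, ContinuousLinearMap.fderiv]
    simp [Pi.single_apply, eq_comm, apply_ite]
  rw [coord_eq_mk, partial_mk]
  split_ifs with hij
  · exact mk_eq_one.2 (Eventually.of_forall fun x => by rw [h, if_pos hij])
  · exact mk_eq_zero.2 (Eventually.of_forall fun x => by rw [h, if_neg hij])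

/-- The projection of `ℝⁿ` that sets the coordinates with index in `T` to zero. -/
noncomputable def zeroProj (T : Finset (Fin n)) : RSpace n →L[ℝ] RSpace n :=
  ContinuousLinearMap.pi fun i => if i ∈ T then 0 else ContinuousLinearMap.proj i

theorem zeroProj_apply (T : Finset (Fin n)) (x : RSpace n) (i : Fin n) :
    zeroProj T x i = if i ∈ T then 0 else x i := by
  simp only [zeroProj, ContinuousLinearMap.coe_pi']
  split_ifs <;> rfl

theorem norm_zeroProj_le (T : Finset (Fin n)) : ‖zeroProj T‖ ≤ 1 := by
  refine ContinuousLinearMap.opNorm_le_bound _ zero_le_one fun x => ?_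
  rw [one_mul, pi_norm_le_iff_of_nonneg (norm_nonneg x)]
  intro i
  rw [zeroProj_apply]
  split_ifs
  · simp
  · exact norm_le_pi_norm x i

theorem analyticAt_comp_zeroProj {f : RSpace n → ℂ} (hf : AnalyticAt ℝ f 0) (T : Finset (Fin n)) :
    AnalyticAt ℝ (fun x => f (zeroProj T x)) 0 :=
  AnalyticAt.fun_comp (by rwa [map_zero]) ((zeroProj T).analyticAt 0)

theorem tendsto_zeroProj (T : Finset (Fin n)) :
    Tendsto (zeroProj T) (𝓝 (0 : RSpace n)) (𝓝 0) := by
  simpa using (zeroProj T).continuous.tendsto 0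

/-- Restriction of germs to the coordinate subspace `{x | ∀ i ∈ T, x i = 0}`; the restriction is
again regarded as a germ on `ℝⁿ`, by composition with `zeroProj T`. -/
noncomputable def zeroOut (T : Finset (Fin n)) : AnGerm n →+* AnGerm n where
  toFun g := ⟨g.1.compTendsto (zeroProj T) (tendsto_zeroProj T), by
    obtain ⟨f, hf, hg⟩ := g.2
    exact ⟨fun x => f (zeroProj T x), analyticAt_comp_zeroProj hf T, by rw [← hg]; rfl⟩⟩
  map_one' := rfl
  map_zero' := rfl
  map_mul' g h := by
    obtain ⟨f, hf, rfl⟩ := g.exists_rep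
    obtain ⟨k, hk, rfl⟩ := h.exists_rep
    rfl
  map_add' g h := by
    obtain ⟨f, hf, rfl⟩ := g.exists_rep
    obtain ⟨k, hk, rfl⟩ := h.exists_rep
    rfl

theorem zeroOut_mk (T : Finset (Fin n)) {f : RSpace n → ℂ} (hf : AnalyticAt ℝ f 0) :
    zeroOut T (AnGerm.mk f hf) =
      AnGerm.mk (fun x => f (zeroProj T x)) (analyticAt_comp_zeroProj hf T) := rfl

theorem zeroOut_zeroOut (T T' : Finset (Fin n)) (g : AnGerm n) :
    zeroOut T (zeroOut T' g) = zeroOut (T ∪ T') g := by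
  obtain ⟨f, hf, rfl⟩ := g.exists_rep
  rw [zeroOut_mk, zeroOut_mk, zeroOut_mk, mk_eq_mk]
  refine Eventually.of_forall fun x => ?_
  simp only
  congr 1
  ext i
  simp only [zeroProj_apply, Finset.mem_union]
  by_cases h1 : i ∈ T <;> by_cases h2 : i ∈ T' <;> simp [h1, h2]

theorem zeroOut_empty (g : AnGerm n) : zeroOut ∅ g = g := by
  obtain ⟨f, hf, rfl⟩ := g.exists_rep
  rw [zeroOut_mk, mk_eq_mk]
  refine Eventually.of_forall fun x => ?_
  exact congrArg f (funext fun i => by simp [zeroProj_apply])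

theorem zeroOut_coord (T : Finset (Fin n)) (i : Fin n) :
    zeroOut T (coord i : AnGerm n) = if i ∈ T then 0 else coord i := by
  rw [coord_eq_mk, zeroOut_mk]
  split_ifs with h
  · exact mk_eq_zero.2 (Eventually.of_forall fun x => by simp [zeroProj_apply, h])
  · exact mk_eq_mk.2 (Eventually.of_forall fun x => by simp [zeroProj_apply, h])

theorem partial_zeroOut (T : Finset (Fin n)) (i : Fin n) (g : AnGerm n) :
    AnGerm.partial i (zeroOut T g) = if i ∈ T then 0 else zeroOut T (AnGerm.partial i g) := by
  obtain ⟨f, hf, rfl⟩ := g.exists_rep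
  have key : ∀ᶠ x in 𝓝 (0 : RSpace n), fderiv ℝ (fun x => f (zeroProj T x)) x (Pi.single i 1) =
      fderiv ℝ f (zeroProj T x) (zeroProj T (Pi.single i 1)) := by
    filter_upwards [(tendsto_zeroProj T).eventually hf.eventually_analyticAt] with x hx
    have := (hx.differentiableAt.hasFDerivAt.comp x (zeroProj T).hasFDerivAt).fderiv
    rw [show (fun x => f (zeroProj T x)) = f ∘ (zeroProj T) from rfl, this]
    rfl
  rw [zeroOut_mk, partial_mk, partial_mk, zeroOut_mk]
  split_ifs with h
  · have h0 : zeroProj T (Pi.single i 1) = 0 := by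
      ext j
      rw [zeroProj_apply]
      by_cases hj : j ∈ T
      · simp [hj]
      · have : j ≠ i := fun e => hj (e ▸ h)
        simp [hj, this]
    refine mk_eq_zero.2 (key.mono fun x hx => ?_)
    rw [hx, h0, map_zero]
  · have h0 : zeroProj T (Pi.single i 1) = Pi.single i (1 : ℝ) := by
      ext j
      rw [zeroProj_apply]
      by_cases hj : j ∈ T
      · have : j ≠ i := fun e => h (e ▸ hj)
        simp [hj, this]
      · simp [hj]
    refine mk_eq_mk.2 (key.mono fun x hx => ?_)
    exact hx.trans (by rw [h0])

theorem partial_eq_zero_of_zeroOut_eq {i : Fin n} {g : AnGerm n} (h : zeroOut {i} g = g) :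
    AnGerm.partial i g = 0 := by
  rw [← h, partial_zeroOut]; simp

/-- Hadamard's lemma in the ring of analytic germs. -/
theorem exists_eq_zeroOut_add (i : Fin n) (g : AnGerm n) :
    ∃ h : AnGerm n, g = zeroOut {i} g + coord i * h := by
  obtain ⟨f, hf, rfl⟩ := g.exists_rep
  obtain ⟨q, hq, hq2⟩ := hf.exists_sub_comp_eq_smul (zeroProj {i}) (norm_zeroProj_le _)
    (Pi.single i 1) (fun x => x i) (fun x => by
      ext j
      by_cases hj : j = i
      · subst hj; simp [zeroProj_apply]
      · simp [zeroProj_apply, hj])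
  refine ⟨AnGerm.mk q hq, ?_⟩
  rw [coord_eq_mk, zeroOut_mk, ← mk_mul, ← mk_add, mk_eq_mk]
  filter_upwards [hq2] with x hx
  rw [Complex.real_smul] at hx
  rw [← hx]; ring

theorem eq_zero_of_coord_mul {i : Fin n} {g : AnGerm n} (h : coord i * g = 0) : g = 0 := by
  obtain ⟨f, hf, rfl⟩ := g.exists_rep
  have h' : ∀ᶠ x in 𝓝 (0 : RSpace n), ((x i : ℝ) : ℂ) * f x = 0 := by
    rw [coord_eq_mk, ← mk_mul] at h
    exact mk_eq_zero.1 h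
  refine mk_eq_zero.2 ?_
  filter_upwards [h'.eventually_nhds, hf.eventually_analyticAt] with x hx hfx
  -- `f` vanishes at the points near `x` off the hyperplane, and these accumulate at `x`
  have hc : Tendsto (fun t : ℝ => f (x + t • Pi.single i 1)) (𝓝[≠] 0) (𝓝 (f x)) := by
    have : ContinuousAt (fun t : ℝ => f (x + t • Pi.single i 1)) 0 := by
      refine ContinuousAt.comp (g := f) ?_ (by fun_prop)
      simpa using hfx.continuousAt
    simpa using this.tendsto.mono_left nhdsWithin_le_nhds
  refine tendsto_nhds_unique (hc.congr' ?_) tendsto_const_nhds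
  have ht : Tendsto (fun t : ℝ => x + t • (Pi.single i 1 : RSpace n)) (𝓝[≠] 0) (𝓝 x) := by
    have : ContinuousAt (fun t : ℝ => x + t • (Pi.single i 1 : RSpace n)) 0 := by fun_prop
    simpa using this.tendsto.mono_left nhdsWithin_le_nhds
  have hne : ∀ᶠ t : ℝ in 𝓝[≠] 0, x i + t ≠ 0 := by
    have : ∀ᶠ t : ℝ in 𝓝[≠] 0, t ≠ -x i := by
      by_cases hxi : x i = 0
      · rw [hxi, neg_zero]; exact eventually_mem_nhdsWithin
      · exact nhdsWithin_le_nhds (isOpen_ne.mem_nhds (by simpa [eq_comm] using hxi))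
    filter_upwards [this] with t ht h0
    exact ht (by linarith)
  filter_upwards [ht.eventually hx, hne] with t h1 h2
  refine (mul_eq_zero.1 h1).resolve_left ?_
  simpa using (by exact_mod_cast h2 : ((x i + t : ℝ) : ℂ) ≠ 0)

theorem eq_zero_of_prod_coord_mul (S : Finset (Fin n)) {g : AnGerm n}
    (h : (∏ j ∈ S, coord j) * g = 0) : g = 0 := by
  classical
  induction S using Finset.induction_on generalizing g with
  | empty => simpa using h
  | insert a S ha ih =>
    rw [Finset.prod_insert ha, mul_assoc] at h
    exact ih (eq_zero_of_coord_mul h)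

theorem zeroOut_prod_coord (T S : Finset (Fin n)) :
    zeroOut T (∏ j ∈ S, coord j : AnGerm n) = if Disjoint S T then ∏ j ∈ S, coord j else 0 := by
  rw [map_prod]
  split_ifs with h
  · refine Finset.prod_congr rfl fun j hj => ?_
    rw [zeroOut_coord, if_neg (Finset.disjoint_left.1 h hj)]
  · obtain ⟨j, hj, hj'⟩ := Finset.not_disjoint_iff.1 h
    refine Finset.prod_eq_zero hj ?_
    rw [zeroOut_coord, if_pos hj']

/-- An analytic germ is a sum `∑ x_S b_S` over the sets `S ⊆ T` of coordinates, where `b_S` does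
not involve the coordinates in `T \ S`. -/
theorem exists_eq_sum_prod_coord_mul (T : Finset (Fin n)) (g : AnGerm n) :
    ∃ b : Finset (Fin n) → AnGerm n, g = ∑ S ∈ T.powerset, (∏ j ∈ S, coord j) * b S ∧
      ∀ S ⊆ T, zeroOut (T \ S) (b S) = b S := by
  classical
  induction T using Finset.induction_on with
  | empty =>
    refine ⟨fun _ => g, by simp, fun S hS => ?_⟩
    rw [Finset.subset_empty.1 hS]; simp [zeroOut_empty]
  | insert i T hi ih =>
    obtain ⟨b, hb, hb'⟩ := ih
    choose c hc using fun S => exists_eq_zeroOut_add i (b S)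
    refine ⟨fun S => if i ∈ S then c (S.erase i) else zeroOut {i} (b S), ?_, ?_⟩
    · rw [Finset.sum_powerset_insert hi, ← Finset.sum_add_distrib, hb]
      refine Finset.sum_congr rfl fun S hS => ?_
      have hiS : i ∉ S := fun h => hi (Finset.mem_powerset.1 hS h)
      simp only [hiS, if_false, Finset.mem_insert_self, if_true, Finset.erase_insert hiS,
        Finset.prod_insert hiS]
      nth_rewrite 1 [hc S]
      ring
    · intro S hS
      by_cases hiS : i ∈ S
      · simp only [hiS, if_true]
        have hS' : S.erase i ⊆ T := fun j hj =>
          (Finset.mem_insert.1 (hS (Finset.mem_of_mem_erase hj))).resolve_left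
            (Finset.ne_of_mem_erase hj)
        have e : insert i T \ S = T \ S.erase i := by
          ext j
          by_cases hj : j = i
          · subst hj; simp [hiS, hi]
          · simp [hj]
        have hi2 : i ∉ T \ S.erase i := fun h => hi (Finset.mem_sdiff.1 h).1
        rw [e, ← sub_eq_zero]
        refine eq_zero_of_coord_mul (i := i) ?_
        have h1 : coord i * c (S.erase i) = b (S.erase i) - zeroOut {i} (b (S.erase i)) := by
          rw [eq_sub_iff_add_eq, add_comm]; exact (hc _).symm
        have h2 := congrArg (zeroOut (T \ S.erase i)) h1
        rw [map_mul, zeroOut_coord, if_neg hi2, map_sub, zeroOut_zeroOut, Finset.union_comm,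
          ← zeroOut_zeroOut, hb' _ hS', ← h1] at h2
        rw [mul_sub, h2, sub_self]
      · simp only [hiS, if_false]
        have hS' : S ⊆ T := fun j hj =>
          (Finset.mem_insert.1 (hS hj)).resolve_left (fun e => hiS (e ▸ hj))
        have e : insert i T \ S ∪ {i} = {i} ∪ T \ S := by
          rw [Finset.insert_sdiff_of_notMem _ hiS]
          ext j; simp
        rw [zeroOut_zeroOut, e, ← zeroOut_zeroOut, hb' S hS']

/-- An analytic germ that vanishes on all `k`-dimensional coordinate subspaces lies in the ideal
generated by the products of `k + 1` distinct coordinates. -/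
theorem mem_span_of_zeroOut_eq_zero {k : ℕ} (hk : k ≤ n) {g : AnGerm n}
    (h : ∀ S : Finset (Fin n), S.card = k → zeroOut Sᶜ g = 0) :
    g ∈ Ideal.span
      {p : AnGerm n | ∃ J : Finset (Fin n), J.card = k + 1 ∧ p = ∏ j ∈ J, coord j} := by
  classical
  obtain ⟨b, hb, hb'⟩ := exists_eq_sum_prod_coord_mul Finset.univ g
  have small : ∀ S : Finset (Fin n), S.card ≤ k → b S = 0 := by
    intro S
    induction S using Finset.strongInduction with
    | H S ih =>
      intro hS
      obtain ⟨S', hSS', hS'⟩ := Finset.exists_superset_card_eq hS (by simpa using hk)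
      have h1 : zeroOut Sᶜ g = 0 := by
        have : Sᶜ = Sᶜ ∪ S'ᶜ := (Finset.union_eq_left.2 (Finset.compl_subset_compl.2 hSS')).symm
        rw [this, ← zeroOut_zeroOut, h S' hS', map_zero]
      rw [hb, map_sum, Finset.sum_eq_single S] at h1
      · rw [map_mul, zeroOut_prod_coord, if_pos disjoint_compl_right] at h1
        have h2 := hb' S (Finset.subset_univ S)
        rw [← Finset.compl_eq_univ_sdiff] at h2
        rw [h2] at h1
        exact eq_zero_of_prod_coord_mul S h1
      · intro S₁ _ hne
        rw [map_mul, zeroOut_prod_coord]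
        split_ifs with hd
        · have hsub : S₁ ⊆ S := by simpa [Finset.disjoint_left, Finset.subset_iff] using hd
          have hss : S₁ ⊂ S := hsub.ssubset_of_ne hne
          rw [ih S₁ hss ((Finset.card_le_card hsub).trans hS), map_zero, mul_zero]
        · rw [zero_mul]
      · intro hn; exact absurd (Finset.mem_powerset.2 (Finset.subset_univ S)) hn
  rw [hb]
  refine Ideal.sum_mem _ fun S _ => ?_
  by_cases hS : S.card ≤ k
  · rw [small S hS, mul_zero]; exact Ideal.zero_mem _
  · obtain ⟨J, hJS, hJ⟩ := Finset.exists_subset_card_eq (show k + 1 ≤ S.card by omega)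
    rw [← Finset.prod_sdiff hJS, mul_comm, ← mul_assoc]
    exact Ideal.mul_mem_left _ _ (Ideal.subset_span ⟨J, hJ, rfl⟩)

end AnGerm

/-! ### Commutation rules for multi-index powers -/

/-- Induction on multi-indices by raising one entry at a time. -/
theorem multiIndex_induction {ι : Type*} [Fintype ι] [DecidableEq ι] {p : (ι → ℕ) → Prop}
    (zero : p 0)
    (add_single : ∀ β i, p β → p (β + Pi.single i 1)) (β : ι → ℕ) : p β := by
  induction h : ∑ i, β i generalizing β with
  | zero =>
    have : β = 0 := funext fun i => by simpa using (Finset.sum_eq_zero_iff.1 h) i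
    rwa [this]
  | succ m ih =>
    obtain ⟨i, hi⟩ : ∃ i, β i ≠ 0 := by
      by_contra! h0
      simp [h0] at h
    have e : β = (β - (Pi.single i 1 : ι → ℕ)) + (Pi.single i 1 : ι → ℕ) := by
      ext j
      by_cases hj : j = i
      · subst hj; simp; omega
      · simp [hj]
    rw [e]
    refine add_single _ i (ih _ ?_)
    have h2 : ∑ j, β j = ∑ j, (β - (Pi.single i 1 : ι → ℕ)) j + 1 := by
      conv_lhs => rw [e]
      simp [Finset.sum_add_distrib]
    omega

theorem prod_ofFn_pow_add_single {M : Type*} [Monoid M] {n : ℕ} (d : Fin n → M)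
    (hd : ∀ i j, Commute (d i) (d j)) (β : Fin n → ℕ) (i : Fin n) :
    (List.ofFn fun j => d j ^ (β + (Pi.single i 1 : Fin n → ℕ)) j).prod =
      d i * (List.ofFn fun j => d j ^ β j).prod := by
  induction n with
  | zero => exact i.elim0
  | succ n ih =>
    rw [List.ofFn_succ, List.ofFn_succ, List.prod_cons, List.prod_cons]
    refine Fin.cases ?_ (fun i => ?_) i
    · simp [pow_succ', mul_assoc]
    · have h := ih (fun j => d j.succ) (fun i j => hd _ _) (fun j => β j.succ) i
      have e : (fun j : Fin n => d j.succ ^ (β + (Pi.single i.succ 1 : Fin (n + 1) → ℕ)) j.succ) =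
          fun j => d j.succ ^ ((fun j : Fin n => β j.succ) + (Pi.single i 1 : Fin n → ℕ)) j := by
        ext j
        simp [Pi.single_apply]
      rw [e, h, ← mul_assoc, ← mul_assoc]
      congr 1
      simpa using ((hd i.succ 0).pow_right (β 0)).symm.eq

/-- A ring `D` containing the analytic germs and commuting elements `∂ᵢ` that satisfy the Leibniz
rule. -/
structure GermOps (n : ℕ) (D : Type*) [Ring D] where
  /-- the inclusion of the functions -/
  ofGerm : AnGerm n →+* D
  /-- the partial derivatives -/
  del : Fin n → D
  del_comm : ∀ i j, Commute (del i) (del j)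
  del_mul_ofGerm : ∀ i g, del i * ofGerm g = ofGerm g * del i + ofGerm (AnGerm.partial i g)

namespace GermOps

variable {n : ℕ} {D : Type*} [Ring D] (𝒟 : GermOps n D)

theorem ofGerm_mul_comm (g h : AnGerm n) : 𝒟.ofGerm g * 𝒟.ofGerm h = 𝒟.ofGerm h * 𝒟.ofGerm g := by
  rw [← map_mul, mul_comm, map_mul]

theorem ofGerm_mul_del (i : Fin n) (g : AnGerm n) :
    𝒟.ofGerm g * 𝒟.del i = 𝒟.del i * 𝒟.ofGerm g - 𝒟.ofGerm (AnGerm.partial i g) := by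
  rw [𝒟.del_mul_ofGerm]; abel

/-- The monomial `∂^β`. -/
def delPow (β : Fin n → ℕ) : D := (List.ofFn fun i => 𝒟.del i ^ β i).prod

theorem delPow_zero : 𝒟.delPow 0 = 1 := by
  simp [delPow]

theorem delPow_add_single (β : Fin n → ℕ) (i : Fin n) :
    𝒟.delPow (β + Pi.single i 1) = 𝒟.del i * 𝒟.delPow β :=
  prod_ofFn_pow_add_single _ 𝒟.del_comm β i

theorem del_commute_delPow (i : Fin n) (β : Fin n → ℕ) : Commute (𝒟.del i) (𝒟.delPow β) := by
  induction β using multiIndex_induction with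
  | zero => rw [delPow_zero]; exact Commute.one_right _
  | add_single β j ih => rw [delPow_add_single]; exact (𝒟.del_comm i j).mul_right ih

/-- Functions independent of the variables `xᵢ` with `βᵢ ≠ 0` commute with `∂^β`. -/
theorem ofGerm_commute_delPow {g : AnGerm n} {β : Fin n → ℕ}
    (h : ∀ i, β i ≠ 0 → AnGerm.zeroOut {i} g = g) : Commute (𝒟.ofGerm g) (𝒟.delPow β) := by
  induction β using multiIndex_induction with
  | zero => rw [delPow_zero]; exact Commute.one_right _
  | add_single β j ih =>
    rw [delPow_add_single]
    refine Commute.mul_right ?_ (ih fun i hi => h i (by simp [hi]))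
    have h0 : AnGerm.partial j g = 0 := AnGerm.partial_eq_zero_of_zeroOut_eq (h j (by simp))
    rw [Commute, SemiconjBy, del_mul_ofGerm, h0, map_zero, add_zero]

theorem euler_mul_delPow (i : Fin n) (β : Fin n → ℕ) :
    𝒟.ofGerm (AnGerm.coord i) * 𝒟.del i * 𝒟.delPow β =
      𝒟.delPow β * (𝒟.ofGerm (AnGerm.coord i) * 𝒟.del i) - β i • 𝒟.delPow β := by
  induction β using multiIndex_induction with
  | zero => simp [delPow_zero]
  | add_single β j ih =>
    have h : 𝒟.ofGerm (AnGerm.coord i) * 𝒟.del i * 𝒟.del j =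
        𝒟.del j * (𝒟.ofGerm (AnGerm.coord i) * 𝒟.del i)
          - (if j = i then 1 else 0 : ℕ) • 𝒟.del j := by
      rw [mul_assoc, (𝒟.del_comm i j).eq, ← mul_assoc, ofGerm_mul_del, AnGerm.partial_coord,
        sub_mul, mul_assoc]
      by_cases hij : j = i
      · subst hij; simp
      · simp [hij]
    rw [delPow_add_single, ← mul_assoc, h, sub_mul, mul_assoc (𝒟.del j), ih, mul_sub, mul_assoc,
      smul_mul_assoc, mul_smul_comm, sub_sub, ← add_smul, Pi.add_apply, Pi.single_apply]
    simp only [eq_comm]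

end GermOps

namespace AnGerm

variable {n : ℕ}

/-- The germ of the monomial `x^e`. -/
noncomputable def mono (e : Fin n → ℕ) : AnGerm n := ∏ i, coord i ^ e i

theorem mono_add_single (e : Fin n → ℕ) (i : Fin n) :
    mono (e + Pi.single i 1) = mono e * coord i := by
  simp only [mono, Pi.add_apply, pow_add, Finset.prod_mul_distrib]
  congr 1
  rw [Finset.prod_eq_single i] <;> simp +contextual

theorem mono_eq_erase_mul (e : Fin n → ℕ) (i : Fin n) :
    mono e = (∏ j ∈ Finset.univ.erase i, coord j ^ e j) * coord i ^ e i :=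
  (Finset.prod_erase_mul _ _ (Finset.mem_univ i)).symm

theorem partial_coord_pow (i j : Fin n) (e : ℕ) :
    AnGerm.partial j (coord i ^ e : AnGerm n) = if j = i then e • coord i ^ (e - 1) else 0 := by
  induction e with
  | zero => simp [partial_one]
  | succ e ih =>
    rw [pow_succ, partial_mul, ih, partial_coord]
    split_ifs with h
    · cases e with
      | zero => simp
      | succ e => simp [pow_succ]; ring
    · simp

theorem eq_zero_of_coord_pow_mul {i : Fin n} {e : ℕ} {g : AnGerm n} (h : coord i ^ e * g = 0) :
    g = 0 := by
  induction e with
  | zero => simpa using h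
  | succ e ih =>
    rw [pow_succ', mul_assoc] at h
    exact ih (eq_zero_of_coord_mul h)

theorem eq_zero_of_zsmul {c : ℤ} (hc : c ≠ 0) {g : AnGerm n} (h : c • g = 0) : g = 0 := by
  rw [← Int.cast_smul_eq_zsmul ℂ] at h
  exact (smul_eq_zero.1 h).resolve_left (by exact_mod_cast hc)

/-- Uniqueness of the polar parts in one variable: after division by `xᵢ^M` the sum reads
`∑ b, xᵢ^(-b) G b`. -/
theorem eq_zero_of_sum_coord_pow_mul (i : Fin n) (M : ℕ) (G : ℕ → AnGerm n)
    (hG : ∀ b, b ≠ 0 → zeroOut {i} (G b) = G b)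
    (h : ∑ b ∈ Finset.range (M + 1), coord i ^ (M - b) * G b = 0) : ∀ b ≤ M, G b = 0 := by
  induction M with
  | zero =>
    intro b hb
    obtain rfl : b = 0 := by omega
    simpa using h
  | succ M ih =>
    have hs : ∑ b ∈ Finset.range (M + 1), coord i ^ (M + 1 - b) * G b =
        coord i * ∑ b ∈ Finset.range (M + 1), coord i ^ (M - b) * G b := by
      rw [Finset.mul_sum]
      refine Finset.sum_congr rfl fun b hb => ?_
      have : M + 1 - b = M - b + 1 := by have := Finset.mem_range.1 hb; omega
      rw [this, pow_succ]; ring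
    rw [Finset.sum_range_succ, hs, Nat.sub_self, pow_zero, one_mul] at h
    have h1 : G (M + 1) = 0 := by
      have := congrArg (zeroOut {i}) h
      rwa [map_add, map_mul, zeroOut_coord, if_pos (Finset.mem_singleton_self i), zero_mul,
        zero_add, map_zero, hG _ (Nat.succ_ne_zero M)] at this
    rw [h1, add_zero] at h
    have h2 := ih (eq_zero_of_coord_mul h)
    intro b hb
    rcases Nat.lt_or_ge M b with hb' | hb'
    · obtain rfl : b = M + 1 := by omega
      exact h1
    · exact h2 b hb'

/-- Uniqueness of Laurent expansions in the following form: after division by `x^e` the sum reads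
`∑ β, x^(-β) A β`, and `A β` does not involve the variables that occur in `x^(-β)`. -/
theorem eq_zero_of_sum_mono_mul (B : Finset (Fin n → ℕ)) (e : Fin n → ℕ)
    (A : (Fin n → ℕ) → AnGerm n) (he : ∀ β ∈ B, β ≤ e)
    (hA : ∀ β ∈ B, ∀ i, β i ≠ 0 → zeroOut {i} (A β) = A β)
    (h : ∑ β ∈ B, mono (e - β) * A β = 0) : ∀ β ∈ B, A β = 0 := by
  classical
  induction hc : B.card using Nat.strong_induction_on generalizing B with
  | _ c ih =>
    intro β₀ hβ₀
    by_cases hB : ∃ β₁ ∈ B, β₁ ≠ β₀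
    · obtain ⟨β₁, hβ₁, hne⟩ := hB
      obtain ⟨i, hi⟩ := Function.ne_iff.1 hne
      set G : ℕ → AnGerm n := fun b => ∑ β ∈ B with β i = b,
        (∏ j ∈ Finset.univ.erase i, coord j ^ (e - β) j) * A β with hGdef
      have hG : ∀ b ≤ e i, G b = 0 := by
        refine eq_zero_of_sum_coord_pow_mul i (e i) G (fun b hb => ?_) ?_
        · simp only [hGdef, map_sum, map_mul, map_prod, map_pow]
          refine Finset.sum_congr rfl fun β hβ => ?_
          obtain ⟨hβB, hβb⟩ := Finset.mem_filter.1 hβ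
          rw [hA β hβB i (hβb ▸ hb)]
          congr 1
          refine Finset.prod_congr rfl fun j hj => ?_
          rw [zeroOut_coord, if_neg (by simpa using Finset.ne_of_mem_erase hj)]
        · rw [← h, ← Finset.sum_fiberwise_of_maps_to (s := B) (t := Finset.range (e i + 1))
            (g := fun β => β i) (fun β hβ => Finset.mem_range.2 (Nat.lt_succ_of_le (he β hβ i)))]
          refine Finset.sum_congr rfl fun b _ => ?_
          rw [hGdef, Finset.mul_sum]
          refine Finset.sum_congr rfl fun β hβ => ?_
          rw [mono_eq_erase_mul _ i, ← (Finset.mem_filter.1 hβ).2, Pi.sub_apply]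
          ring
      have hlt : (B.filter fun β => β i = β₀ i).card < c := by
        rw [← hc]
        exact Finset.card_lt_card (Finset.filter_ssubset.2 ⟨β₁, hβ₁, hi⟩)
      refine ih _ hlt _ (fun β hβ => he β (Finset.mem_filter.1 hβ).1)
        (fun β hβ => hA β (Finset.mem_filter.1 hβ).1) ?_ rfl β₀ (Finset.mem_filter.2 ⟨hβ₀, rfl⟩)
      have h1 := congrArg (fun g => coord i ^ (e i - β₀ i) * g) (hG (β₀ i) (he β₀ hβ₀ i))
      simp only [mul_zero, hGdef, Finset.mul_sum] at h1
      rw [← h1]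
      refine Finset.sum_congr rfl fun β hβ => ?_
      rw [mono_eq_erase_mul _ i, Pi.sub_apply, (Finset.mem_filter.1 hβ).2]
      ring
    · push Not at hB
      rw [Finset.sum_eq_single β₀ (fun β hβ hne => absurd (hB β hβ) hne)
        (fun h => absurd hβ₀ h)] at h
      have : ∀ s : Finset (Fin n), (∏ j ∈ s, coord j ^ (e - β₀) j) * A β₀ = 0 → A β₀ = 0 := by
        intro s
        induction s using Finset.induction_on with
        | empty => simp
        | insert a s ha ih' =>
          intro hs
          rw [Finset.prod_insert ha, mul_assoc] at hs
          exact ih' (eq_zero_of_coord_pow_mul hs)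
      exact this _ h

end AnGerm

/-! ### Normal forms of differential operators modulo left ideals -/

namespace GermOps

variable {n : ℕ} {D : Type*} [Ring D] (𝒟 : GermOps n D)

/-- The ring `D` is generated by the functions and the `∂ᵢ`: a set of operators that contains `1`
and is stable under addition and under left multiplication by generators is everything. -/
def Generates : Prop :=
  ∀ N : AddSubmonoid D, 1 ∈ N → (∀ g, ∀ P ∈ N, 𝒟.ofGerm g * P ∈ N) →
    (∀ i, ∀ P ∈ N, 𝒟.del i * P ∈ N) → ∀ P, P ∈ N

/-- The operator `∑ ∂^β a_β`. -/
noncomputable def rightSum (a : (Fin n → ℕ) →₀ AnGerm n) : D :=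
  a.sum fun β g => 𝒟.delPow β * 𝒟.ofGerm g

/-- A right normal form `∑ ∂^β a_β` is reduced if `a_β` does not involve the variables that occur
in `∂^β`. -/
def IsReduced (a : (Fin n → ℕ) →₀ AnGerm n) : Prop :=
  ∀ β i, β i ≠ 0 → AnGerm.zeroOut {i} (a β) = a β

theorem rightSum_add (a b : (Fin n → ℕ) →₀ AnGerm n) :
    𝒟.rightSum (a + b) = 𝒟.rightSum a + 𝒟.rightSum b :=
  Finsupp.sum_add_index' (fun β => by simp) (fun β g h => by rw [map_add, mul_add])

theorem rightSum_single (β : Fin n → ℕ) (g : AnGerm n) :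
    𝒟.rightSum (Finsupp.single β g) = 𝒟.delPow β * 𝒟.ofGerm g :=
  Finsupp.sum_single_index (by simp)

/-- The operators with a reduced right normal form modulo `K`. -/
noncomputable def reducible (K : Ideal D) : AddSubmonoid D where
  carrier := {P | ∃ a, IsReduced a ∧ P - 𝒟.rightSum a ∈ K}
  zero_mem' := ⟨0, fun β i _ => by simp, by simp [rightSum]⟩
  add_mem' := by
    rintro P Q ⟨a, ha, hP⟩ ⟨b, hb, hQ⟩
    refine ⟨a + b, fun β i h => by simp [ha β i h, hb β i h], ?_⟩
    rw [rightSum_add, add_sub_add_comm]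
    exact K.add_mem hP hQ

variable {𝒟}

theorem mem_reducible_of_mem {K : Ideal D} {P : D} (h : P ∈ K) : P ∈ 𝒟.reducible K :=
  ⟨0, fun β i _ => by simp, by simpa [rightSum] using h⟩

theorem delPow_mul_ofGerm_mem_reducible {K : Ideal D} {β : Fin n → ℕ} {g : AnGerm n}
    (h : ∀ i, β i ≠ 0 → AnGerm.zeroOut {i} g = g) :
    𝒟.delPow β * 𝒟.ofGerm g ∈ 𝒟.reducible K := by
  refine ⟨Finsupp.single β g, fun β' i hi => ?_, by simp [rightSum_single]⟩
  by_cases hβ : β = β'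
  · subst hβ; simpa using h i hi
  · simp [hβ]

theorem mul_mem_reducible_of_forall {K : Ideal D} (Q : D)
    (h : ∀ β g, (∀ i, β i ≠ 0 → AnGerm.zeroOut {i} g = g) →
      Q * (𝒟.delPow β * 𝒟.ofGerm g) ∈ 𝒟.reducible K) {P : D} (hP : P ∈ 𝒟.reducible K) :
    Q * P ∈ 𝒟.reducible K := by
  obtain ⟨a, ha, hP⟩ := hP
  rw [← sub_add_cancel P (𝒟.rightSum a), mul_add]
  refine add_mem (mem_reducible_of_mem (K.mul_mem_left _ hP)) ?_
  rw [rightSum, Finsupp.sum, Finset.mul_sum]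
  exact sum_mem fun β _ => h β _ (ha β)

theorem ofGerm_commutator (i : Fin n) (h : AnGerm n) :
    𝒟.del i * 𝒟.ofGerm (AnGerm.coord i * h) =
      𝒟.ofGerm h * (𝒟.del i * 𝒟.ofGerm (AnGerm.coord i)) +
        𝒟.ofGerm (AnGerm.coord i * AnGerm.partial i h) := by
  rw [𝒟.del_mul_ofGerm, 𝒟.del_mul_ofGerm, AnGerm.partial_mul, AnGerm.partial_coord]
  simp only [if_true, map_add, map_mul, map_one]
  rw [mul_add, ← mul_assoc, 𝒟.ofGerm_mul_comm h]
  noncomm_ring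

theorem del_mul_mem_reducible {K : Ideal D} (hK : ∀ i, 𝒟.del i * 𝒟.ofGerm (AnGerm.coord i) ∈ K)
    (i : Fin n) {P : D} (hP : P ∈ 𝒟.reducible K) : 𝒟.del i * P ∈ 𝒟.reducible K := by
  refine mul_mem_reducible_of_forall _ (fun β g hg => ?_) hP
  have inv : ∀ h, g = AnGerm.zeroOut {i} g + AnGerm.coord i * h → ∀ j ≠ i,
      AnGerm.zeroOut {j} g = g → AnGerm.zeroOut {j} h = h := by
    intro h hh j hj hjg
    rw [← sub_eq_zero]
    refine AnGerm.eq_zero_of_coord_mul (i := i) ?_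
    have h1 : AnGerm.coord i * h = g - AnGerm.zeroOut {i} g := by
      rw [eq_sub_iff_add_eq, add_comm]; exact hh.symm
    have h2 := congrArg (AnGerm.zeroOut {j}) h1
    rw [map_mul, AnGerm.zeroOut_coord, if_neg (by simpa using hj.symm), map_sub,
      AnGerm.zeroOut_zeroOut, Finset.union_comm, ← AnGerm.zeroOut_zeroOut, hjg, ← h1] at h2
    rw [mul_sub, h2, sub_self]
  by_cases hi : β i = 0
  · obtain ⟨h, hh⟩ := AnGerm.exists_eq_zeroOut_add i g
    have e : 𝒟.del i * (𝒟.delPow β * 𝒟.ofGerm g) =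
        𝒟.delPow (β + Pi.single i 1) * 𝒟.ofGerm (AnGerm.zeroOut {i} g) +
        (𝒟.delPow β * 𝒟.ofGerm h * (𝒟.del i * 𝒟.ofGerm (AnGerm.coord i)) +
          𝒟.delPow β * 𝒟.ofGerm (AnGerm.coord i * AnGerm.partial i h)) := by
      conv_lhs => rw [hh]
      rw [delPow_add_single, mul_assoc (𝒟.delPow β) (𝒟.ofGerm h), ← mul_add (𝒟.delPow β),
        ← ofGerm_commutator, map_add, mul_add, mul_add, ← mul_assoc, ← mul_assoc,
        (𝒟.del_commute_delPow i β).eq, mul_assoc (𝒟.delPow β) (𝒟.del i) (𝒟.ofGerm (_ * h))]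
    rw [e]
    refine add_mem (delPow_mul_ofGerm_mem_reducible fun j hj => ?_)
      (add_mem (mem_reducible_of_mem (K.mul_mem_left _ (hK i)))
        (delPow_mul_ofGerm_mem_reducible fun j hj => ?_))
    · by_cases hji : j = i
      · subst hji
        rw [AnGerm.zeroOut_zeroOut, Finset.union_self]
      · rw [AnGerm.zeroOut_zeroOut, Finset.union_comm, ← AnGerm.zeroOut_zeroOut,
          hg j (by simpa [hji] using hj)]
    · have hji : j ≠ i := fun e => hj (e ▸ hi)
      rw [map_mul, AnGerm.zeroOut_coord, if_neg (by simpa using hji.symm)]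
      have h3 := AnGerm.partial_zeroOut {j} i h
      rw [if_neg (by simpa using hji.symm), inv h hh j hji (hg j hj)] at h3
      rw [← h3]
  · rw [← mul_assoc, ← delPow_add_single]
    refine delPow_mul_ofGerm_mem_reducible fun j hj => hg j ?_
    by_cases hji : j = i
    · rwa [hji]
    · simpa [hji] using hj

theorem ofGerm_mul_mem_reducible {K : Ideal D} (hK : ∀ i, 𝒟.del i * 𝒟.ofGerm (AnGerm.coord i) ∈ K)
    (f : AnGerm n) {P : D} (hP : P ∈ 𝒟.reducible K) : 𝒟.ofGerm f * P ∈ 𝒟.reducible K := by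
  refine mul_mem_reducible_of_forall _ (fun β g hg => ?_) hP
  induction β using multiIndex_induction generalizing f with
  | zero =>
    rw [delPow_zero, one_mul, ← map_mul, ← one_mul (𝒟.ofGerm _), ← delPow_zero]
    exact delPow_mul_ofGerm_mem_reducible fun i hi => absurd rfl hi
  | add_single β i ih =>
    have hg' : ∀ j, β j ≠ 0 → AnGerm.zeroOut {j} g = g := fun j hj => hg j (by simp [hj])
    rw [delPow_add_single, mul_assoc, ← mul_assoc, ofGerm_mul_del, sub_mul, sub_eq_add_neg,
      ← neg_mul, ← map_neg, mul_assoc]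
    exact add_mem (del_mul_mem_reducible hK i (ih f hg')) (ih _ hg')

/-- Modulo the Euler operators `∂ᵢxᵢ` every operator has a reduced right normal form. -/
theorem Generates.exists_reduced (hgen : 𝒟.Generates) {K : Ideal D}
    (hK : ∀ i, 𝒟.del i * 𝒟.ofGerm (AnGerm.coord i) ∈ K) (P : D) :
    ∃ a, IsReduced a ∧ P - 𝒟.rightSum a ∈ K := by
  refine hgen (𝒟.reducible K) ?_ (fun g P => ofGerm_mul_mem_reducible hK g)
    (fun i P => del_mul_mem_reducible hK i) P
  have h := delPow_mul_ofGerm_mem_reducible (𝒟 := 𝒟) (K := K) (β := 0) (g := 1)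
    (fun i hi => absurd rfl hi)
  rwa [delPow_zero, map_one, one_mul] at h

/-! ### Left ideals without functions that restrict nontrivially to a coordinate subspace -/

theorem ofGerm_mem_of_zeroOut_eq_zero {L : Ideal D} {T : Finset (Fin n)}
    (hT : ∀ i ∈ T, 𝒟.ofGerm (AnGerm.coord i) ∈ L) {g : AnGerm n}
    (hg : AnGerm.zeroOut T g = 0) : 𝒟.ofGerm g ∈ L := by
  classical
  suffices h : 𝒟.ofGerm (g - AnGerm.zeroOut T g) ∈ L by rwa [hg, sub_zero] at h
  clear hg
  induction T using Finset.induction_on with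
  | empty => rw [AnGerm.zeroOut_empty, sub_self, map_zero]; exact L.zero_mem
  | insert i T hi ih =>
    obtain ⟨h, hh⟩ := AnGerm.exists_eq_zeroOut_add i (AnGerm.zeroOut T g)
    have e : g - AnGerm.zeroOut (insert i T) g = (g - AnGerm.zeroOut T g) + h * AnGerm.coord i := by
      rw [Finset.insert_eq, ← AnGerm.zeroOut_zeroOut]
      linear_combination hh
    rw [e, map_add, map_mul]
    exact L.add_mem (ih fun j hj => hT j (Finset.mem_insert_of_mem hj))
      (L.mul_mem_left _ (hT i (Finset.mem_insert_self i T)))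

theorem coord_pow_mul_delPow_mem {L : Ideal D} {i : Fin n}
    (hi : 𝒟.ofGerm (AnGerm.coord i) ∈ L) (β : Fin n → ℕ) {e : ℕ} (he : β i < e) :
    𝒟.ofGerm (AnGerm.coord i ^ e) * 𝒟.delPow β ∈ L := by
  induction β using multiIndex_induction generalizing e with
  | zero =>
    obtain ⟨e, rfl⟩ : ∃ e', e = e' + 1 := ⟨e - 1, by simp at he; omega⟩
    rw [delPow_zero, mul_one, pow_succ, map_mul]
    exact L.mul_mem_left _ hi
  | add_single β j ih =>
    rw [delPow_add_single, ← mul_assoc, ofGerm_mul_del, sub_mul, mul_assoc]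
    have hβ : β i < e := lt_of_le_of_lt (by simp) he
    refine L.sub_mem (L.mul_mem_left _ (ih hβ)) ?_
    rw [AnGerm.partial_coord_pow]
    split_ifs with hij
    · subst hij
      rw [map_nsmul, smul_mul_assoc]
      refine nsmul_mem (ih ?_) _
      simp at he; omega
    · simp

theorem mono_mul_delPow_mem {L : Ideal D} {i : Fin n}
    (hi : 𝒟.ofGerm (AnGerm.coord i) ∈ L) {β e : Fin n → ℕ} (he : β i < e i) :
    𝒟.ofGerm (AnGerm.mono e) * 𝒟.delPow β ∈ L := by
  rw [AnGerm.mono_eq_erase_mul e i, map_mul, mul_assoc]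
  exact L.mul_mem_left _ (coord_pow_mul_delPow_mem hi β he)

/-- Since `xᵢ∂ᵢ ≡ -1` modulo `L`, the product `x^e ∂^β` is a nonzero multiple of `x^(e - β)`. -/
theorem exists_mono_mul_delPow_sub_mem {L : Ideal D}
    (hL : ∀ i, 𝒟.del i * 𝒟.ofGerm (AnGerm.coord i) ∈ L) (β : Fin n → ℕ) :
    ∃ c : ℤ, c ≠ 0 ∧ ∀ e, β ≤ e →
      𝒟.ofGerm (AnGerm.mono e) * 𝒟.delPow β - c • 𝒟.ofGerm (AnGerm.mono (e - β)) ∈ L := by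
  induction β using multiIndex_induction with
  | zero => exact ⟨1, one_ne_zero, fun e _ => by simp [delPow_zero]⟩
  | add_single β i ih =>
    obtain ⟨c, hc, h⟩ := ih
    refine ⟨-(β i + 1) * c, mul_ne_zero (by omega) hc, fun e he => ?_⟩
    have hei : β i + 1 ≤ e i := by simpa using he i
    have hsplit : e = (e - (Pi.single i 1 : Fin n → ℕ)) + Pi.single i 1 := by
      ext j
      by_cases hj : j = i
      · subst hj; simp; omega
      · simp [hj]
    set e' : Fin n → ℕ := e - Pi.single i 1 with he'
    have hβ : β ≤ e' := by
      intro j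
      by_cases hj : j = i
      · subst hj; simp [he']; omega
      · simpa [he', hj] using he j
    have hsub : e - (β + Pi.single i 1) = e' - β := by
      rw [he']; ext j; simp only [Pi.sub_apply, Pi.add_apply]; omega
    have hx : 𝒟.ofGerm (AnGerm.coord i) * 𝒟.del i =
        𝒟.del i * 𝒟.ofGerm (AnGerm.coord i) - 1 := by
      rw [ofGerm_mul_del, AnGerm.partial_coord, if_pos rfl, map_one]
    have key : 𝒟.ofGerm (AnGerm.mono e) * 𝒟.delPow (β + Pi.single i 1) =
        𝒟.ofGerm (AnGerm.mono e') * 𝒟.delPow β * (𝒟.del i * 𝒟.ofGerm (AnGerm.coord i))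
          - ((β i : ℤ) + 1) • (𝒟.ofGerm (AnGerm.mono e') * 𝒟.delPow β) := by
      conv_lhs => rw [hsplit]
      rw [AnGerm.mono_add_single, map_mul, delPow_add_single, mul_assoc, ← mul_assoc _ (𝒟.del i),
        euler_mul_delPow, hx, add_smul, natCast_zsmul, one_smul]
      rw [mul_sub, mul_sub, mul_one, mul_sub, mul_smul_comm, mul_assoc]
      abel
    rw [key, hsub]
    have e2 : 𝒟.ofGerm (AnGerm.mono e') * 𝒟.delPow β * (𝒟.del i * 𝒟.ofGerm (AnGerm.coord i))
          - ((β i : ℤ) + 1) • (𝒟.ofGerm (AnGerm.mono e') * 𝒟.delPow β)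
          - (-((β i : ℤ) + 1) * c) • 𝒟.ofGerm (AnGerm.mono (e' - β)) =
        𝒟.ofGerm (AnGerm.mono e') * 𝒟.delPow β * (𝒟.del i * 𝒟.ofGerm (AnGerm.coord i))
          - ((β i : ℤ) + 1) • (𝒟.ofGerm (AnGerm.mono e') * 𝒟.delPow β
            - c • 𝒟.ofGerm (AnGerm.mono (e' - β))) := by
      rw [smul_sub, smul_smul, neg_mul, neg_smul]; abel
    rw [e2]
    exact L.sub_mem (L.mul_mem_left _ (hL i)) (zsmul_mem (h e' hβ) _)

/-- Let the left ideal `L` contain the `xᵢ` with `i ∉ S` and the `∂ᵢxᵢ`, and let every function in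
`L` vanish on the coordinate subspace of the variables in `S`. Then the coefficients of a reduced
operator in `L` vanish on that subspace. -/
theorem zeroOut_eq_zero_of_rightSum_mem {L : Ideal D} (S : Finset (Fin n))
    (hx : ∀ i ∉ S, 𝒟.ofGerm (AnGerm.coord i) ∈ L)
    (hθ : ∀ i, 𝒟.del i * 𝒟.ofGerm (AnGerm.coord i) ∈ L)
    (hL : ∀ g, 𝒟.ofGerm g ∈ L → AnGerm.zeroOut Sᶜ g = 0)
    {a : (Fin n → ℕ) →₀ AnGerm n} (ha : IsReduced a) (h : 𝒟.rightSum a ∈ L) (β : Fin n → ℕ) :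
    AnGerm.zeroOut Sᶜ (a β) = 0 := by
  classical
  by_contra hβ
  set s := a.support.filter fun β => AnGerm.zeroOut Sᶜ (a β) ≠ 0 with hs
  have hsne : s.Nonempty := ⟨β, by
    rw [hs, Finset.mem_filter, Finsupp.mem_support_iff]
    exact ⟨fun h0 => hβ (by rw [h0, map_zero]), hβ⟩⟩
  -- the order transversal to the subspace is maximal at `β₀`
  obtain ⟨β₀, hβ₀, hmax⟩ := s.exists_max_image (fun β => ∑ i ∈ Sᶜ, β i) hsne
  -- For `β ∈ s` the product `x^e ∂^β` lies in `L` unless `β` agrees with `β₀` outside `S`, as `x^e`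
  -- contains a variable outside `S` to a power exceeding `β`; the other terms are collected in `B`.
  set M : ℕ := ∑ β ∈ s, ∑ i, β i with hM
  set e : Fin n → ℕ := fun i => if i ∈ S then M else β₀ i with he
  have hMle : ∀ β ∈ s, ∀ i, β i ≤ M := fun β hβ i =>
    (Finset.single_le_sum (f := β) (fun _ _ => Nat.zero_le _) (Finset.mem_univ i)).trans
      (Finset.single_le_sum (f := fun β : Fin n → ℕ => ∑ i, β i) (fun _ _ => Nat.zero_le _) hβ)
  set B := s.filter fun β => ∀ i ∉ S, β i = β₀ i with hB
  have hBle : ∀ β ∈ B, β ≤ e := fun β hβ i => by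
    obtain ⟨hβs, hβ'⟩ := Finset.mem_filter.1 hβ
    by_cases hi : i ∈ S
    · simpa [he, hi] using hMle β hβs i
    · simp [he, hi, hβ' i hi]
  have hsB : ∀ β ∈ s, β ∉ B → ∃ i ∉ S, β i < e i := by
    intro β hβ hnB
    by_contra! hcon
    refine hnB (Finset.mem_filter.2 ⟨hβ, ?_⟩)
    have hle : ∀ i ∈ Sᶜ, β₀ i ≤ β i := fun i hi => by
      have hi' := Finset.mem_compl.1 hi
      simpa [he, hi'] using hcon i hi'
    have hsum := (Finset.sum_eq_sum_iff_of_le hle).1 (le_antisymm (Finset.sum_le_sum hle)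
      (hmax β hβ))
    exact fun i hi => (hsum i (Finset.mem_compl.2 hi)).symm
  choose c hc0 hc using fun β => exists_mono_mul_delPow_sub_mem hθ β
  set A : (Fin n → ℕ) → AnGerm n := fun β => c β • AnGerm.zeroOut Sᶜ (a β) with hA
  have hmem : 𝒟.ofGerm (∑ β ∈ B, AnGerm.mono (e - β) * (c β • a β)) ∈ L := by
    have h1 : 𝒟.ofGerm (AnGerm.mono e) * 𝒟.rightSum a ∈ L := L.mul_mem_left _ h
    have h2 : ∀ β ∈ a.support, 𝒟.ofGerm (AnGerm.mono e) * (𝒟.delPow β * 𝒟.ofGerm (a β)) -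
        (if β ∈ B then 𝒟.ofGerm (AnGerm.mono (e - β) * (c β • a β)) else 0) ∈ L := by
      intro β hβ
      have hcom : 𝒟.ofGerm (AnGerm.mono e) * (𝒟.delPow β * 𝒟.ofGerm (a β)) =
          𝒟.ofGerm (a β) * (𝒟.ofGerm (AnGerm.mono e) * 𝒟.delPow β) := by
        rw [← (𝒟.ofGerm_commute_delPow (ha β)).eq, ← mul_assoc, ← mul_assoc, 𝒟.ofGerm_mul_comm]
      split_ifs with hβB
      · have e3 : 𝒟.ofGerm (AnGerm.mono (e - β) * (c β • a β)) =
            𝒟.ofGerm (a β) * (c β • 𝒟.ofGerm (AnGerm.mono (e - β))) := by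
          rw [← map_zsmul 𝒟.ofGerm, ← map_mul]
          congr 1
          rw [mul_smul_comm, mul_smul_comm, mul_comm]
        rw [hcom, e3, ← mul_sub]
        exact L.mul_mem_left _ (hc β e (hBle β hβB))
      · rw [sub_zero]
        by_cases hβs : β ∈ s
        · obtain ⟨i, hi, hlt⟩ := hsB β hβs hβB
          rw [hcom]
          exact L.mul_mem_left _ (mono_mul_delPow_mem (hx i hi) hlt)
        · have h0 : AnGerm.zeroOut Sᶜ (a β) = 0 := by
            by_contra hne
            exact hβs (Finset.mem_filter.2 ⟨hβ, hne⟩)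
          exact L.mul_mem_left _ (L.mul_mem_left _ (ofGerm_mem_of_zeroOut_eq_zero
            (fun i hi => hx i (Finset.mem_compl.1 hi)) h0))
    have h3 := L.sum_mem h2
    rw [Finset.sum_sub_distrib, ← Finset.mul_sum, Finset.sum_ite_mem,
      Finset.inter_eq_right.2 ((Finset.filter_subset _ _).trans (Finset.filter_subset _ _)),
      ← map_sum] at h3
    have h4 := L.sub_mem h1 h3
    rwa [rightSum, Finsupp.sum, sub_sub_cancel] at h4
  have hzero := hL _ hmem
  have hzero' : ∑ β ∈ B, AnGerm.mono (e - β) * A β = 0 := by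
    rw [map_sum] at hzero
    rw [← hzero]
    refine Finset.sum_congr rfl fun β hβ => ?_
    rw [map_mul, map_zsmul]
    congr 1
    rw [AnGerm.mono, map_prod]
    refine Finset.prod_congr rfl fun i _ => ?_
    by_cases hi : i ∈ S
    · rw [map_pow, AnGerm.zeroOut_coord, if_neg (by simpa using hi)]
    · have : (e - β) i = 0 := by
        simp [he, hi, (Finset.mem_filter.1 hβ).2 i hi]
      rw [this, pow_zero, map_one]
  have hfin := AnGerm.eq_zero_of_sum_mono_mul B e A hBle (fun β hβ i hi => by
    rw [hA, map_zsmul, AnGerm.zeroOut_zeroOut, Finset.union_comm, ← AnGerm.zeroOut_zeroOut,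
      ha β i hi]) hzero' β₀ (Finset.mem_filter.2 ⟨hβ₀, fun _ _ => rfl⟩)
  exact (Finset.mem_filter.1 hβ₀).2 (AnGerm.eq_zero_of_zsmul (hc0 β₀) hfin)

end GermOps

/-! ### The annihilators of a chain of generalized eigenvectors -/

namespace GermOps

variable {n : ℕ} {D : Type*} [Ring D] {𝒟 : GermOps n D}

/-- Powers of a function form a left Ore set. -/
theorem Generates.exists_pow_mul_eq (hgen : 𝒟.Generates) (g : AnGerm n) (Q : D) (b : ℕ) :
    ∃ b₀, ∀ b' ≥ b₀, ∃ Q', 𝒟.ofGerm (g ^ b') * Q = Q' * 𝒟.ofGerm (g ^ b) := by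
  let N : AddSubmonoid D :=
    { carrier := {Q | ∀ b, ∃ b₀, ∀ b' ≥ b₀, ∃ Q', 𝒟.ofGerm (g ^ b') * Q = Q' * 𝒟.ofGerm (g ^ b)}
      zero_mem' := fun b => ⟨0, fun b' _ => ⟨0, by simp⟩⟩
      add_mem' := by
        intro P Q hP hQ b
        obtain ⟨b₁, h₁⟩ := hP b
        obtain ⟨b₂, h₂⟩ := hQ b
        refine ⟨max b₁ b₂, fun b' hb' => ?_⟩
        obtain ⟨P', hP'⟩ := h₁ b' (le_trans (le_max_left _ _) hb')
        obtain ⟨Q', hQ'⟩ := h₂ b' (le_trans (le_max_right _ _) hb')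
        exact ⟨P' + Q', by rw [mul_add, hP', hQ', add_mul]⟩ }
  refine hgen N (fun b => ⟨b, fun b' hb' => ⟨𝒟.ofGerm (g ^ (b' - b)), ?_⟩⟩) (fun f P hP b => ?_)
    (fun i P hP b => ?_) Q b
  · rw [mul_one, ← map_mul, ← pow_add, Nat.sub_add_cancel hb']
  · obtain ⟨b₀, h⟩ := hP b
    refine ⟨b₀, fun b' hb' => ?_⟩
    obtain ⟨Q', hQ'⟩ := h b' hb'
    exact ⟨𝒟.ofGerm f * Q', by rw [← mul_assoc, 𝒟.ofGerm_mul_comm, mul_assoc, hQ', mul_assoc]⟩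
  · obtain ⟨b₀, h⟩ := hP b
    refine ⟨b₀ + 1, fun b' hb' => ?_⟩
    obtain ⟨b'', rfl⟩ : ∃ b'', b' = b'' + 1 := ⟨b' - 1, by omega⟩
    obtain ⟨Q', hQ'⟩ := h b'' (by omega)
    -- `g^(b+1) ∂ᵢ = (∂ᵢ g - (b+1) ∂ᵢg) g^b`
    have hder : ∃ f, AnGerm.partial i (g ^ (b'' + 1)) = f * g ^ b'' := by
      clear hb' hQ'
      induction b'' with
      | zero => exact ⟨AnGerm.partial i g, by simp⟩
      | succ m ih =>
        obtain ⟨f, hf⟩ := ih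
        refine ⟨f + AnGerm.partial i g, ?_⟩
        rw [pow_succ, AnGerm.partial_mul, hf]
        ring
    obtain ⟨f, hf⟩ := hder
    refine ⟨(𝒟.del i * 𝒟.ofGerm g - 𝒟.ofGerm f) * Q', ?_⟩
    rw [← mul_assoc, ofGerm_mul_del, hf, mul_assoc _ Q', ← hQ', ← mul_assoc, pow_succ', map_mul,
      map_mul]
    noncomm_ring

/-- The operators that fall into the left ideal `A` after multiplication by a power of `g`. -/
def Generates.saturation (hgen : 𝒟.Generates) (g : AnGerm n) (A : Ideal D) : Ideal D where
  carrier := {P | ∃ b, 𝒟.ofGerm (g ^ b) * P ∈ A}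
  zero_mem' := ⟨0, by simp⟩
  add_mem' := by
    rintro P Q ⟨b, hb⟩ ⟨c, hc⟩
    refine ⟨b + c, ?_⟩
    rw [mul_add, pow_add, map_mul]
    refine A.add_mem ?_ ?_
    · rw [𝒟.ofGerm_mul_comm, mul_assoc]; exact A.mul_mem_left _ hb
    · rw [mul_assoc]; exact A.mul_mem_left _ hc
  smul_mem' := by
    rintro Q P ⟨b, hb⟩
    obtain ⟨b₀, h⟩ := hgen.exists_pow_mul_eq g Q b
    obtain ⟨Q', hQ'⟩ := h b₀ le_rfl
    refine ⟨b₀, ?_⟩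
    rw [smul_eq_mul, ← mul_assoc, hQ', mul_assoc]
    exact A.mul_mem_left _ hb

/-- The products of `m` distinct coordinates and the operators `x₁∂₁ - xᵢ∂ᵢ`. -/
def generators (𝒟 : GermOps n D) (hn : 0 < n) (m : ℕ) : Set D :=
  {P | ∃ J : Finset (Fin n), J.card = m ∧ P = 𝒟.ofGerm (∏ j ∈ J, AnGerm.coord j)} ∪
  {P | ∃ i : Fin n, i ≠ ⟨0, hn⟩ ∧
    P = 𝒟.ofGerm (AnGerm.coord ⟨0, hn⟩) * 𝒟.del ⟨0, hn⟩
      - 𝒟.ofGerm (AnGerm.coord i) * 𝒟.del i}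

theorem del_mul_coord_sub (i j : Fin n) :
    𝒟.del i * 𝒟.ofGerm (AnGerm.coord i) - 𝒟.del j * 𝒟.ofGerm (AnGerm.coord j) =
      𝒟.ofGerm (AnGerm.coord i) * 𝒟.del i - 𝒟.ofGerm (AnGerm.coord j) * 𝒟.del j := by
  rw [𝒟.del_mul_ofGerm, 𝒟.del_mul_ofGerm, AnGerm.partial_coord, AnGerm.partial_coord]
  simp

theorem del_mul_coord_sub_mem_span (hn : 0 < n) (m : ℕ) (i : Fin n) :
    𝒟.del ⟨0, hn⟩ * 𝒟.ofGerm (AnGerm.coord ⟨0, hn⟩) - 𝒟.del i * 𝒟.ofGerm (AnGerm.coord i) ∈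
      Ideal.span (𝒟.generators hn m) := by
  by_cases hi : i = ⟨0, hn⟩
  · rw [hi, sub_self]; exact Ideal.zero_mem _
  · rw [del_mul_coord_sub]
    exact Ideal.subset_span (Or.inr ⟨i, hi, rfl⟩)

/-- Right multiplication by `∂₁x₁`, which commutes with the `x₁∂₁ - xᵢ∂ᵢ` and is congruent to all
`∂ᵢxᵢ`, adds one factor to the products of coordinates. -/
theorem span_generators_mul_mem (hn : 0 < n) {m : ℕ} (hm : m < n) {P : D}
    (hP : P ∈ Ideal.span (𝒟.generators hn m)) :
    P * (𝒟.del ⟨0, hn⟩ * 𝒟.ofGerm (AnGerm.coord ⟨0, hn⟩)) ∈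
      Ideal.span (𝒟.generators hn (m + 1)) := by
  set I := Ideal.span (𝒟.generators hn (m + 1)) with hI
  set θ : Fin n → D := fun i => 𝒟.del i * 𝒟.ofGerm (AnGerm.coord i) with hθ
  have hcom : ∀ i j, θ i * θ j = θ j * θ i := by
    intro i j
    by_cases hij : i = j
    · rw [hij]
    have h1 : ∀ i j : Fin n, i ≠ j → Commute (𝒟.del i) (𝒟.ofGerm (AnGerm.coord j)) := by
      intro i j hij
      rw [Commute, SemiconjBy, 𝒟.del_mul_ofGerm, AnGerm.partial_coord, if_neg hij]
      simp
    exact (((𝒟.del_comm i j).mul_right (h1 i j hij)).mul_left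
      ((h1 j i (Ne.symm hij)).symm.mul_right (𝒟.ofGerm_mul_comm _ _))).eq
  have hspan : Ideal.span (𝒟.generators hn m) ≤
      Submodule.comap (LinearMap.toSpanSingleton D D (θ ⟨0, hn⟩)) I := by
    rw [Ideal.span_le]
    rintro Q (⟨J, hJ, rfl⟩ | ⟨i, hi, rfl⟩)
    · change 𝒟.ofGerm (∏ j ∈ J, AnGerm.coord j) * θ ⟨0, hn⟩ ∈ I
      obtain ⟨i, hi⟩ : ∃ i, i ∉ J := by
        by_contra! hall
        have := Finset.card_eq_iff_eq_univ J |>.2 (Finset.eq_univ_of_forall hall)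
        simp at this; omega
      have e1 : 𝒟.ofGerm (∏ j ∈ J, AnGerm.coord j) * θ i =
          𝒟.del i * 𝒟.ofGerm (∏ j ∈ insert i J, AnGerm.coord j) := by
        have h0 : AnGerm.partial i (∏ j ∈ J, AnGerm.coord j) = (0 : AnGerm n) := by
          refine AnGerm.partial_eq_zero_of_zeroOut_eq ?_
          rw [AnGerm.zeroOut_prod_coord, if_pos (by simpa using hi)]
        rw [hθ, ← mul_assoc, ofGerm_mul_del, h0, map_zero, sub_zero, mul_assoc, ← map_mul,
          Finset.prod_insert hi, mul_comm (AnGerm.coord i)]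
      have e2 := I.mul_mem_left (𝒟.ofGerm (∏ j ∈ J, AnGerm.coord j))
        (del_mul_coord_sub_mem_span (𝒟 := 𝒟) hn (m + 1) i)
      rw [mul_sub] at e2
      have e3 : 𝒟.ofGerm (∏ j ∈ J, AnGerm.coord j) * θ i ∈ I := by
        rw [e1]
        exact I.mul_mem_left _ (Ideal.subset_span
          (Or.inl ⟨insert i J, by rw [Finset.card_insert_of_notMem hi, hJ], rfl⟩))
      have := I.add_mem e2 e3
      rwa [sub_add_cancel] at this
    · change (_ - _) * θ ⟨0, hn⟩ ∈ I
      rw [← del_mul_coord_sub, sub_mul]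
      change θ ⟨0, hn⟩ * θ ⟨0, hn⟩ - θ i * θ ⟨0, hn⟩ ∈ I
      rw [hcom i, ← mul_sub]
      exact I.mul_mem_left _ (del_mul_coord_sub_mem_span hn (m + 1) i)
  exact hspan hP

/-- Let `A m` be the annihilators of vectors `w m`, `m ≤ n`, in a `D`-module such that `w 0 = 0`
and `∂ᵢxᵢ w (m + 1) = w m` for all `i`, such that the products of `m` distinct coordinates kill
`w m`, and such that every function that kills `w (m + 1)` vanishes on the `m`-dimensional
coordinate subspaces. Then `A m` is generated by the obvious annihilators. -/
theorem Generates.annihilator_eq_span (hgen : 𝒟.Generates) (hn : 0 < n) (A : ℕ → Ideal D)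
    (h0 : A 0 = ⊤)
    (hθ : ∀ m < n, ∀ i P, P * (𝒟.del i * 𝒟.ofGerm (AnGerm.coord i)) ∈ A (m + 1) ↔ P ∈ A m)
    (hdiff : ∀ m < n, ∀ i j, 𝒟.del i * 𝒟.ofGerm (AnGerm.coord i) -
      𝒟.del j * 𝒟.ofGerm (AnGerm.coord j) ∈ A (m + 1))
    (hprod : ∀ J : Finset (Fin n), 𝒟.ofGerm (∏ j ∈ J, AnGerm.coord j) ∈ A J.card)
    (hfun : ∀ S : Finset (Fin n), S.card < n → ∀ g, 𝒟.ofGerm g ∈ A (S.card + 1) →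
      AnGerm.zeroOut Sᶜ g = 0) :
    ∀ m ≤ n, A m = Ideal.span (𝒟.generators hn m) := by
  classical
  intro m
  induction m with
  | zero =>
    intro _
    rw [h0, eq_comm, Ideal.eq_top_iff_one]
    exact Ideal.subset_span (Or.inl ⟨∅, rfl, by simp⟩)
  | succ m ih =>
    intro hm
    have hmn : m < n := hm
    have ih := ih hmn.le
    set I := Ideal.span (𝒟.generators hn (m + 1)) with hI
    have hIA : I ≤ A (m + 1) := by
      rw [hI, Ideal.span_le]
      rintro Q (⟨J, hJ, rfl⟩ | ⟨i, hi, rfl⟩)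
      · rw [← hJ]; exact hprod J
      · rw [← del_mul_coord_sub]; exact hdiff m hmn _ _
    refine le_antisymm (fun P hP => ?_) hIA
    set θ : D := 𝒟.del ⟨0, hn⟩ * 𝒟.ofGerm (AnGerm.coord ⟨0, hn⟩) with hθdef
    obtain ⟨a, ha, hκ⟩ := hgen.exists_reduced (K := I ⊔ Ideal.span {θ}) (fun i => by
      have h1 := (I ⊔ Ideal.span {θ}).sub_mem
        (Ideal.mem_sup_right (Ideal.mem_span_singleton_self θ))
        (Ideal.mem_sup_left (del_mul_coord_sub_mem_span (𝒟 := 𝒟) hn (m + 1) i))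
      rwa [sub_sub_cancel] at h1) P
    -- after saturation by `x_S` the annihilator contains the `∂ᵢxᵢ`, and the `xᵢ` with `i ∉ S`
    have hvan : ∀ S : Finset (Fin n), S.card = m → ∀ β, AnGerm.zeroOut Sᶜ (a β) = 0 := by
      intro S hS
      set L := hgen.saturation (∏ j ∈ S, AnGerm.coord j) (A (m + 1)) with hL
      have hAL : A (m + 1) ≤ L := fun Q hQ => ⟨0, by simpa using hQ⟩
      have hθL : ∀ i, 𝒟.del i * 𝒟.ofGerm (AnGerm.coord i) ∈ L := fun i => ⟨1, by
        rw [pow_one, hθ m hmn, ← hS]; exact hprod S⟩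
      refine zeroOut_eq_zero_of_rightSum_mem (L := L) S (fun i hi => ⟨1, ?_⟩) hθL
        (fun g hg => ?_) ha ?_
      · rw [pow_one, ← map_mul, mul_comm, ← Finset.prod_insert hi, ← hS,
          ← Finset.card_insert_of_notMem hi]
        exact hprod _
      · obtain ⟨b, hb⟩ := hg
        rw [← map_mul, ← hS] at hb
        have h2 := hfun S (by omega) _ hb
        rw [map_mul, map_pow, AnGerm.zeroOut_prod_coord, if_pos disjoint_compl_right] at h2
        clear hb
        induction b with
        | zero => simpa using h2
        | succ b ihb =>
          rw [pow_succ', mul_assoc] at h2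
          exact ihb (AnGerm.eq_zero_of_prod_coord_mul S h2)
      · have hKL : I ⊔ Ideal.span {θ} ≤ L := by
          refine sup_le (hIA.trans hAL) ?_
          rw [Ideal.span_le, Set.singleton_subset_iff]
          exact hθL _
        have := L.sub_mem (hAL hP) (hKL hκ)
        rwa [sub_sub_cancel] at this
    -- the coefficients vanish on all `m`-dimensional coordinate subspaces
    have hsum : 𝒟.rightSum a ∈ I := by
      refine I.sum_mem fun β _ => I.mul_mem_left _ ?_
      have h3 := AnGerm.mem_span_of_zeroOut_eq_zero hmn.le (fun S hS => hvan S hS β)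
      refine Submodule.span_induction ?_ ?_ ?_ ?_ h3
      · rintro _ ⟨J, hJ, rfl⟩
        exact Ideal.subset_span (Or.inl ⟨J, hJ, rfl⟩)
      · rw [map_zero]; exact I.zero_mem
      · intro f g _ _ hf hg; rw [map_add]; exact I.add_mem hf hg
      · intro f g _ hg; rw [smul_eq_mul, map_mul]; exact I.mul_mem_left _ hg
    -- the remaining part is `P' ∂₁x₁` up to `I`, and `P'` belongs to the previous annihilator
    obtain ⟨κ, hκI, κ', hκ', hsplit⟩ := Submodule.mem_sup.1 hκ
    obtain ⟨P', rfl⟩ := Ideal.mem_span_singleton'.1 hκ'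
    have hP' : P' ∈ A m := by
      rw [← hθ m hmn ⟨0, hn⟩]
      have h4 := (A (m + 1)).sub_mem ((A (m + 1)).sub_mem hP (hIA hsum)) (hIA hκI)
      rwa [← hsplit, add_sub_cancel_left] at h4
    rw [ih] at hP'
    have h5 := I.add_mem hsum (I.add_mem hκI (span_generators_mul_mem hn hmn hP'))
    rwa [← hθdef, hsplit, add_sub_cancel] at h5

end GermOps

/-! ### The ring of germs of differential operators -/

namespace AnGerm

variable {n : ℕ}

theorem partial_mono (i : Fin n) (α : Fin n → ℕ) :
    AnGerm.partial i (mono α) = α i • mono (α - Pi.single i 1) := by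
  have h0 : AnGerm.partial i (∏ j ∈ Finset.univ.erase i, coord j ^ α j) = (0 : AnGerm n) := by
    refine partial_eq_zero_of_zeroOut_eq ?_
    rw [map_prod]
    refine Finset.prod_congr rfl fun j hj => ?_
    rw [map_pow, zeroOut_coord, if_neg (by simpa using Finset.ne_of_mem_erase hj)]
  rw [mono_eq_erase_mul α i, mono_eq_erase_mul _ i, partial_mul, h0, partial_coord_pow,
    if_pos rfl, zero_mul, zero_add, mul_smul_comm]
  congr 2
  · refine Finset.prod_congr rfl fun j hj => ?_
    simp [Finset.ne_of_mem_erase hj]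
  · simp

end AnGerm

namespace diffOpStalk

variable {n : ℕ}

theorem algebraMap_eq_ofGerm (c : ℂ) :
    algebraMap ℂ (diffOpStalk n) c = ofGerm (AnGerm.constHom n c) := by
  refine Subtype.ext (LinearMap.ext fun h => ?_)
  exact Algebra.smul_def c h

/-- The stalk of differential operators as a ring generated by functions and derivatives. -/
noncomputable def germOps (n : ℕ) : GermOps n (diffOpStalk n) where
  ofGerm :=
    { toFun := ofGerm
      map_one' := Subtype.ext (LinearMap.ext fun h => one_mul h)
      map_zero' := Subtype.ext (LinearMap.ext fun h => zero_mul h)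
      map_mul' := fun g g' => Subtype.ext (LinearMap.ext fun h => mul_assoc g g' h)
      map_add' := fun g g' => Subtype.ext (LinearMap.ext fun h => add_mul g g' h) }
  del := del
  del_comm i j := Subtype.ext (LinearMap.ext fun h => AnGerm.partial_comm i j h)
  del_mul_ofGerm i g := by
    refine Subtype.ext (LinearMap.ext fun h => ?_)
    change AnGerm.partial i (g * h) = g * AnGerm.partial i h + AnGerm.partial i g * h
    rw [AnGerm.partial_mul, add_comm]

theorem germOps_ofGerm (g : AnGerm n) : (germOps n).ofGerm g = ofGerm g := rfl

theorem germOps_generates (n : ℕ) : (germOps n).Generates := by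
  intro N h1 hg hd Q
  suffices h : ∀ P ∈ N, Q * P ∈ N by simpa using h 1 h1
  obtain ⟨Q, hQ⟩ := Q
  induction hQ using Algebra.adjoin_induction with
  | mem x hx =>
    rcases hx with ⟨g, rfl⟩ | ⟨i, rfl⟩
    · exact hg g
    · exact hd i
  | algebraMap c =>
    intro P hP
    have := hg (AnGerm.constHom n c) P hP
    rw [germOps_ofGerm, ← algebraMap_eq_ofGerm] at this
    exact this
  | add x y hx hy ihx ihy =>
    intro P hP
    have := N.add_mem (ihx P hP) (ihy P hP)
    rw [← add_mul] at this
    exact this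
  | mul x y hx hy ihx ihy =>
    intro P hP
    have := ihx _ (ihy P hP)
    rw [← mul_assoc] at this
    exact this

theorem delPow_add_single (β : Fin n → ℕ) (i : Fin n) :
    delPow (β + Pi.single i 1) = del i * delPow β := (germOps n).delPow_add_single β i

theorem delPow_zero : delPow (0 : Fin n → ℕ) = 1 := (germOps n).delPow_zero

theorem delPow_add_single_apply (β : Fin n → ℕ) (i : Fin n) (h : AnGerm n) :
    (delPow (β + Pi.single i 1) : Module.End ℂ (AnGerm n)) h =
      (delPow β : Module.End ℂ (AnGerm n)) (AnGerm.partial i h) := by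
  have e : del i * delPow β = delPow β * del i := ((germOps n).del_commute_delPow i β).eq
  rw [delPow_add_single, e]
  rfl

theorem delPow_mono_self (α : Fin n → ℕ) :
    ∃ c : ℕ, c ≠ 0 ∧ (delPow α : Module.End ℂ (AnGerm n)) (AnGerm.mono α) = c • 1 := by
  induction α using multiIndex_induction with
  | zero => exact ⟨1, one_ne_zero, by rw [delPow_zero]; simp [AnGerm.mono]⟩
  | add_single α i ih =>
    obtain ⟨c, hc, h⟩ := ih
    refine ⟨(α i + 1) * c, mul_ne_zero (Nat.succ_ne_zero _) hc, ?_⟩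
    rw [delPow_add_single_apply, AnGerm.partial_mono, map_nsmul, add_tsub_cancel_right, h,
      smul_smul]
    simp

theorem delPow_mono_eq_zero (β : Fin n → ℕ) {α : Fin n → ℕ} (h : ∃ i, α i < β i) :
    (delPow β : Module.End ℂ (AnGerm n)) (AnGerm.mono α) = 0 := by
  induction β using multiIndex_induction generalizing α with
  | zero => simp at h
  | add_single β i ih =>
    rw [delPow_add_single_apply, AnGerm.partial_mono, map_nsmul]
    by_cases hi : α i = 0
    · rw [hi, zero_smul]
    · obtain ⟨j, hj⟩ := h
      rw [ih ⟨j, ?_⟩, smul_zero]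
      by_cases hji : j = i
      · subst hji; simp at hj ⊢; omega
      · simpa [hji] using hj

/-- The coefficients of a differential operator `∑ a_β ∂^β` are determined by the operator: they
can be read off from its action on monomials. -/
theorem eq_zero_of_sum_mul_delPow {s : Finset (Fin n → ℕ)} {a : (Fin n → ℕ) → AnGerm n}
    (h : ∑ β ∈ s, ofGerm (a β) * delPow β = 0) : ∀ β ∈ s, a β = 0 := by
  intro α hα
  induction hm : ∑ i, α i using Nat.strong_induction_on generalizing α with
  | _ m ih =>
    have h1 : ∑ β ∈ s, a β * (delPow β : Module.End ℂ (AnGerm n)) (AnGerm.mono α) = 0 := by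
      have h2 := congrArg (fun P : diffOpStalk n =>
        (P : Module.End ℂ (AnGerm n)) (AnGerm.mono α)) h
      simp only [AddSubmonoidClass.coe_finsetSum, LinearMap.sum_apply] at h2
      exact h2
    obtain ⟨c, hc, hcα⟩ := delPow_mono_self α
    rw [Finset.sum_eq_single_of_mem α hα, hcα, mul_smul_comm, mul_one] at h1
    · exact AnGerm.eq_zero_of_zsmul (c := c) (by exact_mod_cast hc) (by rwa [natCast_zsmul])
    · intro β hβ hne
      by_cases hlt : ∃ i, α i < β i
      · rw [delPow_mono_eq_zero β hlt, mul_zero]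
      · push Not at hlt
        have hsum : ∑ i, β i < m := by
          obtain ⟨i, hi⟩ := Function.ne_iff.1 hne
          rw [← hm]
          exact Finset.sum_lt_sum (fun i _ => hlt i) ⟨i, Finset.mem_univ i,
            lt_of_le_of_ne (hlt i) hi⟩
        rw [ih _ hsum β hβ rfl, zero_mul]

end diffOpStalk

/-! ### Transposed operators on test functions -/

section TestOperators

variable {n : ℕ} {V : Opens (RSpace n)}

/-- Multiplication by an analytic function, as an endomorphism of the space of test functions. -/
noncomputable def mulTestEnd (a : RSpace n → ℂ) (ha : AnalyticOnNhd ℝ a V) :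
    Module.End ℂ 𝓓(V, ℂ) where
  toFun := mulTest a ha
  map_add' φ ψ := by
    ext x; change a x * (φ x + ψ x) = a x * φ x + a x * ψ x; ring
  map_smul' c φ := by
    ext x; change a x * (c * φ x) = c * (a x * φ x); ring

theorem mulTestEnd_apply (a : RSpace n → ℂ) (ha : AnalyticOnNhd ℝ a V) (φ : 𝓓(V, ℂ))
    (x : RSpace n) : mulTestEnd a ha φ x = a x * φ x := rfl

/-- The partial derivative `∂ᵢ` of test functions. -/
noncomputable def delTest (i : Fin n) : 𝓓(V, ℂ) →L[ℂ] 𝓓(V, ℂ) :=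
  TestFunction.lineDerivCLM ℂ (Pi.single i (1 : ℝ))

theorem TestFunction.differentiable_coe (φ : 𝓓(V, ℂ)) : Differentiable ℝ φ :=
  φ.contDiff.differentiable (by simp)

theorem delTest_apply (i : Fin n) (φ : 𝓓(V, ℂ)) (x : RSpace n) :
    delTest i φ x = fderiv ℝ φ x (Pi.single i 1) := by
  rw [delTest, TestFunction.lineDerivCLM_apply_of_le (by simp),
    (TestFunction.differentiable_coe φ x).lineDeriv_eq_fderiv]

theorem delTest_comm (i j : Fin n) : Commute (delTest i : 𝓓(V, ℂ) →L[ℂ] 𝓓(V, ℂ)) (delTest j) := by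
  refine ContinuousLinearMap.ext fun φ => TestFunction.ext fun x => ?_
  change delTest i (delTest j φ) x = delTest j (delTest i φ) x
  have hs : IsSymmSndFDerivAt ℝ φ x := φ.contDiff.contDiffAt.isSymmSndFDerivAt (by
    rw [minSmoothness_of_isRCLikeNormedField]; exact WithTop.coe_le_coe.2 (le_top : (2 : ℕ∞) ≤ ⊤))
  have hd : DifferentiableAt ℝ (fderiv ℝ φ) x :=
    (φ.contDiff.fderiv_right (m := 1)
      (WithTop.coe_le_coe.2 (le_top : (2 : ℕ∞) ≤ ⊤))).differentiable (by simp) x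
  have e : ∀ i j : Fin n, delTest i (delTest j φ) x =
      fderiv ℝ (fderiv ℝ φ) x (Pi.single i 1) (Pi.single j 1) := by
    intro i j
    rw [delTest_apply, show (delTest j φ : RSpace n → ℂ) = fun y => fderiv ℝ φ y (Pi.single j 1)
      from funext fun y => delTest_apply j φ y, fderiv_clm_apply hd (differentiableAt_const _)]
    simp
  rw [e, e]
  exact hs _ _

theorem testDelPow_zero : (testDelPow 0 : 𝓓(V, ℂ) →L[ℂ] 𝓓(V, ℂ)) = 1 := by
  simp [testDelPow]

theorem testDelPow_add_single (β : Fin n → ℕ) (i : Fin n) :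
    (testDelPow (β + Pi.single i 1) : 𝓓(V, ℂ) →L[ℂ] 𝓓(V, ℂ)) = delTest i * testDelPow β :=
  prod_ofFn_pow_add_single _ delTest_comm β i

theorem delTest_commute_testDelPow (i : Fin n) (β : Fin n → ℕ) :
    Commute (delTest i : 𝓓(V, ℂ) →L[ℂ] 𝓓(V, ℂ)) (testDelPow β) := by
  induction β using multiIndex_induction with
  | zero => rw [testDelPow_zero]; exact Commute.one_right _
  | add_single β j ih => rw [testDelPow_add_single]; exact (delTest_comm i j).mul_right ih

theorem testDelPow_add_single_apply (β : Fin n → ℕ) (i : Fin n) (φ : 𝓓(V, ℂ)) :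
    testDelPow (β + Pi.single i 1) φ = testDelPow β (delTest i φ) := by
  rw [testDelPow_add_single, (delTest_commute_testDelPow i β).eq]; rfl

theorem AnalyticOnNhd.fderiv_apply_const {a : RSpace n → ℂ} (ha : AnalyticOnNhd ℝ a V)
    (v : RSpace n) : AnalyticOnNhd ℝ (fun x => fderiv ℝ a x v) V :=
  fun x hx => AnGerm.analyticAt_fderiv_apply (ha x hx) v

/-- The Leibniz rule for test functions. -/
theorem delTest_mulTestEnd (i : Fin n) (a : RSpace n → ℂ) (ha : AnalyticOnNhd ℝ a V)
    (φ : 𝓓(V, ℂ)) :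
    delTest i (mulTestEnd a ha φ) =
      mulTestEnd a ha (delTest i φ) + mulTestEnd _ (ha.fderiv_apply_const (Pi.single i 1)) φ := by
  ext x
  change _ = a x * delTest i φ x + fderiv ℝ a x (Pi.single i 1) * φ x
  rw [delTest_apply, delTest_apply]
  by_cases hx : x ∈ tsupport φ
  · have h1 := (ha x (φ.tsupport_subset hx)).differentiableAt
    change fderiv ℝ (fun x => a x * φ x) x _ = _
    rw [fderiv_fun_mul h1 (TestFunction.differentiable_coe φ x)]
    simp only [add_apply, smul_apply, smul_eq_mul]
    ring
  · have h0 : (φ : RSpace n → ℂ) =ᶠ[𝓝 x] fun _ => 0 :=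
      notMem_tsupport_iff_eventuallyEq.1 hx
    have h1 : (mulTestEnd a ha φ : RSpace n → ℂ) =ᶠ[𝓝 x] fun _ => 0 := by
      filter_upwards [h0] with y hy
      rw [mulTestEnd_apply, hy, mul_zero]
    rw [h0.fderiv_eq, h1.fderiv_eq, h0.eq_of_nhds]
    simp

end TestOperators

/-! ### Representatives of germs of differential operators -/

section Representatives

variable {n : ℕ} {V : Opens (RSpace n)}

/-- The transposed operator `φ ↦ ∑ (-1)^|β| ∂^β (a_β φ)` of `∑ a_β ∂^β`. -/
noncomputable def DiffOpOn.transpose (Q : DiffOpOn V) : Module.End ℂ 𝓓(V, ℂ) :=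
  ∑ β ∈ Q.idx, (-1 : ℂ) ^ (∑ i, β i) •
    ((testDelPow β : 𝓓(V, ℂ) →L[ℂ] 𝓓(V, ℂ)).toLinearMap * mulTestEnd (Q.coeff β) (Q.analytic β))

theorem DiffOpOn.applyDist_eq (Q : DiffOpOn V) (u : CDistribution V) (φ : 𝓓(V, ℂ)) :
    Q.applyDist u φ = u (Q.transpose φ) := by
  rw [DiffOpOn.applyDist, DiffOpOn.transpose, LinearMap.sum_apply, map_sum]
  refine Finset.sum_congr rfl fun β _ => ?_
  rw [LinearMap.smul_apply, map_smul, smul_eq_mul]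
  rfl

/-- `T` is the transpose of a differential operator on `V` with germ `P` at the origin. -/
def Represents (h0 : (0 : RSpace n) ∈ V) (P : diffOpStalk n) (T : Module.End ℂ 𝓓(V, ℂ)) : Prop :=
  ∃ Q : DiffOpOn V, Q.germ h0 = P ∧ Q.transpose = T

variable {h0 : (0 : RSpace n) ∈ V}

namespace Represents

open diffOpStalk

theorem zero : Represents h0 (0 : diffOpStalk n) 0 :=
  ⟨⟨∅, fun _ _ => 0, fun _ => analyticOnNhd_const⟩, by simp [DiffOpOn.germ],
    by simp [DiffOpOn.transpose]⟩

theorem single (β : Fin n → ℕ) (a : RSpace n → ℂ) (ha : AnalyticOnNhd ℝ a V) :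
    Represents h0 (ofGerm (AnGerm.mk a (ha 0 h0)) * delPow β) ((-1 : ℂ) ^ (∑ i, β i) •
      ((testDelPow β : 𝓓(V, ℂ) →L[ℂ] 𝓓(V, ℂ)).toLinearMap * mulTestEnd a ha)) :=
  ⟨⟨{β}, fun _ => a, fun _ => ha⟩, by simp [DiffOpOn.germ], by simp [DiffOpOn.transpose]⟩

theorem add {P P' : diffOpStalk n} {T T' : Module.End ℂ 𝓓(V, ℂ)} (h : Represents h0 P T)
    (h' : Represents h0 P' T') : Represents h0 (P + P') (T + T') := by
  classical
  obtain ⟨Q, rfl, rfl⟩ := h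
  obtain ⟨Q', rfl, rfl⟩ := h'
  have cut : ∀ (R : DiffOpOn V) (β : Fin n → ℕ),
      AnalyticOnNhd ℝ (fun x => if β ∈ R.idx then R.coeff β x else 0) V := by
    intro R β
    split_ifs
    · exact R.analytic β
    · exact analyticOnNhd_const
  have key : ∀ {M : Type} [AddCommMonoid M] (F : (Fin n → ℕ) →
      {a : RSpace n → ℂ // AnalyticOnNhd ℝ a V} → M)
      (hF : ∀ β a b, F β ⟨fun x => a.1 x + b.1 x, a.2.add b.2⟩ = F β a + F β b)
      (hF0 : ∀ β, F β ⟨fun _ => 0, analyticOnNhd_const⟩ = 0),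
      ∑ β ∈ Q.idx ∪ Q'.idx, F β ⟨fun x => (if β ∈ Q.idx then Q.coeff β x else 0) +
          (if β ∈ Q'.idx then Q'.coeff β x else 0), (cut Q β).add (cut Q' β)⟩ =
        ∑ β ∈ Q.idx, F β ⟨Q.coeff β, Q.analytic β⟩ +
          ∑ β ∈ Q'.idx, F β ⟨Q'.coeff β, Q'.analytic β⟩ := by
    intro M _ F hF hF0
    have one : ∀ (R : DiffOpOn V) (s : Finset (Fin n → ℕ)), R.idx ⊆ s →
        ∑ β ∈ s, F β ⟨fun x => if β ∈ R.idx then R.coeff β x else 0, cut R β⟩ =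
        ∑ β ∈ R.idx, F β ⟨R.coeff β, R.analytic β⟩ := by
      intro R s hs
      rw [← Finset.sum_subset hs]
      · refine Finset.sum_congr rfl fun β hβ => ?_
        congr 2; ext x; rw [if_pos hβ]
      · intro β _ hβ
        rw [← hF0 β]
        congr 2; ext x; rw [if_neg hβ]
    rw [← one Q _ Finset.subset_union_left, ← one Q' _ Finset.subset_union_right,
      ← Finset.sum_add_distrib]
    exact Finset.sum_congr rfl fun β _ =>
      hF β ⟨fun x => if β ∈ Q.idx then Q.coeff β x else 0, cut Q β⟩
        ⟨fun x => if β ∈ Q'.idx then Q'.coeff β x else 0, cut Q' β⟩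
  refine ⟨⟨Q.idx ∪ Q'.idx, fun β x => (if β ∈ Q.idx then Q.coeff β x else 0) +
    (if β ∈ Q'.idx then Q'.coeff β x else 0), fun β => (cut Q β).add (cut Q' β)⟩, ?_, ?_⟩
  · refine key (fun β a => ofGerm (AnGerm.mk a.1 (a.2 0 h0)) * delPow β) (fun β a b => ?_)
      (fun β => ?_)
    · rw [← add_mul]
      congr 1
      exact map_add (germOps n).ofGerm (AnGerm.mk a.1 (a.2 0 h0)) (AnGerm.mk b.1 (b.2 0 h0))
    · have : ofGerm (AnGerm.mk (fun _ => (0 : ℂ)) analyticAt_const) = (0 : diffOpStalk n) :=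
        map_zero (germOps n).ofGerm
      rw [this, zero_mul]
  · refine key (fun β a => (-1 : ℂ) ^ (∑ i, β i) •
      ((testDelPow β : 𝓓(V, ℂ) →L[ℂ] 𝓓(V, ℂ)).toLinearMap * mulTestEnd a.1 a.2)) (fun β a b => ?_)
      (fun β => ?_)
    · rw [← smul_add, ← mul_add]
      congr 2
      ext φ x
      exact add_mul _ _ _
    · have : mulTestEnd (V := V) (fun _ => (0 : ℂ)) analyticOnNhd_const = 0 := by
        ext φ x
        exact zero_mul _
      rw [this, mul_zero, smul_zero]

theorem sum {ι : Type*} (s : Finset ι) {P : ι → diffOpStalk n} {T : ι → Module.End ℂ 𝓓(V, ℂ)}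
    (h : ∀ i ∈ s, Represents h0 (P i) (T i)) : Represents h0 (∑ i ∈ s, P i) (∑ i ∈ s, T i) := by
  classical
  induction s using Finset.induction_on with
  | empty => exact zero
  | insert i s hi ih =>
    rw [Finset.sum_insert hi, Finset.sum_insert hi]
    exact (h i (Finset.mem_insert_self i s)).add (ih fun j hj => h j (Finset.mem_insert_of_mem hj))

theorem ofGerm_mul {P : diffOpStalk n} {T : Module.End ℂ 𝓓(V, ℂ)} (h : Represents h0 P T)
    (a : RSpace n → ℂ) (ha : AnalyticOnNhd ℝ a V) :
    Represents h0 (ofGerm (AnGerm.mk a (ha 0 h0)) * P) (T * mulTestEnd a ha) := by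
  obtain ⟨Q, rfl, rfl⟩ := h
  rw [DiffOpOn.germ, DiffOpOn.transpose, Finset.mul_sum, Finset.sum_mul]
  refine sum _ fun β _ => ?_
  convert single β _ (ha.mul (Q.analytic β)) using 1
  · rw [← mul_assoc]
    congr 1
    exact (map_mul (germOps n).ofGerm (AnGerm.mk a (ha 0 h0)) (AnGerm.mk _ _)).symm
  · rw [smul_mul_assoc, mul_assoc]
    congr 2
    ext φ x
    change Q.coeff β x * (a x * φ x) = a x * Q.coeff β x * φ x
    ring

theorem del_mul {P : diffOpStalk n} {T : Module.End ℂ 𝓓(V, ℂ)} (h : Represents h0 P T)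
    (i : Fin n) :
    Represents h0 (del i * P) (-(T * (delTest i : 𝓓(V, ℂ) →L[ℂ] 𝓓(V, ℂ)).toLinearMap)) := by
  obtain ⟨Q, rfl, rfl⟩ := h
  rw [DiffOpOn.germ, DiffOpOn.transpose, Finset.mul_sum, Finset.sum_mul, ← Finset.sum_neg_distrib]
  refine sum _ fun β _ => ?_
  convert (single (β + Pi.single i 1) _ (Q.analytic β)).add
    (single β _ ((Q.analytic β).fderiv_apply_const (Pi.single i 1))) using 1
  · have h1 := (germOps n).del_mul_ofGerm i (AnGerm.mk (Q.coeff β) (Q.analytic β 0 h0))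
    have h2 := delPow_add_single β i
    rw [← mul_assoc, h2, ← mul_assoc]
    rw [AnGerm.partial_mk] at h1
    refine (congrArg (· * delPow β) h1).trans ?_
    exact add_mul _ _ _
  · ext φ x
    have h3 : ∑ j, (β + (Pi.single i 1 : Fin n → ℕ)) j = ∑ j, β j + 1 := by
      simp [Finset.sum_add_distrib]
    have h4 := testDelPow_add_single_apply β i (mulTestEnd (Q.coeff β) (Q.analytic β) φ)
    rw [delTest_mulTestEnd, map_add] at h4
    have h5 := congrArg (fun ψ : 𝓓(V, ℂ) => ψ x) h4
    change testDelPow (β + Pi.single i 1) (mulTestEnd (Q.coeff β) (Q.analytic β) φ) x =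
      testDelPow β (mulTestEnd (Q.coeff β) (Q.analytic β) (delTest i φ)) x +
      testDelPow β (mulTestEnd _ ((Q.analytic β).fderiv_apply_const (Pi.single i 1)) φ) x at h5
    change -((-1 : ℂ) ^ (∑ i, β i) *
        testDelPow β (mulTestEnd (Q.coeff β) (Q.analytic β) (delTest i φ)) x) =
      (-1 : ℂ) ^ (∑ j, (β + (Pi.single i 1 : Fin n → ℕ)) j) *
        testDelPow (β + Pi.single i 1) (mulTestEnd (Q.coeff β) (Q.analytic β) φ) x +
      (-1 : ℂ) ^ (∑ i, β i) *
        testDelPow β (mulTestEnd _ ((Q.analytic β).fderiv_apply_const (Pi.single i 1)) φ) x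
    rw [h3, h5, pow_succ]
    ring

theorem mul {P P' : diffOpStalk n} {T T' : Module.End ℂ 𝓓(V, ℂ)} (h : Represents h0 P T)
    (h' : Represents h0 P' T') : Represents h0 (P * P') (T' * T) := by
  obtain ⟨Q, rfl, rfl⟩ := h
  rw [DiffOpOn.germ, DiffOpOn.transpose, Finset.sum_mul, Finset.mul_sum]
  refine sum _ fun β _ => ?_
  have h1 : ∀ β : Fin n → ℕ, Represents h0 (delPow β * P') ((-1 : ℂ) ^ (∑ i, β i) •
      (T' * (testDelPow β : 𝓓(V, ℂ) →L[ℂ] 𝓓(V, ℂ)).toLinearMap)) := by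
    intro β
    induction β using multiIndex_induction with
    | zero =>
      convert h' using 1
      · rw [delPow_zero, one_mul]
      · rw [testDelPow_zero]; simp
    | add_single β i ih =>
      convert ih.del_mul i using 1
      · rw [delPow_add_single, mul_assoc]
      · ext φ x
        have h3 : ∑ j, (β + (Pi.single i 1 : Fin n → ℕ)) j = ∑ j, β j + 1 := by
          simp [Finset.sum_add_distrib]
        change (-1 : ℂ) ^ (∑ j, (β + (Pi.single i 1 : Fin n → ℕ)) j) *
          T' (testDelPow (β + Pi.single i 1) φ) x =
          -((-1 : ℂ) ^ (∑ i, β i) * T' (testDelPow β (delTest i φ)) x)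
        rw [h3, testDelPow_add_single_apply, pow_succ]
        ring
  convert (h1 β).ofGerm_mul _ (Q.analytic β) using 1
  · rw [mul_assoc]
  · rw [mul_smul_comm, smul_mul_assoc, mul_assoc]

theorem of_ofGerm (a : RSpace n → ℂ) (ha : AnalyticOnNhd ℝ a V) :
    Represents h0 (ofGerm (AnGerm.mk a (ha 0 h0))) (mulTestEnd a ha) := by
  convert single 0 a ha using 1
  · rw [delPow_zero, mul_one]
  · rw [testDelPow_zero]; ext φ x; simp

theorem one : Represents h0 (1 : diffOpStalk n) 1 := by
  convert of_ofGerm (h0 := h0) (fun _ => (1 : ℂ)) analyticOnNhd_const using 1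
  · exact (map_one (germOps n).ofGerm).symm
  · ext φ x; exact (one_mul _).symm

theorem of_del (i : Fin n) :
    Represents h0 (del i : diffOpStalk n)
      (-(delTest i : 𝓓(V, ℂ) →L[ℂ] 𝓓(V, ℂ)).toLinearMap) := by
  have h := (one (h0 := h0)).del_mul i
  rwa [mul_one, one_mul] at h

/-- On a connected open set the transpose is determined by the germ at the origin. -/
theorem unique (hV : IsPreconnected (V : Set (RSpace n))) {P : diffOpStalk n}
    {T T' : Module.End ℂ 𝓓(V, ℂ)} (h : Represents h0 P T) (h' : Represents h0 P T') : T = T' := by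
  -- the operator represented by `T - T'` has germ zero, so its coefficients vanish on `V`
  have h1 := h.add (h'.ofGerm_mul (fun _ => (-1 : ℂ)) analyticOnNhd_const)
  have e1 : P + ofGerm (AnGerm.mk (fun _ => (-1 : ℂ)) analyticAt_const) * P = 0 := by
    have : (germOps n).ofGerm (-1) = ofGerm (AnGerm.mk (fun _ => (-1 : ℂ)) analyticAt_const) := rfl
    rw [← this, map_neg, map_one]
    have aux : ∀ {D : Type} [Ring D] (p : D), p + -1 * p = 0 := by intros; simp
    exact aux P
  have e2 : T' * mulTestEnd (V := V) (fun _ => (-1 : ℂ)) analyticOnNhd_const = -T' := by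
    have : mulTestEnd (V := V) (fun _ => (-1 : ℂ)) analyticOnNhd_const = -1 := by
      ext φ x
      exact neg_one_mul _
    rw [this, mul_neg, mul_one]
  rw [e1, e2] at h1
  obtain ⟨Q, hQ, hQT⟩ := h1
  rw [← sub_eq_zero, sub_eq_add_neg, ← hQT]
  have h2 := eq_zero_of_sum_mul_delPow hQ
  refine Finset.sum_eq_zero fun β hβ => ?_
  have h3 : Set.EqOn (Q.coeff β) 0 V :=
    (Q.analytic β).eqOn_zero_of_preconnected_of_eventuallyEq_zero hV h0
      (AnGerm.mk_eq_zero.1 (h2 β hβ))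
  have h4 : mulTestEnd (Q.coeff β) (Q.analytic β) = 0 := by
    ext φ x
    change Q.coeff β x * φ x = 0
    by_cases hx : x ∈ tsupport φ
    · rw [h3 (φ.tsupport_subset hx)]; exact zero_mul _
    · rw [image_eq_zero_of_notMem_tsupport hx, mul_zero]
  rw [h4, mul_zero, smul_zero]

end Represents

end Representatives

/-! ### The annihilator of a distribution as a left ideal -/

section Restriction

variable {n : ℕ} {V W : Opens (RSpace n)}

/-- Extension by zero of test functions. -/
noncomputable def testIncl (V W : Opens (RSpace n)) : 𝓓(V, ℂ) →L[ℂ] 𝓓(W, ℂ) :=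
  TestFunction.monoCLM ℂ

theorem testIncl_apply (h : V ≤ W) (φ : 𝓓(V, ℂ)) (x : RSpace n) : testIncl V W φ x = φ x := by
  rw [testIncl, TestFunction.monoCLM_apply, if_pos ⟨le_rfl, h⟩]

theorem coe_testIncl (h : V ≤ W) (φ : 𝓓(V, ℂ)) : (testIncl V W φ : RSpace n → ℂ) = φ :=
  funext fun x => testIncl_apply h φ x

theorem testIncl_delTest (h : V ≤ W) (i : Fin n) (φ : 𝓓(V, ℂ)) :
    testIncl V W (delTest i φ) = delTest i (testIncl V W φ) := by
  ext x
  rw [testIncl_apply h, delTest_apply, delTest_apply, coe_testIncl h]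

theorem testIncl_testDelPow (h : V ≤ W) (β : Fin n → ℕ) (φ : 𝓓(V, ℂ)) :
    testIncl V W (testDelPow β φ) = testDelPow β (testIncl V W φ) := by
  induction β using multiIndex_induction generalizing φ with
  | zero => simp [testDelPow_zero]
  | add_single β i ih =>
    rw [testDelPow_add_single_apply, testDelPow_add_single_apply, ih, testIncl_delTest h]

theorem testIncl_mulTestEnd (h : V ≤ W) (a : RSpace n → ℂ) (ha : AnalyticOnNhd ℝ a W)
    (φ : 𝓓(V, ℂ)) :
    testIncl V W (mulTestEnd a (ha.mono h) φ) = mulTestEnd a ha (testIncl V W φ) := by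
  ext x
  rw [testIncl_apply h, mulTestEnd_apply, mulTestEnd_apply, testIncl_apply h]

/-- Restriction of a differential operator to a smaller open set. -/
def DiffOpOn.restrict (Q : DiffOpOn W) (h : V ≤ W) : DiffOpOn V :=
  ⟨Q.idx, Q.coeff, fun β => (Q.analytic β).mono h⟩

theorem DiffOpOn.testIncl_transpose (Q : DiffOpOn W) (h : V ≤ W) (φ : 𝓓(V, ℂ)) :
    testIncl V W ((Q.restrict h).transpose φ) = Q.transpose (testIncl V W φ) := by
  rw [DiffOpOn.transpose, DiffOpOn.transpose, LinearMap.sum_apply, LinearMap.sum_apply, map_sum]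
  refine Finset.sum_congr rfl fun β _ => ?_
  rw [LinearMap.smul_apply, LinearMap.smul_apply, map_smul]
  congr 1
  change testIncl V W (testDelPow β (mulTestEnd (Q.coeff β) ((Q.analytic β).mono h) φ)) =
    testDelPow β (mulTestEnd (Q.coeff β) (Q.analytic β) (testIncl V W φ))
  rw [testIncl_testDelPow h, testIncl_mulTestEnd h]

theorem CDistribution.restrict_apply (u : CDistribution (⊤ : Opens (RSpace n))) (φ : 𝓓(V, ℂ)) :
    u.restrict V φ = u (testIncl V ⊤ φ) := rfl

end Restriction

section Annihilator

open diffOpStalk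

variable {n : ℕ}

/-- The open ball about the origin of `ℝⁿ`. -/
def ballOpens (n : ℕ) (r : ℝ) : Opens (RSpace n) := ⟨Metric.ball 0 r, Metric.isOpen_ball⟩

theorem zero_mem_ballOpens {r : ℝ} (hr : 0 < r) : (0 : RSpace n) ∈ ballOpens n r :=
  Metric.mem_ball_self hr

theorem ballOpens_mono {r s : ℝ} (h : r ≤ s) : ballOpens n r ≤ ballOpens n s :=
  Metric.ball_subset_ball h

theorem isPreconnected_ballOpens (r : ℝ) : IsPreconnected (ballOpens n r : Set (RSpace n)) :=
  (convex_ball (0 : RSpace n) r).isPreconnected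

theorem exists_analyticOnNhd_ballOpens {f : RSpace n → ℂ} (hf : AnalyticAt ℝ f 0) :
    ∃ r₀ > 0, ∀ r ≤ r₀, AnalyticOnNhd ℝ f (ballOpens n r) := by
  obtain ⟨r₀, hr₀, h⟩ := Metric.eventually_nhds_iff_ball.1 hf.eventually_analyticAt
  exact ⟨r₀, hr₀, fun r hr x hx => h x (Metric.ball_subset_ball hr hx)⟩

/-- Every germ of a differential operator is represented on all sufficiently small balls. -/
theorem exists_represents (P : diffOpStalk n) :
    ∃ r₀ > 0, ∀ r (hr : 0 < r), r ≤ r₀ → ∃ T, Represents (zero_mem_ballOpens hr) P T := by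
  let N : AddSubmonoid (diffOpStalk n) :=
    { carrier := {P | ∃ r₀ > 0, ∀ r (hr : 0 < r), r ≤ r₀ →
        ∃ T, Represents (zero_mem_ballOpens hr) P T}
      zero_mem' := ⟨1, one_pos, fun r hr _ => ⟨0, Represents.zero⟩⟩
      add_mem' := by
        rintro P Q ⟨r₁, h₁, hP⟩ ⟨r₂, h₂, hQ⟩
        refine ⟨min r₁ r₂, lt_min h₁ h₂, fun r hr hle => ?_⟩
        obtain ⟨T, hT⟩ := hP r hr (hle.trans (min_le_left _ _))
        obtain ⟨T', hT'⟩ := hQ r hr (hle.trans (min_le_right _ _))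
        exact ⟨_, hT.add hT'⟩ }
  refine germOps_generates n N ⟨1, one_pos, fun r hr _ => ⟨_, Represents.one⟩⟩ ?_ ?_ P
  · rintro g P ⟨r₁, h₁, hP⟩
    obtain ⟨f, hf, rfl⟩ := g.exists_rep
    obtain ⟨r₂, h₂, hfr⟩ := exists_analyticOnNhd_ballOpens hf
    refine ⟨min r₁ r₂, lt_min h₁ h₂, fun r hr hle => ?_⟩
    obtain ⟨T, hT⟩ := hP r hr (hle.trans (min_le_left _ _))
    exact ⟨_, hT.ofGerm_mul f (hfr r (hle.trans (min_le_right _ _)))⟩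
  · rintro i P ⟨r₁, h₁, hP⟩
    refine ⟨r₁, h₁, fun r hr hle => ?_⟩
    obtain ⟨T, hT⟩ := hP r hr hle
    exact ⟨_, hT.del_mul i⟩

/-- Membership in the annihilator may be tested with any representatives on small balls. -/
theorem mem_annStalk_iff {u : CDistribution (⊤ : Opens (RSpace n))} {P : diffOpStalk n} :
    P ∈ annStalk u ↔ ∃ r₀ > 0, ∀ r (hr : 0 < r), r ≤ r₀ → ∀ T,
      Represents (zero_mem_ballOpens hr) P T → ∀ φ, u (testIncl (ballOpens n r) ⊤ (T φ)) = 0 := by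
  constructor
  · rintro ⟨V, h0, Q, rfl, hQ⟩
    obtain ⟨r₀, hr₀, hV⟩ := Metric.isOpen_iff.1 V.isOpen 0 h0
    refine ⟨r₀, hr₀, fun r hr hle T hT φ => ?_⟩
    have hrV : ballOpens n r ≤ V := (Metric.ball_subset_ball hle).trans hV
    rw [hT.unique (isPreconnected_ballOpens r) ⟨Q.restrict hrV, rfl, rfl⟩]
    have h1 := hQ (testIncl _ V φ)
    rw [DiffOpOn.applyDist_eq, ← Q.testIncl_transpose hrV, CDistribution.restrict_apply] at h1
    convert h1 using 2
    ext x
    rw [testIncl_apply le_top, testIncl_apply le_top, testIncl_apply hrV]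
  · rintro ⟨r₀, hr₀, h⟩
    obtain ⟨r₁, hr₁, hex⟩ := exists_represents P
    have hr : 0 < min r₀ r₁ := lt_min hr₀ hr₁
    obtain ⟨_, Q, hQ, rfl⟩ := hex _ hr (min_le_right _ _)
    refine ⟨_, zero_mem_ballOpens hr, Q, hQ, fun φ => ?_⟩
    rw [DiffOpOn.applyDist_eq]
    exact h _ hr (min_le_left _ _) _ ⟨Q, hQ, rfl⟩ φ

/-- The annihilator of a distribution as a left ideal. -/
noncomputable def annIdeal (u : CDistribution (⊤ : Opens (RSpace n))) : Ideal (diffOpStalk n) where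
  carrier := annStalk u
  zero_mem' := mem_annStalk_iff.2 ⟨1, one_pos, fun r hr _ T hT φ => by
    rw [hT.unique (isPreconnected_ballOpens r) Represents.zero]; simp⟩
  add_mem' := by
    intro P Q hP hQ
    obtain ⟨r₁, h₁, hP⟩ := mem_annStalk_iff.1 hP
    obtain ⟨r₂, h₂, hQ⟩ := mem_annStalk_iff.1 hQ
    obtain ⟨r₃, h₃, eP⟩ := exists_represents P
    obtain ⟨r₄, h₄, eQ⟩ := exists_represents Q
    refine mem_annStalk_iff.2 ⟨min (min r₁ r₂) (min r₃ r₄),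
      lt_min (lt_min h₁ h₂) (lt_min h₃ h₄), fun r hr hle T hT φ => ?_⟩
    simp only [le_min_iff] at hle
    obtain ⟨TP, hTP⟩ := eP r hr hle.2.1
    obtain ⟨TQ, hTQ⟩ := eQ r hr hle.2.2
    rw [hT.unique (isPreconnected_ballOpens r) (hTP.add hTQ), LinearMap.add_apply, map_add, map_add,
      hP r hr hle.1.1 _ hTP, hQ r hr hle.1.2 _ hTQ, add_zero]
  smul_mem' := by
    intro Q P hP
    obtain ⟨r₁, h₁, hP⟩ := mem_annStalk_iff.1 hP
    obtain ⟨r₃, h₃, eP⟩ := exists_represents P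
    obtain ⟨r₄, h₄, eQ⟩ := exists_represents Q
    refine mem_annStalk_iff.2 ⟨min r₁ (min r₃ r₄), lt_min h₁ (lt_min h₃ h₄),
      fun r hr hle T hT φ => ?_⟩
    simp only [le_min_iff] at hle
    obtain ⟨TP, hTP⟩ := eP r hr hle.2.1
    obtain ⟨TQ, hTQ⟩ := eQ r hr hle.2.2
    rw [hT.unique (isPreconnected_ballOpens r) (hTQ.mul hTP)]
    exact hP r hr hle.1 _ hTP (TQ φ)

theorem mem_annIdeal {u : CDistribution (⊤ : Opens (RSpace n))} {P : diffOpStalk n} :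
    P ∈ annIdeal u ↔ P ∈ annStalk u := Iff.rfl

theorem annIdeal_zero : annIdeal (0 : CDistribution (⊤ : Opens (RSpace n))) = ⊤ :=
  Submodule.eq_top_iff'.2 fun _ => mem_annStalk_iff.2 ⟨1, one_pos, fun _ _ _ _ _ _ => rfl⟩

theorem analyticOnNhd_coord (i : Fin n) (V : Opens (RSpace n)) :
    AnalyticOnNhd ℝ (fun x : RSpace n => ((x i : ℝ) : ℂ)) V :=
  fun x _ => AnGerm.analyticAt_coord i x

/-- The transposed Euler operator `φ ↦ xᵢ ∂ᵢφ`. -/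
noncomputable def eulerTest (i : Fin n) (V : Opens (RSpace n)) : Module.End ℂ 𝓓(V, ℂ) :=
  mulTestEnd _ (analyticOnNhd_coord i V) * (delTest i : 𝓓(V, ℂ) →L[ℂ] 𝓓(V, ℂ)).toLinearMap

theorem eulerTest_apply (i : Fin n) {V : Opens (RSpace n)} (φ : 𝓓(V, ℂ)) (x : RSpace n) :
    eulerTest i V φ x = x i * fderiv ℝ φ x (Pi.single i 1) := by
  rw [← delTest_apply]; rfl

theorem testIncl_eulerTest (i : Fin n) {V : Opens (RSpace n)} (φ : 𝓓(V, ℂ)) :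
    testIncl V ⊤ (eulerTest i V φ) = eulerTest i ⊤ (testIncl V ⊤ φ) := by
  ext x
  rw [testIncl_apply le_top, eulerTest_apply, eulerTest_apply, coe_testIncl le_top]

theorem represents_del_mul_coord (i : Fin n) {r : ℝ} (hr : 0 < r) :
    Represents (zero_mem_ballOpens hr) (del i * ofGerm (AnGerm.coord i))
      (-(eulerTest i (ballOpens n r))) := by
  have h := (Represents.of_del (h0 := zero_mem_ballOpens hr) i).mul
    (Represents.of_ofGerm (h0 := zero_mem_ballOpens hr) _ (analyticOnNhd_coord i (ballOpens n r)))
  rw [mul_neg] at h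
  exact h

/-- If `∂ᵢxᵢ u = v`, then `P ∂ᵢxᵢ` annihilates `u` if and only if `P` annihilates `v`. -/
theorem mul_del_mul_coord_mem_annIdeal_iff {u v : CDistribution (⊤ : Opens (RSpace n))} (i : Fin n)
    (h : ∀ φ, u (eulerTest i ⊤ φ) = -v φ) (P : diffOpStalk n) :
    P * (del i * ofGerm (AnGerm.coord i)) ∈ annIdeal u ↔ P ∈ annIdeal v := by
  have key : ∀ {r : ℝ} (hr : 0 < r) (TP : Module.End ℂ 𝓓(ballOpens n r, ℂ)) (φ),
      u (testIncl _ ⊤ ((-(eulerTest i (ballOpens n r)) * TP) φ)) = v (testIncl _ ⊤ (TP φ)) := by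
    intro r hr TP φ
    rw [Module.End.mul_apply, LinearMap.neg_apply, map_neg, map_neg, testIncl_eulerTest, h, neg_neg]
  obtain ⟨r₂, h₂, eP⟩ := exists_represents P
  rw [mem_annIdeal, mem_annIdeal, mem_annStalk_iff, mem_annStalk_iff]
  constructor
  · rintro ⟨r₁, h₁, hP⟩
    refine ⟨r₁, h₁, fun r hr hle TP hTP φ => ?_⟩
    rw [← key hr]
    exact hP r hr hle _ (hTP.mul (represents_del_mul_coord i hr)) φ
  · rintro ⟨r₁, h₁, hP⟩
    refine ⟨min r₁ r₂, lt_min h₁ h₂, fun r hr hle T hT φ => ?_⟩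
    rw [le_min_iff] at hle
    obtain ⟨TP, hTP⟩ := eP r hr hle.2
    rw [hT.unique (isPreconnected_ballOpens r) (hTP.mul (represents_del_mul_coord i hr)), key hr]
    exact hP r hr hle.1 _ hTP φ

theorem del_mul_coord_sub_mem_annIdeal {u : CDistribution (⊤ : Opens (RSpace n))} (i j : Fin n)
    (h : ∀ φ, u (eulerTest i ⊤ φ) = u (eulerTest j ⊤ φ)) :
    (germOps n).del i * (germOps n).ofGerm (AnGerm.coord i) -
      (germOps n).del j * (germOps n).ofGerm (AnGerm.coord j) ∈ annIdeal u := by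
  refine mem_annStalk_iff.2 ⟨1, one_pos, fun r hr _ T hT φ => ?_⟩
  -- the difference is represented because the sum with the second operator is
  have h1 := hT.add (represents_del_mul_coord j hr)
  have h2 : (germOps n).del i * (germOps n).ofGerm (AnGerm.coord i) -
      (germOps n).del j * (germOps n).ofGerm (AnGerm.coord j) + del j * ofGerm (AnGerm.coord j) =
      del i * ofGerm (AnGerm.coord i) := by
    have aux : ∀ {D : Type} [Ring D] (a b : D), a - b + b = a := by intros; simp
    exact aux (D := diffOpStalk n) _ _
  rw [h2] at h1
  have h3 := h1.unique (isPreconnected_ballOpens r) (represents_del_mul_coord i hr)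
  have h4 : T φ = eulerTest j _ φ - eulerTest i _ φ := by
    have := congrArg (fun S : Module.End ℂ 𝓓(ballOpens n r, ℂ) => S φ) h3
    simp only [LinearMap.add_apply, LinearMap.neg_apply] at this
    rw [eq_sub_iff_add_eq, add_comm, ← sub_eq_zero, ← sub_eq_zero.2 this]
    abel
  rw [h4, map_sub, map_sub, testIncl_eulerTest, testIncl_eulerTest, h, sub_self]

/-- A function that is analytic near the origin annihilates `u` if and only if its product with `u`
vanishes on small balls. -/
theorem ofGerm_mem_annIdeal_iff {u : CDistribution (⊤ : Opens (RSpace n))} {f : RSpace n → ℂ}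
    (hf : AnalyticAt ℝ f 0) :
    ofGerm (AnGerm.mk f hf) ∈ annIdeal u ↔ ∃ r, ∃ ha : AnalyticOnNhd ℝ f (ballOpens n r), 0 < r ∧
      ∀ φ, u (testIncl (ballOpens n r) ⊤ (mulTestEnd f ha φ)) = 0 := by
  obtain ⟨r₂, h₂, hfr⟩ := exists_analyticOnNhd_ballOpens hf
  rw [mem_annIdeal, mem_annStalk_iff]
  constructor
  · rintro ⟨r₁, h₁, h⟩
    have hr : 0 < min r₁ r₂ := lt_min h₁ h₂
    exact ⟨min r₁ r₂, hfr _ (min_le_right _ _), hr, fun φ =>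
      h _ hr (min_le_left _ _) _ (Represents.of_ofGerm f (hfr _ (min_le_right _ _))) φ⟩
  · rintro ⟨r₁, ha, h₁, h⟩
    refine ⟨r₁, h₁, fun r hr hle T hT φ => ?_⟩
    rw [hT.unique (isPreconnected_ballOpens r)
      (Represents.of_ofGerm f (ha.mono (ballOpens_mono hle)))]
    convert h (testIncl _ _ φ) using 2
    rw [← testIncl_mulTestEnd (ballOpens_mono hle)]
    ext x
    rw [testIncl_apply le_top, testIncl_apply le_top, testIncl_apply (ballOpens_mono hle)]

end Annihilator

/-! ### The power function and integration by parts -/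

section PlusPow

theorem plusPow_of_pos {y : ℝ} (hy : 0 < y) (t : ℂ) :
    plusPow y t = Complex.exp (t * (Real.log y : ℂ)) := if_pos hy

theorem plusPow_of_nonpos {y : ℝ} (hy : y ≤ 0) (t : ℂ) : plusPow y t = 0 := if_neg hy.not_gt

theorem norm_plusPow_of_pos {y : ℝ} (hy : 0 < y) (t : ℂ) : ‖plusPow y t‖ = y ^ t.re := by
  rw [plusPow_of_pos hy, Complex.norm_exp, Real.rpow_def_of_pos hy]
  simp [mul_comm]

theorem plusPow_add_one (y : ℝ) (t : ℂ) : plusPow y (t + 1) = plusPow y t * y := by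
  rcases lt_or_ge 0 y with hy | hy
  · rw [plusPow_of_pos hy, plusPow_of_pos hy, add_mul, Complex.exp_add, one_mul,
      ← Complex.ofReal_exp, Real.exp_log hy]
  · rw [plusPow_of_nonpos hy, plusPow_of_nonpos hy, zero_mul]

theorem continuous_plusPow {t : ℂ} (ht : 0 < t.re) : Continuous fun y => plusPow y t := by
  have h : (fun y => plusPow y t) = fun y : ℝ => ((max y 0 : ℝ) : ℂ) ^ t := by
    ext y
    rcases lt_or_ge 0 y with hy | hy
    · rw [plusPow_of_pos hy, max_eq_left hy.le, Complex.cpow_def_of_ne_zero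
        (by exact_mod_cast hy.ne'), ← Complex.ofReal_log hy.le, mul_comm]
    · have : t ≠ 0 := fun h => by simp [h] at ht
      rw [plusPow_of_nonpos hy, max_eq_right hy, Complex.ofReal_zero, Complex.zero_cpow this]
  rw [h]
  exact (Complex.continuous_ofReal_cpow_const ht).comp (continuous_id.max continuous_const)

theorem continuous_plusPow_exponent (y : ℝ) : Continuous fun t => plusPow y t := by
  rcases lt_or_ge 0 y with hy | hy
  · simp only [plusPow_of_pos hy]; fun_prop
  · simp only [plusPow_of_nonpos hy]; fun_prop

theorem measurable_plusPow (t : ℂ) : Measurable fun y => plusPow y t :=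
  Measurable.ite measurableSet_Ioi (by fun_prop) measurable_const

/-- The factor `s` makes `(c s)_+^t` differentiable also at `s = 0`. -/
theorem hasDerivAt_plusPow_mul {t : ℂ} (ht : 0 < t.re) (c s : ℝ) :
    HasDerivAt (fun s : ℝ => plusPow (c * s) t * s) ((t + 1) * plusPow (c * s) t) s := by
  rcases lt_trichotomy (c * s) 0 with h | h | h
  · have h1 : (fun s : ℝ => plusPow (c * s) t * s) =ᶠ[𝓝 s] fun _ => 0 := by
      have : ∀ᶠ s' in 𝓝 s, c * s' < 0 :=
        (continuous_const.mul continuous_id).continuousAt.eventually (gt_mem_nhds h)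
      filter_upwards [this] with s' hs'
      rw [plusPow_of_nonpos hs'.le, zero_mul]
    rw [plusPow_of_nonpos h.le, mul_zero]
    exact (hasDerivAt_const s (0 : ℂ)).congr_of_eventuallyEq h1
  · rw [h, plusPow_of_nonpos le_rfl, mul_zero]
    rcases mul_eq_zero.1 h with hc | hs
    · simp only [hc, zero_mul, plusPow_of_nonpos le_rfl]
      exact hasDerivAt_const s (0 : ℂ)
    · subst hs
      rw [hasDerivAt_iff_tendsto_slope]
      have hcont : Tendsto (fun s : ℝ => plusPow (c * s) t) (𝓝[≠] 0) (𝓝 0) := by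
        have h2 : Continuous fun s : ℝ => plusPow (c * s) t :=
          (continuous_plusPow ht).comp (continuous_const.mul continuous_id)
        have := h2.tendsto 0
        rw [h, plusPow_of_nonpos le_rfl] at this
        exact this.mono_left nhdsWithin_le_nhds
      refine hcont.congr' ?_
      filter_upwards [self_mem_nhdsWithin] with s hs
      have hs' : (s : ℂ) ≠ 0 := by exact_mod_cast hs
      rw [slope_def_module]
      simp only [sub_zero, Complex.ofReal_zero, mul_zero, Complex.real_smul, Complex.ofReal_inv]
      field_simp
  · have hs0 : s ≠ 0 := right_ne_zero_of_mul h.ne'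
    have h1 : (fun s : ℝ => plusPow (c * s) t * s) =ᶠ[𝓝 s]
        fun s => Complex.exp (t * (Real.log (c * s) : ℂ)) * s := by
      have : ∀ᶠ s' in 𝓝 s, 0 < c * s' :=
        (continuous_const.mul continuous_id).continuousAt.eventually (lt_mem_nhds h)
      filter_upwards [this] with s' hs'
      rw [plusPow_of_pos hs']
    have hlog : HasDerivAt (fun s : ℝ => Real.log (c * s)) (s⁻¹) s := by
      have hc0 : c ≠ 0 := left_ne_zero_of_mul h.ne'
      refine (((hasDerivAt_id' s).const_mul c).log h.ne').congr_deriv ?_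
      field_simp
    have h2 := ((hlog.ofReal_comp.const_mul t).cexp).mul (hasDerivAt_id s).ofReal_comp
    refine (h2.congr_of_eventuallyEq h1).congr_deriv ?_
    rw [plusPow_of_pos h]
    have hs' : (s : ℂ) ≠ 0 := by exact_mod_cast hs0
    simp only [id, Complex.ofReal_inv, Complex.ofReal_one]
    field_simp

end PlusPow

section PowerIntegral

variable {n : ℕ}

/-- The pairing `∫ (x₁⋯xₙ)_+^t ψ(x) dx`. -/
noncomputable def powerIntegral (t : ℂ) (ψ : RSpace n → ℂ) : ℂ :=
  ∫ x : RSpace n, plusPow (∏ i, x i) t * ψ x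

theorem continuous_prod_coord (T : Finset (Fin n)) :
    Continuous fun x : RSpace n => ∏ j ∈ T, x j :=
  continuous_finsetProd _ fun j _ => continuous_apply j

theorem TestFunction.integrable_mul {V : Opens (RSpace n)} {w : RSpace n → ℂ} (hw : Continuous w)
    (φ : 𝓓(V, ℂ)) : Integrable fun x => w x * φ x :=
  (hw.mul φ.continuous).integrable_of_hasCompactSupport φ.hasCompactSupport.mul_left

/-- With `f = x₁⋯xₙ` the derivative of `f_+^t xᵢ x_T` in the direction of `xᵢ`, `i ∉ T`, is
`(t + 1) f_+^t x_T`. -/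
theorem hasLineDerivAt_plusPow_mul {t : ℂ} (ht : 0 < t.re) {T : Finset (Fin n)} {i : Fin n}
    (hi : i ∉ T) (x : RSpace n) :
    HasLineDerivAt ℝ (fun x : RSpace n =>
        plusPow (∏ j, x j) t * ((∏ j ∈ insert i T, x j : ℝ) : ℂ))
      ((t + 1) * (plusPow (∏ j, x j) t * ((∏ j ∈ T, x j : ℝ) : ℂ))) x (Pi.single i 1) := by
  set c : ℝ := ∏ j ∈ Finset.univ.erase i, x j with hc
  have hline : ∀ s : ℝ, ∏ j, (x + s • (Pi.single i 1 : RSpace n)) j = c * (x i + s) := by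
    intro s
    rw [← Finset.prod_erase_mul _ _ (Finset.mem_univ i)]
    congr 1
    · refine Finset.prod_congr rfl fun j hj => ?_
      simp [Finset.ne_of_mem_erase hj]
    · simp
  have hT : ∀ s : ℝ, ∏ j ∈ T, (x + s • (Pi.single i 1 : RSpace n)) j = ∏ j ∈ T, x j := by
    intro s
    refine Finset.prod_congr rfl fun j hj => ?_
    have : j ≠ i := fun e => hi (e ▸ hj)
    simp [this]
  have h0 := hline 0
  simp only [zero_smul, add_zero] at h0
  have h1 : HasDerivAt (fun s : ℝ => plusPow (c * (x i + s)) t * ((x i + s : ℝ) : ℂ))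
      ((t + 1) * plusPow (c * x i) t) 0 := by
    have := (hasDerivAt_plusPow_mul ht c (x i + 0)).scomp (0 : ℝ)
      ((hasDerivAt_id (0 : ℝ)).const_add (x i))
    simpa [Function.comp_def] using this
  rw [h0]
  refine ((h1.mul_const ((∏ j ∈ T, x j : ℝ) : ℂ)).congr_deriv (by ring)).congr_of_eventuallyEq ?_
  refine Eventually.of_forall fun s => ?_
  simp only [hline, Finset.prod_insert hi, hT]
  simp
  ring

/-- One integration by parts in the direction of `xᵢ`. -/
theorem integral_plusPow_mul_delTest {t : ℂ} (ht : 0 < t.re) {T : Finset (Fin n)} {i : Fin n}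
    (hi : i ∉ T) {V : Opens (RSpace n)} (φ : 𝓓(V, ℂ)) :
    ∫ x : RSpace n, plusPow (∏ j, x j) t * ((∏ j ∈ insert i T, x j : ℝ) : ℂ) * delTest i φ x =
      -(t + 1) * ∫ x : RSpace n, plusPow (∏ j, x j) t * ((∏ j ∈ T, x j : ℝ) : ℂ) * φ x := by
  have hc : ∀ S : Finset (Fin n), Continuous fun x : RSpace n =>
      plusPow (∏ j, x j) t * ((∏ j ∈ S, x j : ℝ) : ℂ) := fun S =>
    ((continuous_plusPow ht).comp (continuous_prod_coord _)).mul
      (Complex.continuous_ofReal.comp (continuous_prod_coord S))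
  have h := integral_bilinear_hasLineDerivAt_right_eq_neg_left_of_integrable
    (μ := (volume : Measure (RSpace n))) (B := ContinuousLinearMap.mul ℝ ℂ)
    (f := fun x : RSpace n => plusPow (∏ j, x j) t * ((∏ j ∈ insert i T, x j : ℝ) : ℂ))
    (f' := fun x => (t + 1) * (plusPow (∏ j, x j) t * ((∏ j ∈ T, x j : ℝ) : ℂ)))
    (g := φ) (g' := delTest i φ) (v := Pi.single i 1)
    (TestFunction.integrable_mul (continuous_const.mul (hc T)) φ)
    (TestFunction.integrable_mul (hc _) (delTest i φ)) (TestFunction.integrable_mul (hc _) φ)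
    (fun x _ => hasLineDerivAt_plusPow_mul ht hi x)
    (fun x _ => by
      rw [delTest_apply]
      exact (TestFunction.differentiable_coe φ x).hasFDerivAt.hasLineDerivAt _)
  simp only [ContinuousLinearMap.mul_apply'] at h
  rw [h, neg_mul, ← integral_const_mul]
  congr 2
  ext x
  ring

/-- The multi-index of the mixed derivative `∏ i ∈ K, ∂ᵢ`. -/
def indicatorIndex (K : Finset (Fin n)) : Fin n → ℕ := fun i => if i ∈ K then 1 else 0

theorem indicatorIndex_insert {K : Finset (Fin n)} {i : Fin n} (hi : i ∉ K) :
    indicatorIndex (insert i K) = indicatorIndex K + Pi.single i 1 := by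
  ext j
  by_cases hj : j = i
  · subst hj; simp [indicatorIndex, hi]
  · simp [indicatorIndex, hj]

theorem integral_plusPow_mul_testDelPow {t : ℂ} (ht : 0 < t.re) {J K : Finset (Fin n)}
    (hJK : Disjoint J K) {V : Opens (RSpace n)} (φ : 𝓓(V, ℂ)) :
    ∫ x : RSpace n, plusPow (∏ j, x j) t * ((∏ j ∈ J ∪ K, x j : ℝ) : ℂ) *
        testDelPow (indicatorIndex K) φ x =
      (-(t + 1)) ^ K.card *
        ∫ x : RSpace n, plusPow (∏ j, x j) t * ((∏ j ∈ J, x j : ℝ) : ℂ) * φ x := by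
  induction K using Finset.induction_on with
  | empty =>
    have : indicatorIndex (∅ : Finset (Fin n)) = 0 := by ext; simp [indicatorIndex]
    rw [this, testDelPow_zero]
    simp
  | insert i K hi ih =>
    have hiJ : i ∉ J ∪ K := by
      rw [Finset.mem_union, not_or]
      exact ⟨Finset.disjoint_right.1 hJK (Finset.mem_insert_self i K), hi⟩
    have hJK' : Disjoint J K := hJK.mono_right (Finset.subset_insert i K)
    rw [indicatorIndex_insert hi, testDelPow_add_single, Finset.union_insert,
      Finset.card_insert_of_notMem hi, pow_succ', mul_assoc, ← ih hJK']
    exact integral_plusPow_mul_delTest ht hiJ _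

/-- Multiplication by `∏ j ∈ J, xⱼ`. -/
noncomputable def mulProd (J : Finset (Fin n)) (V : Opens (RSpace n)) : Module.End ℂ 𝓓(V, ℂ) :=
  mulTestEnd (fun x => ∏ j ∈ J, ((x j : ℝ) : ℂ))
    (Finset.analyticOnNhd_fun_prod _ fun j _ => analyticOnNhd_coord j V)

theorem mulProd_apply (J : Finset (Fin n)) {V : Opens (RSpace n)} (φ : 𝓓(V, ℂ)) (x : RSpace n) :
    mulProd J V φ x = (∏ j ∈ J, ((x j : ℝ) : ℂ)) * φ x := rfl

/-- Integration by parts in the variables `xⱼ`, `j ∉ J`. -/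
theorem powerIntegral_add_one {t : ℂ} (ht : 0 < t.re) (J : Finset (Fin n))
    {V : Opens (RSpace n)} (φ : 𝓓(V, ℂ)) :
    powerIntegral (t + 1) (testDelPow (indicatorIndex Jᶜ) φ) =
      (-(t + 1)) ^ (n - J.card) * powerIntegral t (mulProd J V φ) := by
  have h := integral_plusPow_mul_testDelPow ht (disjoint_compl_right (a := J)) φ
  rw [Finset.union_compl, Finset.card_compl, Fintype.card_fin] at h
  rw [powerIntegral, powerIntegral]
  refine (Eq.trans ?_ h).trans ?_
  · refine integral_congr_ae (Eventually.of_forall fun x => ?_)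
    simp only [plusPow_add_one]
  · congr 2
    ext x
    rw [mulProd_apply, Complex.ofReal_prod, mul_assoc]

/-- For `Re t > 0` the distribution `(x₁⋯xₙ)_+^t` is an eigenvector of `∂ᵢxᵢ` to the eigenvalue
`t + 1`. -/
theorem powerIntegral_eulerTest {t : ℂ} (ht : 0 < t.re) (i : Fin n)
    {V : Opens (RSpace n)} (φ : 𝓓(V, ℂ)) :
    powerIntegral t (eulerTest i V φ) = -(t + 1) * powerIntegral t φ := by
  have h := integral_plusPow_mul_delTest ht (Finset.notMem_empty i) φ
  rw [powerIntegral, powerIntegral]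
  refine (Eq.trans ?_ h).trans ?_
  · congr 1
    ext x
    rw [eulerTest_apply, ← delTest_apply]
    simp [mul_assoc]
  · simp

end PowerIntegral

/-! ### Product test functions -/

section ProductTestFunctions

variable {n : ℕ}

/-- The partial derivative of a product of functions of one variable. -/
theorem delTest_apply_of_eq_prod {V : Opens (RSpace n)} {φ : 𝓓(V, ℂ)} {χ : Fin n → ℝ → ℂ}
    (hφ : ∀ x, φ x = ∏ j, χ j (x j)) {i : Fin n} (hi : Differentiable ℝ (χ i)) (x : RSpace n) :
    delTest i φ x = ∏ j, (Function.update χ i (deriv (χ i))) j (x j) := by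
  have h1 : HasLineDerivAt ℝ φ (delTest i φ x) x (Pi.single i 1) := by
    rw [delTest_apply]
    exact (TestFunction.differentiable_coe φ x).hasFDerivAt.hasLineDerivAt _
  have hline : ∀ s : ℝ, φ (x + s • (Pi.single i 1 : RSpace n)) =
      χ i (x i + s) * ∏ j ∈ Finset.univ.erase i, χ j (x j) := by
    intro s
    rw [hφ, ← Finset.mul_prod_erase _ _ (Finset.mem_univ i)]
    congr 1
    · simp
    · refine Finset.prod_congr rfl fun j hj => ?_
      simp [Finset.ne_of_mem_erase hj]
  have h2 : HasLineDerivAt ℝ φ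
      (deriv (χ i) (x i) * ∏ j ∈ Finset.univ.erase i, χ j (x j)) x (Pi.single i 1) := by
    have h3 := ((hi (x i + 0)).hasDerivAt.comp_const_add (x i) 0).mul_const
      (∏ j ∈ Finset.univ.erase i, χ j (x j))
    rw [add_zero] at h3
    exact h3.congr_of_eventuallyEq (Eventually.of_forall hline)
  rw [HasDerivAt.unique h1 h2, ← Finset.mul_prod_erase _ _ (Finset.mem_univ i),
    Function.update_self]
  congr 1
  refine Finset.prod_congr rfl fun j hj => ?_
  rw [Function.update_of_ne (Finset.ne_of_mem_erase hj)]

theorem testDelPow_indicatorIndex_apply_of_eq_prod {V : Opens (RSpace n)} {φ : 𝓓(V, ℂ)}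
    {χ : Fin n → ℝ → ℂ} (hφ : ∀ x, φ x = ∏ j, χ j (x j)) (hχ : ∀ i, Differentiable ℝ (χ i))
    (K : Finset (Fin n)) (x : RSpace n) :
    testDelPow (indicatorIndex K) φ x =
      ∏ j, (if j ∈ K then deriv (χ j) else χ j) (x j) := by
  induction K using Finset.induction_on generalizing x with
  | empty =>
    have : indicatorIndex (∅ : Finset (Fin n)) = 0 := by ext; simp [indicatorIndex]
    rw [this, testDelPow_zero]
    simpa using hφ x
  | insert i K hi ih =>
    rw [indicatorIndex_insert hi, testDelPow_add_single]
    change delTest i (testDelPow (indicatorIndex K) φ) x = _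
    rw [delTest_apply_of_eq_prod ih (i := i) (by rw [if_neg hi]; exact hχ i)]
    refine Finset.prod_congr rfl fun j _ => ?_
    by_cases hj : j = i
    · subst hj; simp [hi]
    · simp [hj]

/-- Off the coordinate hyperplanes the indicator function of `x₁⋯xₙ > 0` is `(1 + ∏ sgn xᵢ) / 2`,
so that its integral against a product splits into products of one-dimensional integrals. -/
theorem powerIntegral_zero_prod {ψ : Fin n → ℝ → ℂ} (hψ : ∀ i, Integrable (ψ i)) :
    powerIntegral 0 (fun x : RSpace n => ∏ i, ψ i (x i)) =
      1 / 2 * ((∏ i, ∫ y, ψ i y) + ∏ i, ∫ y, ((SignType.sign y : ℝ) : ℂ) * ψ i y) := by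
  have hs : ∀ i, Integrable fun y => ((SignType.sign y : ℝ) : ℂ) * ψ i y := by
    intro i
    refine (hψ i).bdd_mul (c := 1) ?_ (Eventually.of_forall fun y => ?_)
    · have : Measurable fun y : ℝ => ((SignType.sign y : ℝ) : ℂ) := by
        have h : (fun y : ℝ => ((SignType.sign y : ℝ) : ℂ)) =
            fun y => if 0 < y then 1 else if y < 0 then -1 else 0 := by
          ext y
          rcases lt_trichotomy y 0 with h | h | h
          · simp [h, h.not_gt]
          · simp [h]
          · simp [h]
        rw [h]
        exact Measurable.ite measurableSet_Ioi measurable_const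
          (Measurable.ite measurableSet_Iio measurable_const measurable_const)
      exact this.aestronglyMeasurable
    · rcases lt_trichotomy y 0 with h | h | h <;> simp [h]
  have hψ' : Integrable fun x : RSpace n => ∏ i, ψ i (x i) := Integrable.fintype_prod hψ
  have hs' : Integrable fun x : RSpace n => ∏ i, ((SignType.sign (x i) : ℝ) : ℂ) * ψ i (x i) :=
    Integrable.fintype_prod hs
  rw [← integral_fintype_prod_volume_eq_prod, ← integral_fintype_prod_volume_eq_prod,
    ← integral_add hψ' hs', ← integral_const_mul, powerIntegral]
  have hae : ∀ᵐ x : RSpace n, ∀ i, x i ≠ 0 := by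
    rw [ae_all_iff]
    exact fun i => Measure.ae_eval_ne (fun _ : Fin n => (volume : Measure ℝ)) i 0
  refine integral_congr_ae (hae.mono fun x hx => ?_)
  have h0 : ∏ i, x i ≠ 0 := Finset.prod_ne_zero_iff.2 fun i _ => hx i
  have h1 : ∏ i, ((SignType.sign (x i) : ℝ) : ℂ) = ((SignType.sign (∏ i, x i) : ℝ) : ℂ) := by
    have := map_prod ((SignType.castHom : SignType →*₀ ℝ).comp signHom) x Finset.univ
    rw [← Complex.ofReal_prod]
    exact congrArg (fun y : ℝ => (y : ℂ)) this.symm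
  simp only [Finset.prod_mul_distrib, h1]
  rcases lt_or_gt_of_ne h0 with h | h
  · rw [plusPow_of_nonpos h.le, sign_neg h]
    simp
  · rw [plusPow_of_pos h, sign_pos h]
    simp
    ring

theorem integral_sign_mul {ψ : ℝ → ℂ} (hψ : Integrable ψ) :
    ∫ y, ((SignType.sign y : ℝ) : ℂ) * ψ y = (∫ y in Set.Ioi 0, ψ y) - ∫ y in Set.Iic 0, ψ y := by
  have h1 : Integrable ((Set.Ioi (0 : ℝ)).indicator ψ) := hψ.indicator measurableSet_Ioi
  have h2 : Integrable ((Set.Iic (0 : ℝ)).indicator ψ) := hψ.indicator measurableSet_Iic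
  rw [← integral_indicator measurableSet_Ioi, ← integral_indicator measurableSet_Iic,
    ← integral_sub h1 h2]
  have h0 : ∀ᵐ y : ℝ, y ≠ 0 := Measure.ae_ne volume 0
  refine integral_congr_ae (h0.mono fun y hy => ?_)
  rcases lt_or_gt_of_ne hy with h | h
  · simp [h, h.le, h.not_gt]
  · simp [h, h.not_ge]

/-- Near a point `y` with `yᵢ > 0` for `i ∈ S` and `yᵢ = 0` otherwise there are test functions
on which the mixed derivative, in the directions outside `S`, of the indicator function of
`x₁⋯xₙ > 0` does not vanish. -/
theorem exists_powerIntegral_zero_ne_zero {V : Opens (RSpace n)} {S : Finset (Fin n)}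
    (hS : S.card < n) {y : RSpace n} (hy : y ∈ V) (hpos : ∀ i ∈ S, 0 < y i)
    (hzero : ∀ i ∉ S, y i = 0) :
    ∃ φ : 𝓓(V, ℂ), powerIntegral 0 (testDelPow (indicatorIndex Sᶜ) φ) ≠ 0 := by
  obtain ⟨δ, hδ, hδV, hδS⟩ : ∃ δ : ℝ, 0 < δ ∧ Metric.closedBall y δ ⊆ V ∧ ∀ i ∈ S, δ < y i := by
    obtain ⟨ε, hε, hεV⟩ := Metric.nhds_basis_closedBall.mem_iff.1 (V.isOpen.mem_nhds hy)
    have h1 : ∀ᶠ δ in 𝓝[>] (0 : ℝ), δ < ε := nhdsWithin_le_nhds (gt_mem_nhds hε)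
    have h2 : ∀ᶠ δ in 𝓝[>] (0 : ℝ), ∀ i ∈ S, δ < y i :=
      (Filter.eventually_all_finset S).2 fun i hi =>
        nhdsWithin_le_nhds (gt_mem_nhds (hpos i hi))
    obtain ⟨δ, ⟨ha, hb⟩, hc⟩ := ((h1.and h2).and self_mem_nhdsWithin).exists
    exact ⟨δ, hc, (Metric.closedBall_subset_closedBall ha.le).trans hεV, hb⟩
  let b : ∀ i, ContDiffBump (y i) := fun i => ⟨δ / 2, δ, half_pos hδ, half_lt_self hδ⟩
  let χ : Fin n → ℝ → ℂ := fun i t => ((b i t : ℝ) : ℂ)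
  have hχ : ∀ i, ContDiff ℝ ∞ (χ i) := fun i =>
    Complex.ofRealCLM.contDiff.comp (b i).contDiff
  have hχd : ∀ i, Differentiable ℝ (χ i) := fun i => (hχ i).differentiable (by simp)
  have hχc : ∀ i, HasCompactSupport (χ i) := fun i =>
    (b i).hasCompactSupport.comp_left (g := fun t : ℝ => (t : ℂ)) Complex.ofReal_zero
  have hχ' : ∀ i, Continuous (deriv (χ i)) := fun i => (hχ i).continuous_deriv (by simp)
  have hsupp : Function.support (fun x : RSpace n => ∏ j, χ j (x j)) ⊆ Metric.closedBall y δ := by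
    intro x hx
    rw [Metric.mem_closedBall, dist_pi_le_iff hδ.le]
    intro i
    have h1 : χ i (x i) ≠ 0 := Finset.prod_ne_zero_iff.1 hx i (Finset.mem_univ i)
    have h2 : x i ∈ Function.support (b i) := fun h => h1 (by simp [χ, h])
    rw [(b i).support_eq] at h2
    exact (Metric.mem_ball.1 h2).le
  let φ : 𝓓(V, ℂ) :=
    { toFun := fun x => ∏ j, χ j (x j)
      contDiff' := contDiff_prod fun j _ => (hχ j).comp (contDiff_apply ℝ ℝ j)
      hasCompactSupport' :=
        HasCompactSupport.of_support_subset_isCompact (isCompact_closedBall y δ) hsupp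
      tsupport_subset' := (closure_minimal hsupp Metric.isClosed_closedBall).trans hδV }
  refine ⟨φ, ?_⟩
  have h1 := testDelPow_indicatorIndex_apply_of_eq_prod (φ := φ) (χ := χ) (fun x => rfl) hχd Sᶜ
  have hint : ∀ i, Integrable (χ i) := fun i =>
    (hχ i).continuous.integrable_of_hasCompactSupport (hχc i)
  have hint' : ∀ i, Integrable (deriv (χ i)) := fun i =>
    (hχ' i).integrable_of_hasCompactSupport (hχc i).deriv
  rw [show (testDelPow (indicatorIndex Sᶜ) φ : RSpace n → ℂ) = _ from funext h1,
    powerIntegral_zero_prod fun i => by split_ifs; exacts [hint' i, hint i]]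
  have hC1 : ∀ i, ContDiff ℝ 1 (χ i) := fun i => (hχ i).of_le (by simp)
  have hIoi : ∀ i, ∫ t in Set.Ioi 0, deriv (χ i) t = -χ i 0 := fun i =>
    HasCompactSupport.integral_Ioi_deriv_eq (hC1 i) (hχc i) 0
  have hIic : ∀ i, ∫ t in Set.Iic 0, deriv (χ i) t = χ i 0 := fun i =>
    HasCompactSupport.integral_Iic_deriv_eq (hC1 i) (hχc i) 0
  obtain ⟨i₀, hi₀⟩ : ∃ i, i ∈ Sᶜ := by
    have : 0 < Sᶜ.card := by rw [Finset.card_compl, Fintype.card_fin]; omega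
    exact Finset.card_pos.1 this
  have hzero_int : ∏ i, ∫ t, (if i ∈ Sᶜ then deriv (χ i) else χ i) t = 0 := by
    refine Finset.prod_eq_zero (Finset.mem_univ i₀) ?_
    rw [if_pos hi₀, ← intervalIntegral.integral_Iic_add_Ioi (b := 0) (hint' i₀).integrableOn
      (hint' i₀).integrableOn, hIoi, hIic, add_neg_cancel]
  rw [hzero_int, zero_add]
  refine mul_ne_zero (by norm_num) (Finset.prod_ne_zero_iff.2 fun i _ => ?_)
  by_cases hi : i ∈ Sᶜ
  · rw [if_pos hi, integral_sign_mul (hint' i), hIoi, hIic]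
    have : χ i 0 = 1 := by
      have h2 : b i 0 = 1 := by
        refine (b i).one_of_mem_closedBall ?_
        have h3 : y i = 0 := hzero i (Finset.mem_compl.1 hi)
        have h4 : dist 0 (y i) ≤ δ / 2 := by
          rw [h3, dist_self]
          exact (half_pos hδ).le
        exact h4
      simp [χ, h2]
    rw [this]; norm_num
  · have hiS : i ∈ S := by simpa using hi
    rw [if_neg hi]
    have h2 : ∀ t, ((SignType.sign t : ℝ) : ℂ) * χ i t = χ i t := by
      intro t
      by_cases ht : 0 < t
      · simp [ht]
      · have : b i t = 0 := by
          refine (b i).zero_of_le_dist ?_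
          change δ ≤ |t - y i|
          have := hδS i hiS
          rw [abs_of_nonpos (by linarith)]
          linarith
        simp [χ, this]
    simp only [h2]
    have h3 : ∫ t, χ i t = ((∫ t, b i t : ℝ) : ℂ) := integral_ofReal
    rw [h3]
    exact_mod_cast (b i).integral_pos.ne'

/-- A germ annihilating `u` vanishes on the stratum `{xᵢ = 0 for i ∉ S}` as soon as `u` is, there,
up to the factor `x_S`, the mixed derivative of the indicator function of `x₁⋯xₙ > 0`. -/
theorem zeroOut_eq_zero_of_ofGerm_mem_annIdeal {u : CDistribution (⊤ : Opens (RSpace n))}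
    {S : Finset (Fin n)} (hS : S.card < n) {c : ℂ} (hc : c ≠ 0)
    (hu : ∀ φ, u (mulProd S ⊤ φ) = c * powerIntegral 0 (testDelPow (indicatorIndex Sᶜ) φ))
    {g : AnGerm n} (hg : diffOpStalk.ofGerm g ∈ annIdeal u) : AnGerm.zeroOut Sᶜ g = 0 := by
  obtain ⟨f, hf, rfl⟩ := AnGerm.exists_rep g
  obtain ⟨r, ha, hr, hann⟩ := (ofGerm_mem_annIdeal_iff hf).1 hg
  have hvanish : ∀ y ∈ ballOpens n r, (∀ i ∈ S, 0 < y i) → (∀ i ∉ S, y i = 0) → f y = 0 := by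
    intro y hy hpos hzero
    by_contra hfy
    let V' : Opens (RSpace n) := ⟨(ballOpens n r : Set (RSpace n)) ∩ f ⁻¹' {0}ᶜ,
      ha.continuousOn.isOpen_inter_preimage (ballOpens n r).isOpen isOpen_compl_singleton⟩
    have hV' : V' ≤ ballOpens n r := Set.inter_subset_left
    obtain ⟨ψ, hψ⟩ := exists_powerIntegral_zero_ne_zero hS (V := V') (y := y) ⟨hy, hfy⟩ hpos hzero
    -- `f` kills `u`, hence so does `x_S`, as a multiple of `f` near `y`
    have ha' : AnalyticOnNhd ℝ (fun x => (f x)⁻¹ * ∏ j ∈ S, ((x j : ℝ) : ℂ)) V' :=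
      ((ha.mono hV').fun_inv fun x hx => hx.2).mul
        (Finset.analyticOnNhd_fun_prod _ fun j _ => analyticOnNhd_coord j V')
    have h1 : testIncl (ballOpens n r) ⊤ (mulTestEnd f ha
        (testIncl V' (ballOpens n r) (mulTestEnd _ ha' ψ))) = mulProd S ⊤ (testIncl V' ⊤ ψ) := by
      ext x
      rw [testIncl_apply le_top, mulTestEnd_apply, testIncl_apply hV', mulTestEnd_apply,
        mulProd_apply, testIncl_apply le_top]
      by_cases hx : x ∈ V'
      · have : f x ≠ 0 := hx.2
        field_simp
      · have : ψ x = 0 := image_eq_zero_of_notMem_tsupport fun h => hx (ψ.tsupport_subset h)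
        rw [this]; ring
    have h2 := hann (testIncl V' (ballOpens n r) (mulTestEnd _ ha' ψ))
    rw [h1, hu, ← testIncl_testDelPow le_top, coe_testIncl le_top] at h2
    exact mul_ne_zero hc hψ h2
  have hproj : ∀ x ∈ ballOpens n r, AnGerm.zeroProj Sᶜ x ∈ ballOpens n r := by
    intro x hx
    have hx : ‖x‖ < r := mem_ball_zero_iff.1 hx
    refine mem_ball_zero_iff.2 (lt_of_le_of_lt ?_ hx)
    simpa using (AnGerm.zeroProj Sᶜ).le_of_opNorm_le (AnGerm.norm_zeroProj_le Sᶜ) x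
  have hana : AnalyticOnNhd ℝ (fun x => f (AnGerm.zeroProj Sᶜ x)) (ballOpens n r) := fun x hx =>
    AnalyticAt.fun_comp (ha _ (hproj x hx)) ((AnGerm.zeroProj Sᶜ).analyticAt x)
  have hzmem : (fun _ => r / 2 : RSpace n) ∈ ballOpens n r := by
    refine mem_ball_zero_iff.2 ((pi_norm_lt_iff hr).2 fun i => ?_)
    rw [Real.norm_of_nonneg (half_pos hr).le]
    exact half_lt_self hr
  have hev : (fun x => f (AnGerm.zeroProj Sᶜ x)) =ᶠ[𝓝 (fun _ => r / 2 : RSpace n)] 0 := by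
    have h1 : ∀ᶠ x in 𝓝 (fun _ => r / 2 : RSpace n), ∀ i, 0 < x i := by
      rw [eventually_all]
      exact fun i => (continuous_apply i).continuousAt.eventually (lt_mem_nhds (half_pos hr))
    filter_upwards [h1, (ballOpens n r).isOpen.mem_nhds hzmem] with x hx hxr
    refine hvanish _ (hproj x hxr) (fun i hi => ?_) fun i hi => ?_
    · rw [AnGerm.zeroProj_apply, if_neg (by simpa using hi)]
      exact hx i
    · rw [AnGerm.zeroProj_apply, if_pos (by simpa using hi)]
  rw [AnGerm.zeroOut_mk, AnGerm.mk_eq_zero]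
  filter_upwards [(ballOpens n r).isOpen.mem_nhds (zero_mem_ballOpens hr)] with x hx
  exact hana.eqOn_zero_of_preconnected_of_eventuallyEq_zero (isPreconnected_ballOpens r) hzmem hev
    hx

end ProductTestFunctions

/-! ### Laurent expansions of complex functions -/

section Laurent

variable {h : ℂ → ℂ} {s₀ : ℂ} {c : ℤ → ℂ}

theorem HasSum.laurent_mul_zpow {s a : ℂ} (hs : s ≠ s₀)
    (h : HasSum (fun j : ℤ => (s - s₀) ^ j * c j) a) (p : ℤ) :
    HasSum (fun j : ℤ => (s - s₀) ^ j * c (j - p)) ((s - s₀) ^ p * a) := by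
  have h1 := h.mul_left ((s - s₀) ^ p)
  have h2 : (fun j : ℤ => (s - s₀) ^ j * c (j - p)) =
      (fun j : ℤ => (s - s₀) ^ p * ((s - s₀) ^ j * c j)) ∘ Equiv.subRight p := by
    ext j
    change _ = (s - s₀) ^ p * ((s - s₀) ^ (j - p) * c (j - p))
    rw [← mul_assoc, ← zpow_add₀ (sub_ne_zero.2 hs), add_sub_cancel]
  rw [h2]
  exact (Equiv.subRight p).hasSum_iff.2 h1

/-- A Laurent series with finite principal part is a power series up to a factor `(s - s₀)ᵐ`. -/
theorem exists_analyticAt_of_laurent {m : ℕ} (hc : ∀ j : ℤ, j < -(m : ℤ) → c j = 0)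
    (hsum : ∀ᶠ s in 𝓝[≠] s₀, HasSum (fun j : ℤ => (s - s₀) ^ j * c j) (h s)) :
    ∃ H : ℂ → ℂ, AnalyticAt ℂ H s₀ ∧ H s₀ = c (-(m : ℤ)) ∧
      ∀ᶠ s in 𝓝[≠] s₀, (s - s₀) ^ m * h s = H s := by
  have key : ∀ s, s ≠ s₀ → HasSum (fun j : ℤ => (s - s₀) ^ j * c j) (h s) →
      HasSum (fun k : ℕ => (s - s₀) ^ k * c (k - m)) ((s - s₀) ^ m * h s) := by
    intro s hs h1
    have h2 := h1.laurent_mul_zpow hs m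
    rw [zpow_natCast] at h2
    refine (Function.Injective.hasSum_iff (f := fun j : ℤ => (s - s₀) ^ j * c (j - m))
      (g := fun k : ℕ => (k : ℤ)) Nat.cast_injective ?_).2 h2
    intro j hj
    have : j < 0 := by
      by_contra hj'
      exact hj ⟨j.toNat, Int.toNat_of_nonneg (not_lt.1 hj')⟩
    rw [hc _ (by omega), mul_zero]
  refine ⟨fun s => ∑' k : ℕ, (s - s₀) ^ k * c (k - m), ?_, ?_, ?_⟩
  · refine HasFPowerSeriesAt.analyticAt (p := FormalMultilinearSeries.ofScalars ℂ
      fun k : ℕ => c (k - m)) (hasFPowerSeriesAt_iff.2 ?_)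
    simp only [FormalMultilinearSeries.coeff_ofScalars, smul_eq_mul, add_sub_cancel_left]
    rw [eventually_nhdsWithin_iff] at hsum
    have h1 : Tendsto (fun z => s₀ + z) (𝓝 0) (𝓝 s₀) := by
      have : Continuous fun z : ℂ => s₀ + z := by fun_prop
      simpa using this.tendsto 0
    filter_upwards [h1.eventually hsum] with z hz
    by_cases hz0 : z = 0
    · subst hz0
      refine (summable_of_ne_finset_zero (s := {0}) fun k hk => ?_).hasSum
      rw [zero_pow (by simpa using hk), zero_mul]
    · have hne : s₀ + z ≠ s₀ := by simpa using hz0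
      have := (key _ hne (hz hne)).summable.hasSum
      simpa using this
  · change ∑' k : ℕ, (s₀ - s₀) ^ k * c (k - m) = _
    rw [tsum_eq_single 0 fun k hk => by rw [sub_self, zero_pow hk, zero_mul]]
    simp
  · filter_upwards [hsum, self_mem_nhdsWithin] with s h1 h2
    exact (key s h2 h1).tsum_eq.symm

theorem meromorphicAt_of_laurent {m : ℕ} (hc : ∀ j : ℤ, j < -(m : ℤ) → c j = 0)
    (hsum : ∀ᶠ s in 𝓝[≠] s₀, HasSum (fun j : ℤ => (s - s₀) ^ j * c j) (h s)) :
    MeromorphicAt h s₀ := by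
  obtain ⟨H, hH, -, hev⟩ := exists_analyticAt_of_laurent hc hsum
  have h1 : MeromorphicAt (fun s => ((s - s₀) ^ m)⁻¹ * H s) s₀ := by fun_prop
  refine h1.congr ?_
  filter_upwards [hev, self_mem_nhdsWithin] with s h2 h3
  rw [← h2, inv_mul_cancel_left₀ (pow_ne_zero _ (sub_ne_zero.2 h3))]

/-- A limit of `(s - s₀)ᵖ h(s)` at `s₀` bounds the order of the pole and determines the
coefficient of index `-p`. -/
theorem laurent_coeff_of_tendsto {m : ℕ} (hc : ∀ j : ℤ, j < -(m : ℤ) → c j = 0)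
    (hsum : ∀ᶠ s in 𝓝[≠] s₀, HasSum (fun j : ℤ => (s - s₀) ^ j * c j) (h s)) {p : ℤ} {ℓ : ℂ}
    (hℓ : Tendsto (fun s => (s - s₀) ^ p * h s) (𝓝[≠] s₀) (𝓝 ℓ)) :
    (∀ j < -p, c j = 0) ∧ c (-p) = ℓ := by
  have key : ∀ (N : ℕ) (c : ℤ → ℂ) (h : ℂ → ℂ), (∀ j : ℤ, j < -(N : ℤ) → c j = 0) →
      (∀ᶠ s in 𝓝[≠] s₀, HasSum (fun j : ℤ => (s - s₀) ^ j * c j) (h s)) →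
      Tendsto h (𝓝[≠] s₀) (𝓝 ℓ) → (∀ j < 0, c j = 0) ∧ c 0 = ℓ := by
    intro N c h hc hsum hℓ
    induction N with
    | zero =>
      obtain ⟨H, hH, hH0, hev⟩ := exists_analyticAt_of_laurent hc hsum
      refine ⟨fun j hj => hc j (by simpa using hj), ?_⟩
      have h1 : Tendsto H (𝓝[≠] s₀) (𝓝 (H s₀)) :=
        hH.continuousAt.tendsto.mono_left nhdsWithin_le_nhds
      have h2 : Tendsto h (𝓝[≠] s₀) (𝓝 (H s₀)) := h1.congr' (hev.mono fun s hs => by simp [← hs])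
      rw [tendsto_nhds_unique hℓ h2, hH0]
      simp
    | succ N ih =>
      refine ih fun j hj => ?_
      rcases eq_or_ne j (-((N + 1 : ℕ) : ℤ)) with rfl | hj'
      · obtain ⟨H, hH, hH0, hev⟩ := exists_analyticAt_of_laurent hc hsum
        have h1 : Tendsto H (𝓝[≠] s₀) (𝓝 (H s₀)) :=
          hH.continuousAt.tendsto.mono_left nhdsWithin_le_nhds
        have h2 : Tendsto (fun s => (s - s₀) ^ (N + 1)) (𝓝[≠] s₀) (𝓝 0) := by
          have : Continuous fun s => (s - s₀) ^ (N + 1) := by fun_prop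
          have := (this.tendsto s₀).mono_left (nhdsWithin_le_nhds (s := {s₀}ᶜ))
          simpa using this
        have h3 := (h2.mul hℓ).congr' hev
        rw [zero_mul] at h3
        rw [← hH0, tendsto_nhds_unique h1 h3]
      · exact hc j (by push_cast at hj' ⊢; omega)
  have h1 := key (m + p.natAbs) (fun j => c (j - p)) (fun s => (s - s₀) ^ p * h s)
    (fun j hj => hc _ (by omega))
    (by
      filter_upwards [hsum, self_mem_nhdsWithin] with s h1 h2
      exact h1.laurent_mul_zpow h2 p) hℓ
  refine ⟨fun j hj => ?_, by simpa using h1.2⟩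
  have := h1.1 (j + p) (by omega)
  simpa using this

/-- The identity theorem for meromorphic functions on the plane. -/
theorem Meromorphic.eventually_eq_zero {h : ℂ → ℂ} (hh : ∀ s, MeromorphicAt h s)
    (h0 : ∀ s : ℂ, 0 < s.re → h s = 0) (s₀ : ℂ) : ∀ᶠ s in 𝓝[≠] s₀, h s = 0 := by
  have hm : Meromorphic h := fun s => hh s
  rw [← meromorphicOrderAt_eq_top_iff]
  by_contra hne
  have h1 := hm.exists_meromorphicOrderAt_ne_top_iff_forall.1 ⟨s₀, hne⟩ 1
  apply h1
  rw [meromorphicOrderAt_eq_top_iff]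
  have : ∀ᶠ s in 𝓝 (1 : ℂ), 0 < s.re :=
    Complex.continuous_re.continuousAt.eventually (lt_mem_nhds (by simp))
  exact nhdsWithin_le_nhds (this.mono h0)

end Laurent

/-! ### Continuity of the power integral -/

section Continuity

variable {n : ℕ}

theorem norm_plusPow_le {t : ℂ} {a b : ℝ} (ha : a ≤ t.re) (hb : t.re ≤ b) {y : ℝ} (hy : 0 < y) :
    ‖plusPow y t‖ ≤ y ^ a + y ^ b := by
  rw [norm_plusPow_of_pos hy]
  rcases le_total y 1 with h | h
  · exact (Real.rpow_le_rpow_of_exponent_ge hy h ha).trans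
      (le_add_of_nonneg_right (Real.rpow_nonneg hy.le b))
  · exact (Real.rpow_le_rpow_of_exponent_le h hb).trans
      (le_add_of_nonneg_left (Real.rpow_nonneg hy.le a))

theorem continuousOn_powerIntegral {V : Opens (RSpace n)} (ψ : 𝓓(V, ℂ)) (b : ℕ) :
    ContinuousOn (fun t => powerIntegral t ψ) {t | 0 ≤ t.re ∧ t.re ≤ b} := by
  have hf := continuous_prod_coord (n := n) Finset.univ
  have hbound : Integrable fun x : RSpace n => (((1 + |∏ i, x i| ^ b : ℝ) : ℂ)) * ψ x :=
    TestFunction.integrable_mul (by fun_prop) ψ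
  refine continuousOn_of_dominated (bound := fun x => ‖(((1 + |∏ i, x i| ^ b : ℝ) : ℂ)) * ψ x‖)
    (fun t _ => ?_) (fun t ht => Eventually.of_forall fun x => ?_) hbound.norm
    (Eventually.of_forall fun x => ?_)
  · exact (((measurable_plusPow t).comp hf.measurable).mul
      ψ.continuous.measurable).aestronglyMeasurable
  · rw [norm_mul, norm_mul]
    refine mul_le_mul_of_nonneg_right ?_ (norm_nonneg _)
    rw [Complex.norm_real, Real.norm_of_nonneg (by positivity)]
    rcases lt_or_ge 0 (∏ i, x i) with h | h
    · refine (norm_plusPow_le ht.1 ht.2 h).trans ?_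
      rw [Real.rpow_zero, Real.rpow_natCast, abs_of_pos h]
    · rw [plusPow_of_nonpos h, norm_zero]
      positivity
  · exact ((continuous_plusPow_exponent _).mul continuous_const).continuousOn

end Continuity

/-! ### Laurent coefficients of the complex power -/

section Coefficients

variable {n : ℕ} {F : ℂ → CDistribution (⊤ : Opens (RSpace n))}

theorem IsComplexPower.apply_eq (hF : IsComplexPower n F) {s : ℂ} (hs : 0 < s.re)
    (φ : 𝓓((⊤ : Opens (RSpace n)), ℂ)) : F s φ = powerIntegral s φ := hF.1 s hs φ

theorem HasLaurentExpansionAt.meromorphicAt {s₀ : ℂ} {u : ℤ → CDistribution (⊤ : Opens (RSpace n))}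
    (hu : HasLaurentExpansionAt F s₀ u) (φ : 𝓓((⊤ : Opens (RSpace n)), ℂ)) :
    MeromorphicAt (fun s => F s φ) s₀ := by
  obtain ⟨⟨m, hm⟩, hsum⟩ := hu
  exact meromorphicAt_of_laurent (c := fun j => u j φ) (m := m) (fun j hj => by simp [hm j hj])
    (hsum.mono fun s hs => hs φ)

theorem IsComplexPower.meromorphicAt (hF : IsComplexPower n F)
    (φ : 𝓓((⊤ : Opens (RSpace n)), ℂ)) (s : ℂ) : MeromorphicAt (fun s => F s φ) s := by
  obtain ⟨u, hu⟩ := hF.2 s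
  exact hu.meromorphicAt φ

/-- The integration by parts outside `J` persists under continuation. -/
theorem IsComplexPower.eventually_add_one (hF : IsComplexPower n F) (J : Finset (Fin n))
    (φ : 𝓓((⊤ : Opens (RSpace n)), ℂ)) (s₀ : ℂ) :
    ∀ᶠ s in 𝓝[≠] s₀, F (s + 1) (testDelPow (indicatorIndex Jᶜ) φ) =
      (-(s + 1)) ^ (n - J.card) * F s (mulProd J ⊤ φ) := by
  have h1 : ∀ s, MeromorphicAt (fun s => F (s + 1) (testDelPow (indicatorIndex Jᶜ) φ)) s :=
    fun s => (hF.meromorphicAt (testDelPow (indicatorIndex Jᶜ) φ) (s + 1)).comp_analyticAt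
      (g := fun s => s + 1) (by fun_prop)
  have h2 : ∀ s, MeromorphicAt (fun s => F s (mulProd J ⊤ φ)) s := hF.meromorphicAt _
  have h3 := Meromorphic.eventually_eq_zero (h := fun s =>
    F (s + 1) (testDelPow (indicatorIndex Jᶜ) φ) -
      (-(s + 1)) ^ (n - J.card) * F s (mulProd J ⊤ φ))
    (fun s => (h1 s).sub (.mul (by fun_prop) (h2 s))) (fun s hs => by
      rw [hF.apply_eq hs, hF.apply_eq (by simp; linarith), powerIntegral_add_one hs, sub_self]) s₀
  exact h3.mono fun s hs => sub_eq_zero.1 hs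

/-- The relation `∂ᵢxᵢ f_+^s = (s + 1) f_+^s`, where `f = x₁⋯xₙ`, persists under continuation. -/
theorem IsComplexPower.eventually_eulerTest (hF : IsComplexPower n F) (i : Fin n)
    (φ : 𝓓((⊤ : Opens (RSpace n)), ℂ)) (s₀ : ℂ) :
    ∀ᶠ s in 𝓝[≠] s₀, F s (eulerTest i ⊤ φ) + (s + 1) * F s φ = 0 :=
  Meromorphic.eventually_eq_zero (h := fun s => F s (eulerTest i ⊤ φ) + (s + 1) * F s φ)
    (fun s => (hF.meromorphicAt _ s).add (.mul (by fun_prop) (hF.meromorphicAt _ s)))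
    (fun s hs => by rw [hF.apply_eq hs, hF.apply_eq hs, powerIntegral_eulerTest hs]; ring) s₀

theorem mulProd_empty {V : Opens (RSpace n)} (φ : 𝓓(V, ℂ)) : mulProd ∅ V φ = φ := by
  ext x; simp [mulProd_apply]

/-- The complex power is regular at `0`, where it is the indicator function of `x₁⋯xₙ > 0`. -/
theorem IsComplexPower.tendsto_zero (hF : IsComplexPower n F)
    (ψ : 𝓓((⊤ : Opens (RSpace n)), ℂ)) :
    Tendsto (fun t => F t ψ) (𝓝[≠] 0) (𝓝 (powerIntegral 0 ψ)) := by
  set Lψ := testDelPow (indicatorIndex (∅ : Finset (Fin n))ᶜ) ψ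
  have hcont1 : Tendsto (fun t : ℂ => powerIntegral (t + 1) Lψ) (𝓝 0) (𝓝 (powerIntegral 1 Lψ)) := by
    have h1 : ContinuousAt (fun t => powerIntegral t Lψ) 1 := by
      refine (continuousOn_powerIntegral Lψ 2).continuousAt ?_
      have h2 : ∀ᶠ t in 𝓝 (1 : ℂ), 0 < t.re ∧ t.re < 2 :=
        (Complex.continuous_re.continuousAt.eventually (lt_mem_nhds (by simp))).and
          (Complex.continuous_re.continuousAt.eventually (gt_mem_nhds (by simp)))
      exact h2.mono fun t ht => ⟨ht.1.le, by simpa using ht.2.le⟩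
    have h3 : Tendsto (fun t : ℂ => t + 1) (𝓝 0) (𝓝 1) := by
      have : Continuous fun t : ℂ => t + 1 := by fun_prop
      simpa using this.tendsto 0
    exact h1.tendsto.comp h3
  -- the limit exists by one shift of the exponent; its value is found along the positive reals
  have hlim : Tendsto (fun t => F t ψ) (𝓝[≠] 0) (𝓝 (((-(0 + 1)) ^ n)⁻¹ * powerIntegral 1 Lψ)) := by
    have h1 : Tendsto (fun t : ℂ => ((-(t + 1)) ^ n)⁻¹ * powerIntegral (t + 1) Lψ) (𝓝[≠] 0)
        (𝓝 (((-(0 + 1)) ^ n)⁻¹ * powerIntegral 1 Lψ)) := by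
      refine Tendsto.mul ?_ (hcont1.mono_left nhdsWithin_le_nhds)
      have : Continuous fun t : ℂ => (-(t + 1)) ^ n := by fun_prop
      exact ((this.tendsto 0).inv₀ (pow_ne_zero _ (by simp))).mono_left nhdsWithin_le_nhds
    refine h1.congr' ?_
    have hre : ∀ᶠ t in 𝓝[≠] (0 : ℂ), -1 < t.re :=
      nhdsWithin_le_nhds (Complex.continuous_re.continuousAt.eventually (lt_mem_nhds (by simp)))
    filter_upwards [hF.eventually_add_one ∅ ψ 0, hre] with t ht hre
    have hre1 : 0 < (t + 1).re := by simp; linarith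
    have hne : -(t + 1) ≠ 0 := neg_ne_zero.2 fun h => by simp [h] at hre1
    rw [← hF.apply_eq hre1, ht, mulProd_empty, Finset.card_empty, Nat.sub_zero,
      inv_mul_cancel_left₀ (pow_ne_zero _ hne)]
  have hreal : Tendsto (fun t : ℝ => (t : ℂ)) (𝓝[>] 0) (𝓝[≠] 0) := by
    refine tendsto_nhdsWithin_iff.2 ⟨?_, ?_⟩
    · exact (Complex.continuous_ofReal.tendsto' 0 0 rfl).mono_left nhdsWithin_le_nhds
    · filter_upwards [self_mem_nhdsWithin] with t ht
      exact Complex.ofReal_ne_zero.2 (ne_of_gt ht)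
  have hreal' : Tendsto (fun t : ℝ => (t : ℂ)) (𝓝[>] 0) (𝓝[{t | 0 ≤ t.re ∧ t.re ≤ (1 : ℕ)}] 0) := by
    refine tendsto_nhdsWithin_iff.2
      ⟨hreal.mono_right nhdsWithin_le_nhds, ?_⟩
    have h1 : ∀ᶠ t in 𝓝[>] (0 : ℝ), t < 1 := nhdsWithin_le_nhds (gt_mem_nhds one_pos)
    filter_upwards [self_mem_nhdsWithin, h1] with t ht ht1
    exact ⟨le_of_lt ht, by simpa using ht1.le⟩
  have h2 : Tendsto (fun t : ℝ => F t ψ) (𝓝[>] 0) (𝓝 (powerIntegral 0 ψ)) := by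
    have h3 := (continuousOn_powerIntegral ψ 1 0 (by simp)).tendsto.comp hreal'
    refine h3.congr' ?_
    filter_upwards [self_mem_nhdsWithin] with t ht
    exact (hF.apply_eq (by simpa using ht) ψ).symm
  rwa [← tendsto_nhds_unique (hlim.comp hreal) h2]

variable {u : ℤ → CDistribution (⊤ : Opens (RSpace n))}

/-- Multiplication by `x_J` lowers the order of the pole at `-1` to at most `n - |J|`, and the
coefficient of that order is a mixed derivative of the indicator function of `x₁⋯xₙ > 0`. -/
theorem IsComplexPower.coeff_mulProd (hF : IsComplexPower n F)
    (hu : HasLaurentExpansionAt F (-1) u) (J : Finset (Fin n))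
    (φ : 𝓓((⊤ : Opens (RSpace n)), ℂ)) :
    (∀ j : ℤ, j < -((n - J.card : ℕ) : ℤ) → u j (mulProd J ⊤ φ) = 0) ∧
      u (-((n - J.card : ℕ) : ℤ)) (mulProd J ⊤ φ) =
        (-1) ^ (n - J.card) * powerIntegral 0 (testDelPow (indicatorIndex Jᶜ) φ) := by
  obtain ⟨⟨m, hm⟩, hsum⟩ := hu
  refine laurent_coeff_of_tendsto (h := fun s => F s (mulProd J ⊤ φ)) (s₀ := -1) (m := m)
    (c := fun j => u j (mulProd J ⊤ φ)) (fun j hj => by simp [hm j hj])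
    (hsum.mono fun s hs => hs _) ?_
  have h1 : Tendsto (fun s : ℂ => s + 1) (𝓝[≠] (-1)) (𝓝[≠] 0) := by
    refine tendsto_nhdsWithin_iff.2 ⟨?_, ?_⟩
    · have : Continuous fun t : ℂ => t + 1 := by fun_prop
      exact (this.tendsto' (-1) 0 (by simp)).mono_left nhdsWithin_le_nhds
    · filter_upwards [self_mem_nhdsWithin] with t ht h
      exact ht (eq_neg_of_add_eq_zero_left h)
  have h2 := ((hF.tendsto_zero (testDelPow (indicatorIndex Jᶜ) φ)).comp h1).const_mul
    ((-1 : ℂ) ^ (n - J.card))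
  refine h2.congr' ((hF.eventually_add_one J φ (-1)).mono fun s hs => ?_)
  simp only [Function.comp_apply]
  rw [hs, zpow_natCast, ← mul_assoc, ← mul_pow]
  congr 2
  ring

/-- The pole at `-1` has order at most `n`. -/
theorem IsComplexPower.coeff_eq_zero (hF : IsComplexPower n F)
    (hu : HasLaurentExpansionAt F (-1) u) {j : ℤ} (hj : j < -(n : ℤ)) : u j = 0 := by
  ext φ
  have := (hF.coeff_mulProd hu ∅ φ).1 j (by simpa using hj)
  rwa [mulProd_empty] at this

/-- The relation `∂ᵢxᵢ u_j = u_{j-1}` between the Laurent coefficients, in transposed form. -/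
theorem IsComplexPower.coeff_eulerTest (hF : IsComplexPower n F)
    (hu : HasLaurentExpansionAt F (-1) u) (i : Fin n) (j : ℤ)
    (φ : 𝓓((⊤ : Opens (RSpace n)), ℂ)) : u j (eulerTest i ⊤ φ) = -u (j - 1) φ := by
  obtain ⟨⟨m, hm⟩, hsum⟩ := hu
  have h1 : ∀ᶠ s in 𝓝[≠] (-1 : ℂ), HasSum
      (fun j : ℤ => (s - -1) ^ j * (u j (eulerTest i ⊤ φ) + u (j - 1) φ))
      (F s (eulerTest i ⊤ φ) + (s + 1) * F s φ) := by
    filter_upwards [hsum, self_mem_nhdsWithin] with s hs hne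
    have h2 := (hs φ).laurent_mul_zpow (c := fun j => u j φ) hne 1
    rw [zpow_one, sub_neg_eq_add] at h2
    simpa only [mul_add, sub_neg_eq_add] using (hs (eulerTest i ⊤ φ)).add h2
  have h2 := laurent_coeff_of_tendsto (m := m) (p := -j) (ℓ := 0) (fun j hj => by
    rw [hm j hj, hm (j - 1) (by omega)]; simp) h1
    (tendsto_const_nhds.congr' ((hF.eventually_eulerTest i φ (-1)).mono fun s hs => by
      simp only [hs, mul_zero]))
  rw [neg_neg] at h2
  exact eq_neg_of_add_eq_zero_left h2.2

/-! ### The annihilators of the Laurent coefficients -/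

theorem prod_coord_eq_mk (J : Finset (Fin n)) :
    ∏ j ∈ J, (AnGerm.coord j : AnGerm n) = AnGerm.mk (fun x => ∏ j ∈ J, ((x j : ℝ) : ℂ))
      (Finset.analyticAt_fun_prod _ fun j _ => AnGerm.analyticAt_coord j 0) := by
  induction J using Finset.induction_on with
  | empty => rfl
  | insert i J hi ih =>
    rw [Finset.prod_insert hi, ih, AnGerm.coord_eq_mk, ← AnGerm.mk_mul]
    exact AnGerm.mk_eq_mk.2 (Eventually.of_forall fun x =>
      (Finset.prod_insert (f := fun j => ((x j : ℝ) : ℂ)) hi).symm)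

theorem IsComplexPower.annIdeal_coeff (hF : IsComplexPower n F)
    (hu : HasLaurentExpansionAt F (-1) u) (hn : 0 < n) {k : ℕ} (hk : k < n) :
    annIdeal (u (-(n : ℤ) + k)) = Ideal.span ((diffOpStalk.germOps n).generators hn (k + 1)) := by
  -- the chain starts with the coefficient of index `-n - 1`, which is zero
  have h := (diffOpStalk.germOps_generates n).annihilator_eq_span hn
    (fun m => annIdeal (u (-(n : ℤ) + m - 1))) ?_ ?_ ?_ ?_ ?_ (k + 1) hk
  · rw [← h]
    congr 2
    push_cast
    ring
  · rw [hF.coeff_eq_zero hu (by simp), annIdeal_zero]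
  · intro m _ i P
    refine mul_del_mul_coord_mem_annIdeal_iff i (fun φ => ?_) P
    rw [hF.coeff_eulerTest hu]
    congr 3
    push_cast
    ring
  · intro m _ i j
    refine del_mul_coord_sub_mem_annIdeal i j fun φ => ?_
    rw [hF.coeff_eulerTest hu, hF.coeff_eulerTest hu]
  · intro J
    rw [prod_coord_eq_mk]
    refine (ofGerm_mem_annIdeal_iff _).2 ⟨1, Finset.analyticOnNhd_fun_prod _ fun j _ =>
      analyticOnNhd_coord j _, one_pos, fun φ => ?_⟩
    have hcard := card_finset_fin_le J
    rw [testIncl_mulTestEnd le_top _ (Finset.analyticOnNhd_fun_prod _ fun j _ =>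
      analyticOnNhd_coord j ⊤)]
    exact (hF.coeff_mulProd hu J _).1 _ (by omega)
  · intro S hS g hg
    refine zeroOut_eq_zero_of_ofGerm_mem_annIdeal hS (c := (-1) ^ (n - S.card))
      (pow_ne_zero _ (by norm_num)) (fun φ => ?_) hg
    rw [← (hF.coeff_mulProd hu S φ).2]
    congr 2
    push_cast [hS.le]
    ring

theorem IsComplexPower.coeff_neg_ne_zero (hF : IsComplexPower n F)
    (hu : HasLaurentExpansionAt F (-1) u) (hn : 0 < n) : u (-(n : ℤ)) ≠ 0 := by
  intro h0
  have h := zeroOut_eq_zero_of_ofGerm_mem_annIdeal (u := u (-(n : ℤ))) (S := ∅) (by simpa using hn)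
    (c := (-1) ^ n) (pow_ne_zero _ (by norm_num)) (fun φ => by
      have := (hF.coeff_mulProd hu ∅ φ).2
      rwa [Finset.card_empty, Nat.sub_zero] at this) (g := 1) (by
        rw [h0, annIdeal_zero]; exact Submodule.mem_top)
  rw [map_one] at h
  have h1 : ∀ᶠ x : RSpace n in 𝓝 0, (1 : ℂ) = 0 := AnGerm.mk_eq_zero (f := fun _ => 1)
    (hf := analyticAt_const).1 h
  exact one_ne_zero h1.self_of_nhds

end Coefficients

/-! ### Existence of the complex power -/

section Existence

variable {n : ℕ}

/-- The distribution with density `w`. -/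
noncomputable def densityDist (w : RSpace n → ℂ) : CDistribution (⊤ : Opens (RSpace n)) :=
  TestFunction.integralAgainstBilinCLM (ContinuousLinearMap.mul ℂ ℂ) volume w

theorem densityDist_apply {w : RSpace n → ℂ} (hw : LocallyIntegrable w)
    (φ : 𝓓((⊤ : Opens (RSpace n)), ℂ)) : densityDist w φ = ∫ x, w x * φ x := by
  rw [densityDist, TestFunction.integralAgainstBilinCLM_eq_integral (hw.locallyIntegrableOn _)]
  simp only [ContinuousLinearMap.mul_apply', mul_comm]

/-- The distribution `(x₁⋯xₙ)_+^t` for `Re t > 0`. -/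
noncomputable def powerDist (n : ℕ) (t : ℂ) : CDistribution (⊤ : Opens (RSpace n)) :=
  densityDist fun x => plusPow (∏ i, x i) t

theorem powerDist_apply {t : ℂ} (ht : 0 < t.re) (φ : 𝓓((⊤ : Opens (RSpace n)), ℂ)) :
    powerDist n t φ = powerIntegral t φ :=
  densityDist_apply (((continuous_plusPow ht).comp
    (continuous_prod_coord Finset.univ)).locallyIntegrable) φ

/-- The coefficient `t_+^τ (log t)ᵏ / k!` of the expansion of `t_+^s` at `s = τ`. -/
noncomputable def plusPowLog (τ : ℂ) (k : ℕ) (y : ℝ) : ℂ :=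
  plusPow y τ * ((Real.log y : ℂ) ^ k / (k.factorial : ℂ))

theorem measurable_plusPowLog (τ : ℂ) (k : ℕ) : Measurable (plusPowLog τ k) :=
  (measurable_plusPow τ).mul
    (((Complex.measurable_ofReal.comp Real.measurable_log).pow_const k).div_const _)

theorem hasSum_plusPowLog (τ z : ℂ) (y : ℝ) :
    HasSum (fun k => z ^ k * plusPowLog τ k y) (plusPow y (τ + z)) := by
  rcases lt_or_ge 0 y with hy | hy
  · have h := (NormedSpace.expSeries_div_hasSum_exp (z * (Real.log y : ℂ))).mul_left (plusPow y τ)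
    rw [← Complex.exp_eq_exp_ℂ] at h
    rw [plusPow_of_pos hy (τ + z), add_mul, Complex.exp_add, ← plusPow_of_pos hy]
    refine h.congr_fun fun k => ?_
    rw [plusPowLog, mul_pow]
    ring
  · simp only [plusPowLog, plusPow_of_nonpos hy, zero_mul, mul_zero]
    exact hasSum_zero

theorem norm_plusPowLog_le {τ : ℂ} (hτ : 1 ≤ τ.re) {b : ℕ} (hb : τ.re + 1 ≤ b) (k : ℕ) (y : ℝ) :
    ‖plusPowLog τ k y‖ ≤ 2 * (1 + |y| ^ b) := by
  rcases lt_or_ge 0 y with hy | hy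
  · have hpow : ∀ c : ℝ, 0 ≤ c → c ≤ b → y ^ c ≤ 1 + y ^ b := by
      intro c h0 h1
      have := norm_plusPow_le (t := c) (a := 0) (b := b) (by simpa using h0) (by simpa using h1) hy
      rwa [norm_plusPow_of_pos hy, Complex.ofReal_re, Real.rpow_zero, Real.rpow_natCast] at this
    have hlog : |Real.log y| ^ k / (k.factorial : ℝ) ≤ y + y⁻¹ := by
      refine (Real.pow_div_factorial_le_exp _ (abs_nonneg _) k).trans ?_
      refine (Real.exp_abs_le _).trans_eq ?_
      rw [Real.exp_log hy, Real.exp_neg, Real.exp_log hy]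
    rw [plusPowLog, norm_mul, norm_plusPow_of_pos hy, norm_div, norm_pow, Complex.norm_real,
      Real.norm_eq_abs, Complex.norm_natCast, abs_of_pos hy]
    calc y ^ τ.re * (|Real.log y| ^ k / (k.factorial : ℝ)) ≤ y ^ τ.re * (y + y⁻¹) :=
          mul_le_mul_of_nonneg_left hlog (Real.rpow_nonneg hy.le _)
      _ = y ^ (τ.re + 1) + y ^ (τ.re - 1) := by
          rw [Real.rpow_add hy, Real.rpow_sub hy, Real.rpow_one]
          ring
      _ ≤ 2 * (1 + y ^ b) := by
          have h1 := hpow (τ.re + 1) (by linarith) hb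
          have h2 := hpow (τ.re - 1) (by linarith) (by linarith)
          linarith
  · rw [plusPowLog, plusPow_of_nonpos hy, zero_mul, norm_zero]
    positivity

/-- The power series expansion of `(x₁⋯xₙ)_+^s` at `s = τ`. -/
theorem hasSum_powerDist {τ : ℂ} (hτ : 1 ≤ τ.re) {s : ℂ} (hs : ‖s - τ‖ < 1)
    (φ : 𝓓((⊤ : Opens (RSpace n)), ℂ)) :
    HasSum (fun k : ℕ => (s - τ) ^ k * densityDist (fun x => plusPowLog τ k (∏ i, x i)) φ)
      (powerDist n s φ) := by
  have hf := continuous_prod_coord (n := n) Finset.univ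
  obtain ⟨b, hb⟩ := exists_nat_ge (τ.re + 1)
  have hmeas : ∀ k, Measurable fun x : RSpace n => plusPowLog τ k (∏ i, x i) := fun k =>
    (measurable_plusPowLog τ k).comp hf.measurable
  have hcont : Continuous fun x : RSpace n => 2 * (1 + |∏ i, x i| ^ b) := by fun_prop
  have hli : ∀ k, LocallyIntegrable fun x : RSpace n => plusPowLog τ k (∏ i, x i) := fun k =>
    hcont.locallyIntegrable.mono (hmeas k).aestronglyMeasurable (Eventually.of_forall fun x =>
      (norm_plusPowLog_le hτ hb k _).trans (le_abs_self _))
  have hre : 0 < s.re := by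
    have h1 := (Complex.abs_re_le_norm (s - τ)).trans_lt hs
    rw [Complex.sub_re, abs_lt] at h1
    linarith
  rw [powerDist_apply hre]
  have hB : Integrable fun x : RSpace n => (((2 * (1 + |∏ i, x i| ^ b) : ℝ)) : ℂ) * φ x :=
    TestFunction.integrable_mul (Complex.continuous_ofReal.comp hcont) φ
  have hgeo : ∀ B : ℝ, HasSum (fun k : ℕ => ‖s - τ‖ ^ k * B) ((1 - ‖s - τ‖)⁻¹ * B) := fun B =>
    (hasSum_geometric_of_lt_one (norm_nonneg _) hs).mul_right B
  have hterm : ∀ k : ℕ, (s - τ) ^ k * densityDist (fun x => plusPowLog τ k (∏ i, x i)) φ =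
      ∫ x, (s - τ) ^ k * plusPowLog τ k (∏ i, x i) * φ x := by
    intro k
    rw [densityDist_apply (hli k), ← integral_const_mul]
    simp only [mul_assoc]
  simp only [hterm]
  refine hasSum_integral_of_dominated_convergence
    (fun k x => ‖s - τ‖ ^ k * ‖(((2 * (1 + |∏ i, x i| ^ b) : ℝ)) : ℂ) * φ x‖)
    (fun k => (((hmeas k).const_mul _).mul φ.continuous.measurable).aestronglyMeasurable)
    (fun k => Eventually.of_forall fun x => ?_)
    (Eventually.of_forall fun x => (hgeo _).summable) ?_ (Eventually.of_forall fun x => ?_)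
  · rw [mul_assoc, norm_mul, norm_mul, norm_mul, norm_pow]
    gcongr
    rw [Complex.norm_real]
    exact (norm_plusPowLog_le hτ hb k _).trans (le_abs_self _)
  · simp only [(hgeo _).tsum_eq]
    exact hB.norm.const_mul _
  · have := (hasSum_plusPowLog τ (s - τ) (∏ i, x i)).mul_right (φ x)
    rwa [add_sub_cancel] at this

/-- The mixed derivative `∂₁⋯∂ₙ` of test functions. -/
noncomputable def mixedDel (n : ℕ) :
    𝓓((⊤ : Opens (RSpace n)), ℂ) →L[ℂ] 𝓓((⊤ : Opens (RSpace n)), ℂ) :=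
  testDelPow (indicatorIndex (∅ : Finset (Fin n))ᶜ)

/-- The factor `∏ (-(s + j + 1))⁻ⁿ`, `j < N`, produced by `N` integrations by parts in each
variable. At its poles it takes the value `0`, which is irrelevant. -/
noncomputable def shiftFactor (n N : ℕ) (s : ℂ) : ℂ :=
  ∏ j ∈ Finset.range N, ((-(s + j + 1)) ^ n)⁻¹

theorem shiftFactor_add (N M : ℕ) (s : ℂ) :
    shiftFactor n (N + M) s = shiftFactor n N s * shiftFactor n M (s + N) := by
  rw [shiftFactor, Finset.prod_range_add]
  congr 1
  refine Finset.prod_congr rfl fun j _ => ?_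
  push_cast
  ring_nf

/-- The analytic continuation of the complex power to the half-plane `Re s > -N`. -/
noncomputable def continuedPower (n N : ℕ) (s : ℂ) : CDistribution (⊤ : Opens (RSpace n)) :=
  shiftFactor n N s • (powerDist n (s + N)).comp (mixedDel n ^ N)

theorem continuedPower_apply (N : ℕ) (s : ℂ) (φ : 𝓓((⊤ : Opens (RSpace n)), ℂ)) :
    continuedPower n N s φ = shiftFactor n N s * powerDist n (s + N) ((mixedDel n ^ N) φ) := rfl

theorem continuedPower_eq_powerDist {s : ℂ} (hs : 0 < s.re) (N : ℕ) :
    continuedPower n N s = powerDist n s := by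
  ext φ
  rw [continuedPower_apply]
  induction N generalizing φ with
  | zero => simp [shiftFactor]
  | succ N ih =>
    have hre : 0 < (s + N).re := by
      rw [Complex.add_re, Complex.natCast_re]; positivity
    have hre1 : 0 < (s + N + 1).re := by
      rw [Complex.add_re, Complex.one_re]; positivity
    have hne : -(s + N + 1) ≠ 0 := neg_ne_zero.2 fun h => by simp [h] at hre1
    have h1 := powerIntegral_add_one hre ∅ ((mixedDel n ^ N) φ)
    rw [mulProd_empty, Finset.card_empty, Nat.sub_zero, ← powerDist_apply hre1,
      ← powerDist_apply hre] at h1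
    have h2 : (mixedDel n ^ (N + 1)) φ =
        testDelPow (indicatorIndex (∅ : Finset (Fin n))ᶜ) ((mixedDel n ^ N) φ) := by
      rw [pow_succ']; rfl
    rw [← ih φ, h2, Nat.cast_succ, ← add_assoc, h1, shiftFactor, Finset.prod_range_succ,
      ← shiftFactor, mul_assoc, inv_mul_cancel_left₀ (pow_ne_zero _ hne)]

/-- The continuations to different half-planes agree. -/
theorem continuedPower_add {N : ℕ} {s : ℂ} (hs : 0 < (s + N).re) (M : ℕ) :
    continuedPower n (N + M) s = continuedPower n N s := by
  ext φ
  have h : mixedDel n ^ (N + M) = mixedDel n ^ M * mixedDel n ^ N := by rw [add_comm, pow_add]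
  rw [continuedPower_apply, continuedPower_apply, ← continuedPower_eq_powerDist hs M,
    continuedPower_apply, shiftFactor_add, mul_assoc, h, Nat.cast_add, add_assoc]
  rfl

theorem meromorphicAt_shiftFactor (N : ℕ) (s₀ : ℂ) : MeromorphicAt (shiftFactor n N) s₀ := by
  unfold shiftFactor
  fun_prop

/-- The Laurent expansion is the Cauchy product of those of the shift factor and of the power. -/
theorem hasLaurentExpansionAt_continuedPower {N : ℕ} {s₀ : ℂ} (hs₀ : 1 ≤ (s₀ + N).re) :
    ∃ u, HasLaurentExpansionAt (continuedPower n N) s₀ u := by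
  obtain ⟨p, hp⟩ := meromorphicAt_shiftFactor (n := n) N s₀
  obtain ⟨P, hP⟩ := hp
  set v : ℕ → CDistribution (⊤ : Opens (RSpace n)) := fun k => ∑ a ∈ Finset.range (k + 1),
    P.coeff a • (densityDist fun x => plusPowLog (s₀ + N) (k - a) (∏ i, x i)).comp (mixedDel n ^ N)
    with hv
  refine ⟨fun j => if j < -(p : ℤ) then 0 else v (j + p).toNat, ⟨p, fun j hj => if_pos hj⟩, ?_⟩
  have hball : ∀ᶠ s in 𝓝[≠] s₀, ‖s - s₀‖ < 1 :=
    nhdsWithin_le_nhds (Filter.mem_of_superset (Metric.ball_mem_nhds s₀ one_pos)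
        fun s hs => mem_ball_iff_norm.1 hs)
  filter_upwards [nhdsWithin_le_nhds (hasFPowerSeriesAt_iff'.1 hP), hball, self_mem_nhdsWithin]
    with s h1 h2 hne φ
  have hsub : s - s₀ ≠ 0 := sub_ne_zero.2 hne
  have h3 := hasSum_powerDist hs₀ (s := s + N) (by simpa using h2) ((mixedDel n ^ N) φ)
  rw [add_sub_add_right_eq_sub] at h3
  have h4 := hasSum_sum_range_mul_of_summable_norm h1.summable.norm h3.summable.norm
  rw [h1.tsum_eq, h3.tsum_eq] at h4
  have h5 : HasSum (fun k : ℕ => (s - s₀) ^ k * v k φ)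
      ((s - s₀) ^ p * continuedPower n N s φ) := by
    rw [continuedPower_apply, ← mul_assoc]
    refine h4.congr_fun fun k => ?_
    rw [hv, sum_apply, Finset.mul_sum]
    refine Finset.sum_congr rfl fun a ha => ?_
    have hpow : (s - s₀) ^ k = (s - s₀) ^ a * (s - s₀) ^ (k - a) := by
      rw [← pow_add, Nat.add_sub_cancel' (Nat.lt_succ_iff.1 (Finset.mem_range.1 ha))]
    rw [hpow, smul_apply, smul_eq_mul, smul_eq_mul, ContinuousLinearMap.comp_apply]
    ring
  have h6 : HasSum (fun j : ℤ => (s - s₀) ^ j * (if j < 0 then 0 else v j.toNat) φ)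
      ((s - s₀) ^ p * continuedPower n N s φ) := by
    refine (Function.Injective.hasSum_iff (g := fun k : ℕ => (k : ℤ)) Nat.cast_injective
      fun j hj => ?_).1 ?_
    · have : j < 0 := by
        by_contra hj'
        exact hj ⟨j.toNat, Int.toNat_of_nonneg (not_lt.1 hj')⟩
      simp [this]
    · refine h5.congr_fun fun k => ?_
      simp [(Int.natCast_nonneg k).not_gt]
  have h7 := h6.laurent_mul_zpow (c := fun j => (if j < 0 then 0 else v j.toNat) φ) hne (-p)
  rw [zpow_neg, zpow_natCast, inv_mul_cancel_left₀ (pow_ne_zero _ hsub)] at h7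
  refine h7.congr_fun fun j => ?_
  simp only [sub_neg_eq_add, lt_neg_iff_add_neg]

/-- At `s` the continuation to some half-plane containing `s` is used; near a given point all
choices agree with a single continuation. -/
theorem exists_isComplexPower (n : ℕ) :
    ∃ F : ℂ → CDistribution (⊤ : Opens (RSpace n)), IsComplexPower n F := by
  have hN : ∀ s : ℂ, 0 < (s + ((⌈|s.re|⌉₊ + 1 : ℕ) : ℂ)).re := by
    intro s
    have h1 := Nat.le_ceil |s.re|
    have h2 := neg_abs_le s.re
    rw [Complex.add_re, Complex.natCast_re]
    push_cast
    linarith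
  refine ⟨fun s => continuedPower n (⌈|s.re|⌉₊ + 1) s, fun s hs φ => ?_, fun s₀ => ?_⟩
  · change continuedPower n _ s φ = _
    rw [continuedPower_eq_powerDist hs, powerDist_apply hs]
    rfl
  · set M := ⌈|s₀.re|⌉₊ + 2 with hM
    obtain ⟨u, hm, hu⟩ := hasLaurentExpansionAt_continuedPower (n := n) (N := M) (s₀ := s₀) (by
      have h1 := Nat.le_ceil |s₀.re|
      have h2 := neg_abs_le s₀.re
      rw [Complex.add_re, Complex.natCast_re, hM]
      push_cast
      linarith)
    refine ⟨u, hm, ?_⟩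
    have hball : ∀ᶠ s in 𝓝[≠] s₀, ‖s - s₀‖ < 1 :=
      nhdsWithin_le_nhds (Filter.mem_of_superset (Metric.ball_mem_nhds s₀ one_pos)
        fun s hs => mem_ball_iff_norm.1 hs)
    filter_upwards [hu, hball] with s h1 h2
    have h3 : ⌈|s.re|⌉₊ + 1 ≤ M := by
      have h4 : |s.re| ≤ |s₀.re| + 1 := by
        have h5 := (Complex.abs_re_le_norm (s - s₀)).trans h2.le
        rw [Complex.sub_re] at h5
        linarith [abs_sub_abs_le_abs_sub s.re s₀.re]
      have := Nat.ceil_mono h4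
      rw [Nat.ceil_add_one (abs_nonneg _)] at this
      omega
    obtain ⟨k, hk⟩ := Nat.exists_eq_add_of_le h3
    rw [hk, continuedPower_add (hN s)] at h1
    exact h1

end Existence

/-- `Ideal` of the noncommutative ring `diffOpStalk n` means left ideal. -/
theorem proposition1 (n : ℕ) (hn : 0 < n) :
    (∃ F : ℂ → CDistribution (⊤ : Opens (RSpace n)), IsComplexPower n F) ∧
    ∀ F : ℂ → CDistribution (⊤ : Opens (RSpace n)), IsComplexPower n F →
      ∀ u : ℤ → CDistribution (⊤ : Opens (RSpace n)), HasLaurentExpansionAt F (-1) u →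
        (u (-(n : ℤ)) ≠ 0 ∧ ∀ j : ℤ, j < -(n : ℤ) → u j = 0) ∧
        ∀ k : ℕ, k < n →
          annStalk (u (-(n : ℤ) + (k : ℤ))) =
            (Ideal.span (annGenerators n hn (k + 1)) : Set (diffOpStalk n)) := by
  refine ⟨exists_isComplexPower n, fun F hF u hu => ⟨⟨hF.coeff_neg_ne_zero hu hn,
    fun j hj => hF.coeff_eq_zero hu hj⟩, fun k hk => ?_⟩⟩
  have h := congrArg (fun I : Ideal (diffOpStalk n) => (I : Set (diffOpStalk n)))
    (hF.annIdeal_coeff hu hn hk)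
  exact h
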